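/- For integers $n$ and $d\le n$, let $d$-Junta be the set of all $f:\{0,1\}^n\to\{0,1\}$ with at most $d$ relevant variables, where $x_i$ is relevant in $f$ if changing the $i$-th bit changes the value of $f$ at some assignment. A deterministic non-adaptive algorithm gets $n$ and $d$, computes a list of assignments (membership queries) that depends on $n$ and $d$ only, receives the values of an unknown target $f$ at all of them at once, and then computes an output; it learns $d$-Junta if for every target $f\in d$-Junta its output is a representation of a function that is identical to $f$ (here: a list of at most $d$ variables together with a truth table on these variables). Theorem. There is a deterministic non-adaptive algorithm that, for all integers $n\ge 2$ and $1\le d\le n$, learns $d$-Junta in time $\mathrm{poly}(d^d,n)$ with $O(d^3 2^d\log n)$ queries. That is, there are a single algorithm (a program for a random access machine with unit-cost addition and subtraction) and a constant $c$ such that for all such $n$ and $d$ the algorithm learns $d$-Junta in at most $c\,(d^d+n)^c$ steps with at most $c\,d^3 2^d\log n$ queries. -/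

import Mathlib

namespace JuntaLearning

/-! Random access machines. The machine has registers holding natural numbers and finitely many
(per program) unbounded arrays of natural numbers. The only arithmetic is addition and truncated
subtraction, each at unit cost, so a run of `t` steps handles numbers of `O(t)` bits only and the
model is polynomially equivalent to the multitape Turing machine. Programs are written in
structured form (sequencing, branching, loops) instead of with jumps. -/

/-- A state: `reg x` is the content of register `x`, and `mem k i` is cell `i` of array `k`. -/
structure State where
  reg : ℕ → ℕ
  mem : ℕ → ℕ → ℕ

/-- Expressions: constants, registers, sums, truncated differences, and the cell of a fixed array
at a computed address. -/
inductive Expr where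
  | const (c : ℕ)
  | reg (x : ℕ)
  | add (e₁ e₂ : Expr)
  | sub (e₁ e₂ : Expr)
  | load (k : ℕ) (e : Expr)

/-- The value of an expression in a state. -/
def Expr.eval (s : State) : Expr → ℕ
  | .const c => c
  | .reg x => s.reg x
  | .add e₁ e₂ => e₁.eval s + e₂.eval s
  | .sub e₁ e₂ => e₁.eval s - e₂.eval s
  | .load k e => s.mem k (e.eval s)

/-- The number of steps taken to evaluate an expression: one for each of its nodes. -/
def Expr.cost : Expr → ℕ
  | .const _ => 1
  | .reg _ => 1
  | .add e₁ e₂ => e₁.cost + e₂.cost + 1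
  | .sub e₁ e₂ => e₁.cost + e₂.cost + 1
  | .load _ e => e.cost + 1

/-- Programs. `ite a b p q` runs `p` if `a < b` and `q` otherwise; `loop a b p` runs `p` as long
as `a < b`. -/
inductive Prog where
  | skip
  | assign (x : ℕ) (e : Expr)
  | store (k : ℕ) (a e : Expr)
  | seq (p q : Prog)
  | ite (a b : Expr) (p q : Prog)
  | loop (a b : Expr) (p : Prog)

/-- The state after writing `v` into register `x`. -/
def State.setReg (s : State) (x v : ℕ) : State :=
  { s with reg := Function.update s.reg x v }

/-- The state after writing `v` into cell `i` of array `k`. -/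
def State.setMem (s : State) (k i v : ℕ) : State :=
  { s with mem := Function.update s.mem k (Function.update (s.mem k) i v) }

/-- `Exec p s t s'`: the program `p`, started in state `s`, halts after exactly `t` steps in
state `s'`. -/
inductive Exec : Prog → State → ℕ → State → Prop where
  | skip (s : State) : Exec .skip s 1 s
  | assign (x : ℕ) (e : Expr) (s : State) :
      Exec (.assign x e) s (e.cost + 1) (s.setReg x (e.eval s))
  | store (k : ℕ) (a e : Expr) (s : State) :
      Exec (.store k a e) s (a.cost + e.cost + 1) (s.setMem k (a.eval s) (e.eval s))
  | seq {p q : Prog} {s₀ s₁ s₂ : State} {t₁ t₂ : ℕ} :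
      Exec p s₀ t₁ s₁ → Exec q s₁ t₂ s₂ → Exec (.seq p q) s₀ (t₁ + t₂) s₂
  | ite_true {a b : Expr} {p q : Prog} {s s₁ : State} {t : ℕ} :
      a.eval s < b.eval s → Exec p s t s₁ →
        Exec (.ite a b p q) s (a.cost + b.cost + 1 + t) s₁
  | ite_false {a b : Expr} {p q : Prog} {s s₁ : State} {t : ℕ} :
      ¬ a.eval s < b.eval s → Exec q s t s₁ →
        Exec (.ite a b p q) s (a.cost + b.cost + 1 + t) s₁
  | loop_true {a b : Expr} {p : Prog} {s s₁ s₂ : State} {t₁ t₂ : ℕ} :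
      a.eval s < b.eval s → Exec p s t₁ s₁ → Exec (.loop a b p) s₁ t₂ s₂ →
        Exec (.loop a b p) s (a.cost + b.cost + 1 + t₁ + t₂) s₂
  | loop_false {a b : Expr} {p : Prog} {s : State} :
      ¬ a.eval s < b.eval s → Exec (.loop a b p) s (a.cost + b.cost + 1) s

/-! Boolean functions and juntas. -/

/-- The variable `i` is relevant in `f`: some assignment is sensitive to it. -/
def Relevant {n : ℕ} (f : (Fin n → Bool) → Bool) (i : Fin n) : Prop :=
  ∃ a : Fin n → Bool, f (Function.update a i false) ≠ f (Function.update a i true)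

/-- The class `d`-Junta on `n` variables: at most `d` variables are relevant. -/
def Junta (n d : ℕ) : Set ((Fin n → Bool) → Bool) :=
  {f | {i : Fin n | Relevant f i}.ncard ≤ d}

/-! Non-adaptive learning from membership queries: a first program computes all the queries from
`n` and `d`, then all the answers are handed over at once, and a second program, which goes on
from the state that the first one has left, computes a hypothesis. -/

/-- The start: `n` in register `0`, `d` in register `1`, and zeros everywhere else. -/
def start (n d : ℕ) : State where
  reg x := if x = 0 then n else if x = 1 then d else 0
  mem _ _ := 0

/-- The number of queries asked in the state `s`. -/
def numQueries (s : State) : ℕ := s.reg 0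

/-- The `j`-th query asked in the state `s`: its `n` bits are the cells `j * n`, …,
`j * n + (n - 1)` of array `0`. -/
def query (n : ℕ) (s : State) (j : ℕ) : Fin n → Bool :=
  fun i => decide (s.mem 0 (j * n + i) ≠ 0)

/-- The answers for the target `f` are put in array `1`; everything else is kept. -/
def answer {n : ℕ} (f : (Fin n → Bool) → Bool) (s : State) : State where
  reg := s.reg
  mem k j := if k = 1 ∧ j < numQueries s then (f (query n s j)).toNat else s.mem k j

/-- The number of variables of the hypothesis given by the state `s`. -/
def hypArity (s : State) : ℕ := s.reg 0

/-- The row of the truth table selected by `x`: its `j`-th binary digit is the value of the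
`j`-th variable of the hypothesis, whose index is in cell `j` of array `2`. -/
def hypRow (n : ℕ) (s : State) (x : Fin n → Bool) : ℕ :=
  ∑ j ∈ Finset.range (hypArity s),
    (if h : s.mem 2 j < n then (x ⟨s.mem 2 j, h⟩).toNat else 0) * 2 ^ j

/-- The hypothesis given by the state `s`: its truth table is in array `3`. -/
def hypothesis (n : ℕ) (s : State) : (Fin n → Bool) → Bool :=
  fun x => decide (s.mem 3 (hypRow n s x) ≠ 0)

/-- The state `s` outputs `f`, by a list of at most `d` variables and a truth table on them. -/
def Outputs {n : ℕ} (d : ℕ) (s : State) (f : (Fin n → Bool) → Bool) : Prop :=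
  hypArity s ≤ d ∧ (∀ j < hypArity s, s.mem 2 j < n) ∧ hypothesis n s = f

/-- The deterministic non-adaptive algorithm with query program `ask` and reconstruction program
`reconstruct` exactly learns `d`-Junta on `n` variables, with at most `Q` membership queries and
in at most `T` steps (asking a query counts as `n` steps). -/
def LearnsJunta (ask reconstruct : Prog) (n d : ℕ) (Q : ℝ) (T : ℕ) : Prop :=
  ∃ (t₁ : ℕ) (s₁ : State), Exec ask (start n d) t₁ s₁ ∧
    (numQueries s₁ : ℝ) ≤ Q ∧
    ∀ f ∈ Junta n d, ∃ (t₂ : ℕ) (s₂ : State), Exec reconstruct (answer f s₁) t₂ s₂ ∧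
      Outputs d s₂ f ∧ t₁ + numQueries s₁ * n + t₂ ≤ T

end JuntaLearning

/-! Hashing. Let `q` be a prime of order `d ^ 2 * log n`. Variable `i` is read as the polynomial
over `ZMod q` whose coefficients are its base-`q` digits, `k` of them, and each of `m = 2 * d ^ 2 *
k` points `α` sends `i` to the value of its polynomial at `α`. Two such polynomials agree at fewer
than `k` points, so some `α` separates any `d + 1` given variables (`exists_injOn`). For every `α`
the same `N` assignments to the `q` classes are pulled back to queries, which makes `m * N` queries
in all.

Choice of the `N` assignments. The family has to be `Determining`: if a function of one `d`-tuple of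
bits and a function of another agree on the family, they agree everywhere. For a fixed pair of
tuples, take the bipartite graph whose vertices are the `2 ^ d` restrictions to each tuple and in
which every assignment is an edge. The requirement holds once the chosen edges have the same
connected components as all edges together. Call a class of the current partition bad if some edge
leaves it. Membership in a bad class, read off from either side, gives two `d`-juntas that differ
somewhere. By `weight_bound` they differ on a fraction of at least `1 / (4 * 2 ^ d)` of the `q ^ (2
* d)` candidates, which are the polynomials of degree below `2 * d` with values thresholded at `q /
2`. Hence the best candidate lowers the number of bad classes, totalled over all pairs of tuples, by
a fraction `1 / (8 * 2 ^ d)` (`potential_le_score`, `potential_mergeAll`), and `N = O(2 ^ d * d *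
log q)` greedy rounds leave none (`decay`). As `k * log q = O(log n)`, the number of queries is `O(d
^ 3 * 2 ^ d * log n)`.

Reconstruction. If the answers for one `α` look like a function of some tuple, the hashed target
really is a function of it (`eq_of_consistent`); so its sensitive classes are those contained in all
consistent tuples (`sensitive_iff`). The points `α` with the most sensitive classes are exactly
those that separate the relevant variables (`maximal_iff`), and a variable is relevant iff its class
is sensitive for all of them (`mem_relevantSet_iff`). Every assignment to the relevant variables
occurs among the queries (`exists_query`), so the truth table can be read off from the answers.

Time. All searches range over `q ^ O(d)` objects, and `q ^ d` is polynomial in `d ^ d + n` because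
`(log n) ^ d ≤ d ^ d * 2 ^ (log n + d)`. The algorithm is written in a small language whose loops
are bounded by registers. If these hold at most `B`, the running time is at most `(B + 10) ^ w`,
where `w` depends on the program text only. -/

namespace JuntaLearning

/-! A small language of bounded loops, compiled to programs. -/

/-- Terms: `mul p a b` is `a * min b p` and `sum x p e` is `∑ x < p, e`, for registers `p`. -/
inductive Term where
  | const (c : ℕ)
  | var (x : ℕ)
  | add (a b : Term)
  | sub (a b : Term)
  | load (k : ℕ) (a : Term)
  | ite (a b e f : Term)
  | mul (p : ℕ) (a b : Term)
  | sum (x p : ℕ) (e : Term)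

namespace Term

/-- The value of a term. -/
def eval (m : ℕ → ℕ → ℕ) : Term → (ℕ → ℕ) → ℕ
  | const c, _ => c
  | var x, ρ => ρ x
  | add a b, ρ => a.eval m ρ + b.eval m ρ
  | sub a b, ρ => a.eval m ρ - b.eval m ρ
  | load k a, ρ => m k (a.eval m ρ)
  | ite a b e f, ρ => if a.eval m ρ < b.eval m ρ then e.eval m ρ else f.eval m ρ
  | mul p a b, ρ => a.eval m ρ * min (b.eval m ρ) (ρ p)
  | sum x p e, ρ => ∑ i ∈ Finset.range (ρ p), e.eval m (Function.update ρ x i)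

/-- All registers that occur lie below `T`. -/
def Below (T : ℕ) : Term → Prop
  | const _ => True
  | var x => x < T
  | add a b => a.Below T ∧ b.Below T
  | sub a b => a.Below T ∧ b.Below T
  | load _ a => a.Below T
  | ite a b e f => a.Below T ∧ b.Below T ∧ e.Below T ∧ f.Below T
  | mul p a b => p < T ∧ a.Below T ∧ b.Below T
  | sum x p e => x < T ∧ p < T ∧ e.Below T

/-- With this instance the register bounds of the concrete programs are settled by `decide`. -/
instance decBelow (T : ℕ) : (e : Term) → Decidable (e.Below T)
  | const _ => inferInstanceAs (Decidable True)
  | var x => inferInstanceAs (Decidable (x < T))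
  | add a b => @instDecidableAnd _ _ (decBelow T a) (decBelow T b)
  | sub a b => @instDecidableAnd _ _ (decBelow T a) (decBelow T b)
  | load _ a => decBelow T a
  | ite a b e f => @instDecidableAnd _ _ (decBelow T a) (@instDecidableAnd _ _ (decBelow T b)
      (@instDecidableAnd _ _ (decBelow T e) (decBelow T f)))
  | mul p a b => @instDecidableAnd _ _ (inferInstanceAs (Decidable (p < T)))
      (@instDecidableAnd _ _ (decBelow T a) (decBelow T b))
  | sum x p e => @instDecidableAnd _ _ (inferInstanceAs (Decidable (x < T)))
      (@instDecidableAnd _ _ (inferInstanceAs (Decidable (p < T))) (decBelow T e))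

theorem Below.mono {T T' : ℕ} (h : T ≤ T') : ∀ {e : Term}, e.Below T → e.Below T'
  | const _, _ => trivial
  | var _, he => lt_of_lt_of_le he h
  | add _ _, he => ⟨he.1.mono h, he.2.mono h⟩
  | sub _ _, he => ⟨he.1.mono h, he.2.mono h⟩
  | load _ a, he => Below.mono (e := a) h he
  | ite _ _ _ _, he => ⟨he.1.mono h, he.2.1.mono h, he.2.2.1.mono h, he.2.2.2.mono h⟩
  | mul _ _ _, he => ⟨lt_of_lt_of_le he.1 h, he.2.1.mono h, he.2.2.mono h⟩
  | sum _ _ _, he => ⟨lt_of_lt_of_le he.1 h, lt_of_lt_of_le he.2.1 h, he.2.2.mono h⟩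

/-- Compiled code disturbs registers from `T` on only. The values of later subterms, computed in
intermediate states, are therefore those of the initial state. -/
theorem eval_congr (m : ℕ → ℕ → ℕ) {T : ℕ} : ∀ {e : Term} {ρ ρ' : ℕ → ℕ}, e.Below T →
    (∀ x < T, ρ x = ρ' x) → e.eval m ρ = e.eval m ρ'
  | const _, _, _, _, _ => rfl
  | var x, _, _, he, h => h x he
  | add a b, _, _, he, h => by simp only [eval, eval_congr m he.1 h, eval_congr m he.2 h]
  | sub a b, _, _, he, h => by simp only [eval, eval_congr m he.1 h, eval_congr m he.2 h]
  | load _ a, _, _, he, h => by simp only [eval, eval_congr m (e := a) he h]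
  | ite a b e f, _, _, he, h => by
      simp only [eval, eval_congr m he.1 h, eval_congr m he.2.1 h, eval_congr m he.2.2.1 h,
        eval_congr m he.2.2.2 h]
  | mul p a b, _, _, he, h => by
      simp only [eval, eval_congr m he.2.1 h, eval_congr m he.2.2 h, h p he.1]
  | sum x p e, ρ, ρ', he, h => by
      simp only [eval, h p he.2.1]
      refine Finset.sum_congr rfl fun i _ => eval_congr m he.2.2 fun y hy => ?_
      by_cases hyx : y = x
      · simp [hyx]
      · simp [hyx, h y hy]

/-- The exponent in the time bound. -/
def weight : Term → ℕ
  | const _ => 1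
  | var _ => 1
  | add a b => a.weight + b.weight + 1
  | sub a b => a.weight + b.weight + 1
  | load _ a => a.weight + 1
  | ite a b e f => a.weight + b.weight + e.weight + f.weight + 2
  | mul _ a b => a.weight + b.weight + 3
  | sum _ _ e => e.weight + 3

/-- The program that puts the value into register `T` and uses the registers from `T` on. -/
def compile : Term → ℕ → Prog
  | const c, T => .assign T (.const c)
  | var x, T => .assign T (.reg x)
  | add a b, T => .seq (a.compile T) (.seq (b.compile (T + 1))
      (.assign T (.add (.reg T) (.reg (T + 1)))))
  | sub a b, T => .seq (a.compile T) (.seq (b.compile (T + 1))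
      (.assign T (.sub (.reg T) (.reg (T + 1)))))
  | load k a, T => .seq (a.compile T) (.assign T (.load k (.reg T)))
  | ite a b e f, T => .seq (a.compile T) (.seq (b.compile (T + 1))
      (.ite (.reg T) (.reg (T + 1)) (e.compile T) (f.compile T)))
  | mul p a b, T => .seq (a.compile (T + 1)) (.seq (b.compile (T + 2))
      (.seq (.ite (.reg p) (.reg (T + 2)) (.assign (T + 2) (.reg p)) .skip)
      (.seq (.assign T (.const 0)) (.seq (.assign (T + 3) (.const 0))
      (.loop (.reg (T + 3)) (.reg (T + 2))
        (.seq (.assign T (.add (.reg T) (.reg (T + 1))))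
          (.assign (T + 3) (.add (.reg (T + 3)) (.const 1)))))))))
  -- The bound is copied before `x` is reset, and the old content of `x` is saved and put back at
  -- the end, so that no register below `T` is changed in total.
  | sum x p e, T => .seq (.assign (T + 2) (.reg p)) (.seq (.assign (T + 1) (.reg x))
      (.seq (.assign T (.const 0)) (.seq (.assign x (.const 0))
      (.seq (.loop (.reg x) (.reg (T + 2))
        (.seq (e.compile (T + 3)) (.seq (.assign T (.add (.reg T) (.reg (T + 3))))
          (.assign x (.add (.reg x) (.const 1))))))
        (.assign x (.reg (T + 1)))))))

end Term

/-! ### Running time of compiled terms -/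

/-- A loop whose body takes at most `c` steps and advances the counter. -/
theorem exec_counter_loop {x b : ℕ} {p : Prog} {n c : ℕ} (I : ℕ → State → Prop)
    (hx : ∀ i s, I i s → s.reg x = i ∧ s.reg b = n)
    (hp : ∀ i s, i < n → I i s → ∃ t s', Exec p s t s' ∧ t ≤ c ∧ I (i + 1) s') :
    ∀ j i s, i + j = n → I i s →
      ∃ t s', Exec (.loop (.reg x) (.reg b) p) s t s' ∧ t ≤ j * (c + 3) + 3 ∧ I n s' := by
  intro j
  induction j with
  | zero =>
    intro i s hi hI
    obtain rfl : i = n := by omega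
    refine ⟨_, _, Exec.loop_false ?_, ?_, hI⟩
    · simp [Expr.eval, hx i s hI]
    · simp [Expr.cost]
  | succ j ih =>
    intro i s hi hI
    obtain ⟨t, s', h1, h2, h3⟩ := hp i s (by omega) hI
    obtain ⟨t', s'', h4, h5, h6⟩ := ih (i + 1) s' (by omega) h3
    refine ⟨_, s'', Exec.loop_true ?_ h1 h4, ?_, h6⟩
    · simp only [Expr.eval, hx i s hI]; omega
    · simp only [Expr.cost, add_mul]; omega

/-- Costs are bounded by `β ^ weight`. Running two pieces in sequence adds their exponents plus one,
and the slack of `8` pays for the constant number of further steps. -/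
theorem pow_sum_bound {β a b : ℕ} (hβ : 10 ≤ β) :
    β ^ a + β ^ b + 8 ≤ β ^ (a + b + 1) := by
  have ha : 1 ≤ β ^ a := Nat.one_le_pow _ _ (by omega)
  have hb : 1 ≤ β ^ b := Nat.one_le_pow _ _ (by omega)
  have : β ^ (a + b + 1) = β * (β ^ a * β ^ b) := by ring
  rw [this]
  have h1 : β ^ a ≤ β ^ a * β ^ b := Nat.le_mul_of_pos_right _ hb
  have h2 : β ^ b ≤ β ^ a * β ^ b := Nat.le_mul_of_pos_left _ ha
  nlinarith

/-- One extra factor `B + 10` pays for the at most `B` iterations, a second one for the constant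
overhead of each of them. -/
theorem pow_loop_bound {B a j : ℕ} (h : j ≤ B) :
    j * (10 + (B + 10) ^ a) + 20 ≤ (B + 10) ^ (a + 2) := by
  have ha : 1 ≤ (B + 10) ^ a := Nat.one_le_pow _ _ (by omega)
  have : (B + 10) ^ (a + 2) = (B + 10) * ((B + 10) * (B + 10) ^ a) := by ring
  rw [this]
  have h1 : j * (10 + (B + 10) ^ a) ≤ B * (10 + (B + 10) ^ a) := Nat.mul_le_mul_right _ h
  nlinarith [Nat.zero_le (B * (B + 10) ^ a)]

theorem pow_step {β a b : ℕ} (hβ : 10 ≤ β) (h : a < b) : β ^ a + 9 ≤ β ^ b := by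
  have ha : 1 ≤ β ^ a := Nat.one_le_pow _ _ (by omega)
  have h1 : β ^ (a + 1) ≤ β ^ b := Nat.pow_le_pow_right (by omega) h
  rw [pow_succ] at h1
  nlinarith

namespace Term

/-- Only the registers below `V` need a bound, because only they limit loops; a product is a
repeated addition whose count is clipped by such a register. Computed values and memory contents may
be arbitrarily large. `V` stays fixed while the scratch position `T` moves up in the recursion. -/
theorem exec_compile {B V : ℕ} : ∀ (e : Term) (T : ℕ) (s : State), V ≤ T → e.Below V →
    (∀ x < V, s.reg x ≤ B) → ∃ t s', Exec (e.compile T) s t s' ∧ t ≤ (B + 10) ^ e.weight ∧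
      s'.mem = s.mem ∧ s'.reg T = e.eval s.mem s.reg ∧ ∀ x < T, s'.reg x = s.reg x := by
  have h10 : 10 ≤ B + 10 := by omega
  intro e
  induction e with
  | const c =>
    intro T s hV he hB
    refine ⟨_, _, Exec.assign _ _ _, by simp [Expr.cost, weight], rfl, ?_, ?_⟩
    · simp [State.setReg, Expr.eval, eval]
    · intro x hx; simp [State.setReg, hx.ne]
  | var c =>
    intro T s hV he hB
    refine ⟨_, _, Exec.assign _ _ _, by simp [Expr.cost, weight], rfl, ?_, ?_⟩
    · simp [State.setReg, Expr.eval, eval]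
    · intro x hx; simp [State.setReg, hx.ne]
  | add a b iha ihb =>
    intro T s hV he hB
    obtain ⟨t1, s1, h1, c1, m1, e1, r1⟩ := iha T s hV he.1 hB
    obtain ⟨t2, s2, h2, c2, m2, e2, r2⟩ := ihb (T + 1) s1 (by omega) he.2
      (fun x hx => by rw [r1 x (by omega)]; exact hB x hx)
    refine ⟨_, _, Exec.seq h1 (Exec.seq h2 (Exec.assign _ _ _)), ?_, ?_, ?_, ?_⟩
    · have := pow_sum_bound (a := a.weight) (b := b.weight) h10
      simp only [Expr.cost, weight]; omega
    · simp [State.setReg, m1, m2]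
    · have hb : b.eval s1.mem s1.reg = b.eval s.mem s.reg := by
        rw [m1]; exact eval_congr _ he.2 fun x hx => r1 x (by omega)
      simp [State.setReg, Expr.eval, eval, e2, r2 T (by omega), e1, hb]
    · intro x hx
      simp [State.setReg, hx.ne, r2 x (by omega), r1 x hx]
  | sub a b iha ihb =>
    intro T s hV he hB
    obtain ⟨t1, s1, h1, c1, m1, e1, r1⟩ := iha T s hV he.1 hB
    obtain ⟨t2, s2, h2, c2, m2, e2, r2⟩ := ihb (T + 1) s1 (by omega) he.2
      (fun x hx => by rw [r1 x (by omega)]; exact hB x hx)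
    refine ⟨_, _, Exec.seq h1 (Exec.seq h2 (Exec.assign _ _ _)), ?_, ?_, ?_, ?_⟩
    · have := pow_sum_bound (a := a.weight) (b := b.weight) h10
      simp only [Expr.cost, weight]; omega
    · simp [State.setReg, m1, m2]
    · have hb : b.eval s1.mem s1.reg = b.eval s.mem s.reg := by
        rw [m1]; exact eval_congr _ he.2 fun x hx => r1 x (by omega)
      simp [State.setReg, Expr.eval, eval, e2, r2 T (by omega), e1, hb]
    · intro x hx
      simp [State.setReg, hx.ne, r2 x (by omega), r1 x hx]
  | load k a iha =>
    intro T s hV he hB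
    obtain ⟨t1, s1, h1, c1, m1, e1, r1⟩ := iha T s hV he hB
    refine ⟨_, _, Exec.seq h1 (Exec.assign _ _ _), ?_, ?_, ?_, ?_⟩
    · have := pow_step (a := a.weight) (b := a.weight + 1) h10 (by omega)
      simp only [Expr.cost, weight]; omega
    · simp [State.setReg, m1]
    · simp [State.setReg, Expr.eval, eval, e1, m1]
    · intro x hx
      simp [State.setReg, hx.ne, r1 x hx]
  | ite a b e f iha ihb ihe ihf =>
    intro T s hV he hB
    obtain ⟨t1, s1, h1, c1, m1, e1, r1⟩ := iha T s hV he.1 hB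
    obtain ⟨t2, s2, h2, c2, m2, e2, r2⟩ := ihb (T + 1) s1 (by omega) he.2.1
      (fun x hx => by rw [r1 x (by omega)]; exact hB x hx)
    have r12 : ∀ x < T, s2.reg x = s.reg x := fun x hx => by rw [r2 x (by omega), r1 x hx]
    have hB2 : ∀ x < V, s2.reg x ≤ B := fun x hx => by rw [r12 x (by omega)]; exact hB x hx
    obtain ⟨t3, s3, h3, c3, m3, e3, r3⟩ := ihe T s2 hV he.2.2.1 hB2
    obtain ⟨t4, s4, h4, c4, m4, e4, r4⟩ := ihf T s2 hV he.2.2.2 hB2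
    have hb : b.eval s1.mem s1.reg = b.eval s.mem s.reg := by
      rw [m1]; exact eval_congr _ he.2.1 fun x hx => r1 x (by omega)
    have m12 : s2.mem = s.mem := m2.trans m1
    have hT : s2.reg T = a.eval s.mem s.reg := by rw [r2 T (by omega), e1]
    have b1 := pow_sum_bound (a := a.weight) (b := b.weight) h10
    have b2 := pow_sum_bound (a := e.weight) (b := f.weight) h10
    have b3 : (B + 10) ^ (a.weight + b.weight + 1) + (B + 10) ^ (e.weight + f.weight) ≤
        (B + 10) ^ (a.weight + b.weight + e.weight + f.weight + 2) := by
      have := pow_sum_bound (a := a.weight + b.weight + 1) (b := e.weight + f.weight) h10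
      calc _ ≤ _ := by omega
        _ ≤ (B + 10) ^ (a.weight + b.weight + 1 + (e.weight + f.weight) + 1) := this
        _ = _ := by congr 1; ring
    have be : (B + 10) ^ e.weight ≤ (B + 10) ^ (e.weight + f.weight) :=
      Nat.pow_le_pow_right (by omega) (by omega)
    have bf : (B + 10) ^ f.weight ≤ (B + 10) ^ (e.weight + f.weight) :=
      Nat.pow_le_pow_right (by omega) (by omega)
    by_cases hlt : a.eval s.mem s.reg < b.eval s.mem s.reg
    · refine ⟨_, s3, Exec.seq h1 (Exec.seq h2 (Exec.ite_true ?_ h3)), ?_, m3.trans m12, ?_, ?_⟩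
      · simpa [Expr.eval, hT, e2, hb] using hlt
      · simp only [Expr.cost, weight]; omega
      · rw [e3, m12, eval, if_pos hlt]
        exact eval_congr _ he.2.2.1 fun x hx => r12 x (by omega)
      · intro x hx; rw [r3 x hx, r12 x hx]
    · refine ⟨_, s4, Exec.seq h1 (Exec.seq h2 (Exec.ite_false ?_ h4)), ?_, m4.trans m12, ?_, ?_⟩
      · simpa [Expr.eval, hT, e2, hb] using hlt
      · simp only [Expr.cost, weight]; omega
      · rw [e4, m12, eval, if_neg hlt]
        exact eval_congr _ he.2.2.2 fun x hx => r12 x (by omega)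
      · intro x hx; rw [r4 x hx, r12 x hx]
  | mul p a b iha ihb =>
    intro T s hV he hB
    obtain ⟨hp, ha, hb⟩ := he
    obtain ⟨t1, s1, h1, c1, m1, e1, r1⟩ := iha (T + 1) s (by omega) ha hB
    obtain ⟨t2, s2, h2, c2, m2, e2, r2⟩ := ihb (T + 2) s1 (by omega) hb
      (fun x hx => by rw [r1 x (by omega)]; exact hB x hx)
    have r12 : ∀ x < T, s2.reg x = s.reg x := fun x hx => by
      rw [r2 x (by omega), r1 x (by omega)]
    have e2' : s2.reg (T + 2) = b.eval s.mem s.reg := by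
      rw [e2, m1]; exact eval_congr _ hb fun x hx => r1 x (by omega)
    have e1' : s2.reg (T + 1) = a.eval s.mem s.reg := by rw [r2 _ (by omega), e1]
    set u := a.eval s.mem s.reg
    set w := min (b.eval s.mem s.reg) (s.reg p) with hw
    have hwB : w ≤ B := (min_le_right _ _).trans (hB p hp)
    obtain ⟨t3, s3, h3, c3, m3, e3, f3, r3⟩ : ∃ t s3, Exec (.ite (.reg p) (.reg (T + 2))
        (.assign (T + 2) (.reg p)) .skip) s2 t s3 ∧ t ≤ 5 ∧ s3.mem = s2.mem ∧
        s3.reg (T + 2) = w ∧ s3.reg (T + 1) = u ∧ ∀ x < T, s3.reg x = s2.reg x := by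
      by_cases hlt : s2.reg p < s2.reg (T + 2)
      · refine ⟨_, _, Exec.ite_true hlt (Exec.assign _ _ _), by simp [Expr.cost], rfl, ?_, ?_, ?_⟩
        · rw [r12 p (by omega), e2'] at hlt
          simp [State.setReg, Expr.eval, hw, r12 p (by omega), hlt.le]
        · simp [State.setReg, e1']
        · intro x hx
          simp (disch := omega) [State.setReg]
      · refine ⟨_, _, Exec.ite_false hlt (Exec.skip _), by simp [Expr.cost], rfl, ?_, e1',
          fun _ _ => rfl⟩
        rw [r12 p (by omega), e2'] at hlt
        rw [e2', hw, min_eq_left (by omega)]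
    obtain ⟨t4, s4, h4, c4, hI⟩ := exec_counter_loop (x := T + 3) (b := T + 2) (n := w) (c := 8)
      (p := .seq (.assign T (.add (.reg T) (.reg (T + 1))))
          (.assign (T + 3) (.add (.reg (T + 3)) (.const 1))))
      (fun i s' => s'.mem = s.mem ∧ s'.reg (T + 3) = i ∧ s'.reg (T + 2) = w ∧
        s'.reg (T + 1) = u ∧ s'.reg T = u * i ∧ ∀ x < T, s'.reg x = s.reg x)
      (fun i s' h => ⟨h.2.1, h.2.2.1⟩)
      (by
        rintro i s' hi ⟨hm, hx, hw', hu, hT, hr⟩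
        refine ⟨_, _, Exec.seq (Exec.assign _ _ _) (Exec.assign _ _ _), by simp [Expr.cost],
          ?_, ?_, ?_, ?_, ?_, ?_⟩
        · simpa [State.setReg] using hm
        · simp [State.setReg, Expr.eval, hx]
        · simp [State.setReg, hw']
        · simp [State.setReg, hu]
        · simp [State.setReg, Expr.eval, hT, hu]; ring
        · intro x hx
          simp (disch := omega) [State.setReg, hr x hx])
      w 0 ((s3.setReg T 0).setReg (T + 3) 0) (by simp)
      ⟨by simp [State.setReg, m3, m2, m1], by simp [State.setReg], by simp [State.setReg, e3],
        by simp [State.setReg, f3], by simp [State.setReg], fun x hx => by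
          simp (disch := omega) [State.setReg, r3 x hx, r12 x hx]⟩
    refine ⟨_, s4, Exec.seq h1 (Exec.seq h2 (Exec.seq h3 (Exec.seq (Exec.assign _ _ _)
      (Exec.seq (Exec.assign _ _ _) h4)))), ?_, hI.1, hI.2.2.2.2.1, hI.2.2.2.2.2⟩
    have b1 := pow_sum_bound (a := a.weight) (b := b.weight) h10
    have b2 := pow_loop_bound (a := a.weight + b.weight + 1) hwB
    have b3 : w * (8 + 3) ≤ w * (10 + (B + 10) ^ (a.weight + b.weight + 1)) :=
      Nat.mul_le_mul_left _ (by
        have : 1 ≤ (B + 10) ^ (a.weight + b.weight + 1) := Nat.one_le_pow _ _ (by omega)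
        omega)
    have b4 : (B + 10) ^ (a.weight + b.weight + 1) + 20 + w * 11 ≤
        (B + 10) ^ (a.weight + b.weight + 3) := by
      have h1 : 1 ≤ (B + 10) ^ (a.weight + b.weight + 1) := Nat.one_le_pow _ _ (by omega)
      have : (B + 10) ^ (a.weight + b.weight + 3) =
        (B + 10) * ((B + 10) * (B + 10) ^ (a.weight + b.weight + 1)) := by ring
      have h2 : (20 * B + 99) * 1 ≤ (20 * B + 99) * (B + 10) ^ (a.weight + b.weight + 1) :=
        Nat.mul_le_mul_left _ h1
      rw [this]; nlinarith [Nat.zero_le (B * B * (B + 10) ^ (a.weight + b.weight + 1))]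
    simp only [Expr.cost, weight]; omega
  | sum x p e ih =>
    intro T s hV he hB
    obtain ⟨hx, hp, he⟩ := he
    set n := s.reg p
    have hnB : n ≤ B := hB p hp
    obtain ⟨t4, s4, h4, c4, hI⟩ := exec_counter_loop (x := x) (b := T + 2) (n := n)
      (c := (B + 10) ^ e.weight + 8)
      (p := .seq (e.compile (T + 3)) (.seq (.assign T (.add (.reg T) (.reg (T + 3))))
          (.assign x (.add (.reg x) (.const 1)))))
      (fun i s' => s'.mem = s.mem ∧ s'.reg x = i ∧ s'.reg (T + 2) = n ∧
        s'.reg (T + 1) = s.reg x ∧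
        s'.reg T = ∑ j ∈ Finset.range i, e.eval s.mem (Function.update s.reg x j) ∧
        i ≤ n ∧ ∀ y < T, y ≠ x → s'.reg y = s.reg y)
      (fun i s' h => ⟨h.2.1, h.2.2.1⟩)
      (by
        rintro i s' hi ⟨hm, hx', hn, hs, hT, hin, hr⟩
        have hreg : ∀ y < V, s'.reg y = Function.update s.reg x i y := fun y hy => by
          by_cases hyx : y = x
          · subst hyx; simp [hx']
          · simp [hyx, hr y (by omega) hyx]
        obtain ⟨t1, s1, h1, c1, m1, e1, r1⟩ := ih (T + 3) s' (by omega) he (fun y hy => by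
          rw [hreg y hy]
          by_cases hyx : y = x
          · subst hyx; simp; omega
          · simp [hyx, hB y hy])
        refine ⟨_, _, Exec.seq h1 (Exec.seq (Exec.assign _ _ _) (Exec.assign _ _ _)), ?_,
          ?_, ?_, ?_, ?_, ?_, ?_, ?_⟩
        · simp [Expr.cost]; omega
        · simp [State.setReg, m1, hm]
        · simp (disch := omega) [State.setReg, Expr.eval, r1 x (by omega), hx']
        · simp (disch := omega) [State.setReg, r1 (T + 2) (by omega), hn]
        · simp (disch := omega) [State.setReg, r1 (T + 1) (by omega), hs]
        · simp (disch := omega) [State.setReg, Expr.eval, r1 T (by omega), hT,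
            Finset.sum_range_succ, e1, hm, eval_congr _ he hreg]
        · omega
        · intro y hy hyx
          simp (disch := omega) [State.setReg, r1 y (by omega), hr y hy hyx])
      n 0 ((((s.setReg (T + 2) n).setReg (T + 1) (s.reg x)).setReg T 0).setReg x 0) (by simp)
      ⟨by simp [State.setReg], by simp [State.setReg],
        by simp (disch := omega) [State.setReg],
        by simp (disch := omega) [State.setReg],
        by simp (disch := omega) [State.setReg], by simp, fun y hy hyx => by
          simp (disch := omega) [State.setReg]⟩
    obtain ⟨hm, hx', hn, hs, hT, -, hr⟩ := hI
    have e0 : (Expr.reg x).eval (s.setReg (T + 2) ((Expr.reg p).eval s)) = s.reg x := by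
      simp (disch := omega) [Expr.eval, State.setReg]
    have k0 := Exec.assign (T + 1) (.reg x) (s.setReg (T + 2) n)
    rw [show (Expr.reg x).eval (s.setReg (T + 2) n) = s.reg x from e0] at k0
    refine ⟨_, _, Exec.seq (Exec.assign _ _ _) (Exec.seq k0 (Exec.seq
      (Exec.assign _ _ _) (Exec.seq (Exec.assign _ _ _) (Exec.seq h4 (Exec.assign _ _ _))))),
      ?_, ?_, ?_, ?_⟩
    · have b2 := pow_loop_bound (a := e.weight) hnB
      have b3 : n * ((B + 10) ^ e.weight + 8 + 3) = n * (10 + (B + 10) ^ e.weight) + n := by ring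
      have b4 : (B + 10) ^ (e.weight + 2) + n ≤ (B + 10) ^ (e.weight + 3) := by
        have h1 : 1 ≤ (B + 10) ^ (e.weight + 2) := Nat.one_le_pow _ _ (by omega)
        rw [pow_succ (B + 10) (e.weight + 2)]; nlinarith
      simp only [Expr.cost, weight]; omega
    · simp [State.setReg, hm]
    · simp (disch := omega) [State.setReg, hT, eval, n]
    · intro y hy
      by_cases hyx : y = x
      · subst hyx; simp [State.setReg, Expr.eval, hs]
      · simp [State.setReg, hyx, hr y hy hyx]

end Term

/-! ### Statements and their running time -/

/-- Statements, which change the memory only. -/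
inductive Stmt where
  | store (k : ℕ) (a e : Term)
  | seq (p q : Stmt)
  | ite (a b : Term) (p q : Stmt)
  | rep (x p : ℕ) (q : Stmt)

namespace Stmt

/-- The effect of a statement on the memory. -/
def run : Stmt → (ℕ → ℕ) → (ℕ → ℕ → ℕ) → ℕ → ℕ → ℕ
  | store k a e, ρ, m => Function.update m k (Function.update (m k) (a.eval m ρ) (e.eval m ρ))
  | seq p q, ρ, m => q.run ρ (p.run ρ m)
  | ite a b p q, ρ, m => if a.eval m ρ < b.eval m ρ then p.run ρ m else q.run ρ m
  | rep x p q, ρ, m =>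
      Nat.rec m (fun i m' => q.run (Function.update ρ x i) m') (ρ p)

/-- All registers that occur lie below `T`. -/
def Below (T : ℕ) : Stmt → Prop
  | store _ a e => a.Below T ∧ e.Below T
  | seq p q => p.Below T ∧ q.Below T
  | ite a b p q => a.Below T ∧ b.Below T ∧ p.Below T ∧ q.Below T
  | rep x p q => x < T ∧ p < T ∧ q.Below T

instance decBelow (T : ℕ) : (p : Stmt) → Decidable (p.Below T)
  | store _ a e => inferInstanceAs (Decidable (a.Below T ∧ e.Below T))
  | seq p q => @instDecidableAnd _ _ (decBelow T p) (decBelow T q)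
  | ite a b p q => @instDecidableAnd _ _ (Term.decBelow T a) (@instDecidableAnd _ _
      (Term.decBelow T b) (@instDecidableAnd _ _ (decBelow T p) (decBelow T q)))
  | rep x p q => @instDecidableAnd _ _ (inferInstanceAs (Decidable (x < T)))
      (@instDecidableAnd _ _ (inferInstanceAs (Decidable (p < T))) (decBelow T q))

/-- The statement may write to array `k`. -/
def Writes (k : ℕ) : Stmt → Prop
  | store k' _ _ => k = k'
  | seq p q => p.Writes k ∨ q.Writes k
  | ite _ _ p q => p.Writes k ∨ q.Writes k
  | rep _ _ q => q.Writes k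

instance decWrites (k : ℕ) : (p : Stmt) → Decidable (p.Writes k)
  | store k' _ _ => inferInstanceAs (Decidable (k = k'))
  | seq p q => @instDecidableOr _ _ (decWrites k p) (decWrites k q)
  | ite _ _ p q => @instDecidableOr _ _ (decWrites k p) (decWrites k q)
  | rep _ _ q => decWrites k q

theorem run_frame {k : ℕ} : ∀ (p : Stmt) (ρ : ℕ → ℕ) (m : ℕ → ℕ → ℕ), ¬ p.Writes k →
    p.run ρ m k = m k := by
  intro p
  induction p with
  | store k' a e =>
    intro ρ m h
    exact Function.update_of_ne h _ _
  | seq p q ihp ihq =>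
    intro ρ m h
    simp only [Writes, not_or] at h
    rw [run, ihq _ _ h.2, ihp _ _ h.1]
  | ite a b p q ihp ihq =>
    intro ρ m h
    simp only [Writes, not_or] at h
    rw [run]; split_ifs
    · exact ihp _ _ h.1
    · exact ihq _ _ h.2
  | rep x p q ih =>
    intro ρ m h
    rw [run]
    induction ρ p with
    | zero => rfl
    | succ j hj => exact (ih _ _ h).trans hj

/-- Invariants of loops. -/
theorem run_rep {x p : ℕ} {q : Stmt} {ρ : ℕ → ℕ} {m : ℕ → ℕ → ℕ} {n : ℕ} (hn : ρ p = n)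
    (I : ℕ → (ℕ → ℕ → ℕ) → Prop) (h0 : I 0 m)
    (hs : ∀ i < n, ∀ m', I i m' → I (i + 1) (q.run (Function.update ρ x i) m')) :
    I n ((Stmt.rep x p q).run ρ m) := by
  subst hn
  rw [run]
  have : ∀ j ≤ ρ p, I j (Nat.rec m (fun i m' => q.run (Function.update ρ x i) m') j) := by
    intro j
    induction j with
    | zero => exact fun _ => h0
    | succ j ih => exact fun hj => hs j (by omega) _ (ih (by omega))
  exact this _ le_rfl

/-- The exponent in the time bound. -/
def weight : Stmt → ℕ
  | store _ a e => a.weight + e.weight + 1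
  | seq p q => p.weight + q.weight + 1
  | ite a b p q => a.weight + b.weight + p.weight + q.weight + 2
  | rep _ _ q => q.weight + 3

/-- The program of a statement, with working registers from `T` on. -/
def compile : Stmt → ℕ → Prog
  | store k a e, T => .seq (a.compile T) (.seq (e.compile (T + 1))
      (.store k (.reg T) (.reg (T + 1))))
  | seq p q, T => .seq (p.compile T) (q.compile T)
  | ite a b p q, T => .seq (a.compile T) (.seq (b.compile (T + 1))
      (.ite (.reg T) (.reg (T + 1)) (p.compile T) (q.compile T)))
  | rep x p q, T => .seq (.assign T (.reg p)) (.seq (.assign (T + 1) (.reg x))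
      (.seq (.assign x (.const 0)) (.seq (.loop (.reg x) (.reg T)
        (.seq (q.compile (T + 2)) (.assign x (.add (.reg x) (.const 1)))))
        (.assign x (.reg (T + 1))))))

theorem run_congr {T : ℕ} : ∀ (p : Stmt) {ρ ρ' : ℕ → ℕ} (m : ℕ → ℕ → ℕ), p.Below T →
    (∀ x < T, ρ x = ρ' x) → p.run ρ m = p.run ρ' m := by
  intro p
  induction p with
  | store k a e =>
    intro ρ ρ' m hp h
    simp only [run, Term.eval_congr m hp.1 h, Term.eval_congr m hp.2 h]
  | seq p q ihp ihq =>
    intro ρ ρ' m hp h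
    simp only [run, ihp m hp.1 h, ihq _ hp.2 h]
  | ite a b p q ihp ihq =>
    intro ρ ρ' m hp h
    simp only [run, Term.eval_congr m hp.1 h, Term.eval_congr m hp.2.1 h, ihp m hp.2.2.1 h,
      ihq m hp.2.2.2 h]
  | rep x p q ih =>
    intro ρ ρ' m hp h
    simp only [run, h p hp.2.1]
    induction ρ' p with
    | zero => rfl
    | succ j hj =>
      simp only [hj]
      refine ih _ hp.2.2 fun y hy => ?_
      by_cases hyx : y = x
      · simp [hyx]
      · simp [hyx, h y hy]

theorem exec_compile {B V : ℕ} : ∀ (p : Stmt) (T : ℕ) (s : State), V ≤ T → p.Below V →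
    (∀ x < V, s.reg x ≤ B) → ∃ t s', Exec (p.compile T) s t s' ∧ t ≤ (B + 10) ^ p.weight ∧
      s'.mem = p.run s.reg s.mem ∧ ∀ x < T, s'.reg x = s.reg x := by
  have h10 : 10 ≤ B + 10 := by omega
  intro p
  induction p with
  | store k a e =>
    intro T s hV hp hB
    obtain ⟨t1, s1, h1, c1, m1, e1, r1⟩ := a.exec_compile T s hV hp.1 hB
    obtain ⟨t2, s2, h2, c2, m2, e2, r2⟩ := e.exec_compile (T + 1) s1 (by omega) hp.2
      (fun x hx => by rw [r1 x (by omega)]; exact hB x hx)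
    refine ⟨_, _, Exec.seq h1 (Exec.seq h2 (Exec.store _ _ _ _)), ?_, ?_, ?_⟩
    · have := pow_sum_bound (a := a.weight) (b := e.weight) h10
      simp only [Expr.cost, weight]; omega
    · have hb : e.eval s.mem s1.reg = e.eval s.mem s.reg := by
        exact Term.eval_congr _ hp.2 fun x hx => r1 x (by omega)
      simp [State.setMem, Expr.eval, run, e2, r2 T (by omega), e1, hb, m2, m1]
    · intro x hx
      simp [State.setMem, r2 x (by omega), r1 x hx]
  | seq p q ihp ihq =>
    intro T s hV hp hB
    obtain ⟨t1, s1, h1, c1, m1, r1⟩ := ihp T s hV hp.1 hB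
    obtain ⟨t2, s2, h2, c2, m2, r2⟩ := ihq T s1 (by omega) hp.2
      (fun x hx => by rw [r1 x (by omega)]; exact hB x hx)
    refine ⟨_, _, Exec.seq h1 h2, ?_, ?_, ?_⟩
    · have := pow_sum_bound (a := p.weight) (b := q.weight) h10
      simp only [weight]; omega
    · rw [m2, m1, run]
      exact run_congr q _ hp.2 fun x hx => r1 x (by omega)
    · intro x hx
      rw [r2 x (by omega), r1 x hx]
  | ite a b e f ihe ihf =>
    intro T s hV he hB
    obtain ⟨t1, s1, h1, c1, m1, e1, r1⟩ := a.exec_compile T s hV he.1 hB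
    obtain ⟨t2, s2, h2, c2, m2, e2, r2⟩ := b.exec_compile (T + 1) s1 (by omega) he.2.1
      (fun x hx => by rw [r1 x (by omega)]; exact hB x hx)
    have r12 : ∀ x < T, s2.reg x = s.reg x := fun x hx => by rw [r2 x (by omega), r1 x hx]
    have hB2 : ∀ x < V, s2.reg x ≤ B := fun x hx => by rw [r12 x (by omega)]; exact hB x hx
    obtain ⟨t3, s3, h3, c3, m3, r3⟩ := ihe T s2 hV he.2.2.1 hB2
    obtain ⟨t4, s4, h4, c4, m4, r4⟩ := ihf T s2 hV he.2.2.2 hB2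
    have hb : b.eval s1.mem s1.reg = b.eval s.mem s.reg := by
      rw [m1]; exact Term.eval_congr _ he.2.1 fun x hx => r1 x (by omega)
    have m12 : s2.mem = s.mem := m2.trans m1
    have hT : s2.reg T = a.eval s.mem s.reg := by rw [r2 T (by omega), e1]
    have b1 := pow_sum_bound (a := a.weight) (b := b.weight) h10
    have b3 : (B + 10) ^ (a.weight + b.weight + 1) + (B + 10) ^ (e.weight + f.weight) ≤
        (B + 10) ^ (a.weight + b.weight + e.weight + f.weight + 2) := by
      have := pow_sum_bound (a := a.weight + b.weight + 1) (b := e.weight + f.weight) h10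
      calc _ ≤ _ := by omega
        _ ≤ (B + 10) ^ (a.weight + b.weight + 1 + (e.weight + f.weight) + 1) := this
        _ = _ := by congr 1; ring
    have be : (B + 10) ^ e.weight ≤ (B + 10) ^ (e.weight + f.weight) :=
      Nat.pow_le_pow_right (by omega) (by omega)
    have bf : (B + 10) ^ f.weight ≤ (B + 10) ^ (e.weight + f.weight) :=
      Nat.pow_le_pow_right (by omega) (by omega)
    by_cases hlt : a.eval s.mem s.reg < b.eval s.mem s.reg
    · refine ⟨_, s3, Exec.seq h1 (Exec.seq h2 (Exec.ite_true ?_ h3)), ?_, ?_, ?_⟩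
      · simpa [Expr.eval, hT, e2, hb] using hlt
      · simp only [Expr.cost, weight]; omega
      · rw [m3, m12, run, if_pos hlt]
        exact run_congr e _ he.2.2.1 fun x hx => r12 x (by omega)
      · intro x hx; rw [r3 x hx, r12 x hx]
    · refine ⟨_, s4, Exec.seq h1 (Exec.seq h2 (Exec.ite_false ?_ h4)), ?_, ?_, ?_⟩
      · simpa [Expr.eval, hT, e2, hb] using hlt
      · simp only [Expr.cost, weight]; omega
      · rw [m4, m12, run, if_neg hlt]
        exact run_congr f _ he.2.2.2 fun x hx => r12 x (by omega)
      · intro x hx; rw [r4 x hx, r12 x hx]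
  | rep x p e ih =>
    intro T s hV he hB
    obtain ⟨hx, hp, he⟩ := he
    set n := s.reg p
    have hnB : n ≤ B := hB p hp
    obtain ⟨t4, s4, h4, c4, hI⟩ := exec_counter_loop (x := x) (b := T) (n := n)
      (c := (B + 10) ^ e.weight + 4)
      (p := .seq (e.compile (T + 2)) (.assign x (.add (.reg x) (.const 1))))
      (fun i s' => s'.mem = Nat.rec s.mem
          (fun i m' => e.run (Function.update s.reg x i) m') i ∧
        s'.reg x = i ∧ s'.reg T = n ∧
        s'.reg (T + 1) = s.reg x ∧ i ≤ n ∧ ∀ y < T, y ≠ x → s'.reg y = s.reg y)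
      (fun i s' h => ⟨h.2.1, h.2.2.1⟩)
      (by
        rintro i s' hi ⟨hm, hx', hn, hs, hin, hr⟩
        have hreg : ∀ y < V, s'.reg y = Function.update s.reg x i y := fun y hy => by
          by_cases hyx : y = x
          · subst hyx; simp [hx']
          · simp [hyx, hr y (by omega) hyx]
        obtain ⟨t1, s1, h1, c1, m1, r1⟩ := ih (T + 2) s' (by omega) he (fun y hy => by
          rw [hreg y hy]
          by_cases hyx : y = x
          · subst hyx; simp; omega
          · simp [hyx, hB y hy])
        refine ⟨_, _, Exec.seq h1 (Exec.assign _ _ _), ?_, ?_, ?_, ?_, ?_, ?_, ?_⟩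
        · simp [Expr.cost]; omega
        · simp only [State.setReg, m1]
          rw [run_congr e _ he hreg, hm]
        · simp [State.setReg, Expr.eval, r1 x (by omega), hx']
        · simp (disch := omega) [State.setReg, r1 T (by omega), hn]
        · simp (disch := omega) [State.setReg, r1 (T + 1) (by omega), hs]
        · omega
        · intro y hy hyx
          simp (disch := omega) [State.setReg, r1 y (by omega), hr y hy hyx])
      n 0 (((s.setReg T n).setReg (T + 1) (s.reg x)).setReg x 0) (by simp)
      ⟨by simp [State.setReg], by simp [State.setReg],
        by simp (disch := omega) [State.setReg],
        by simp (disch := omega) [State.setReg], by simp, fun y hy hyx => by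
          simp (disch := omega) [State.setReg]⟩
    obtain ⟨hm, hx', hn, hs, -, hr⟩ := hI
    have e0 : (Expr.reg x).eval (s.setReg T n) = s.reg x := by
      simp (disch := omega) [Expr.eval, State.setReg]
    have k0 := Exec.assign (T + 1) (.reg x) (s.setReg T n)
    rw [e0] at k0
    refine ⟨_, _, Exec.seq (Exec.assign _ _ _) (Exec.seq k0 (Exec.seq
      (Exec.assign _ _ _) (Exec.seq h4 (Exec.assign _ _ _)))), ?_, ?_, ?_⟩
    · have b2 := pow_loop_bound (a := e.weight) hnB
      have b3 : n * ((B + 10) ^ e.weight + 4 + 3) ≤ n * (10 + (B + 10) ^ e.weight) :=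
        Nat.mul_le_mul_left _ (by omega)
      have b4 : (B + 10) ^ (e.weight + 2) ≤ (B + 10) ^ (e.weight + 3) :=
        Nat.pow_le_pow_right (by omega) (by omega)
      simp only [Expr.cost, weight]; omega
    · simp [State.setReg, hm, run, n]
    · intro y hy
      by_cases hyx : y = x
      · subst hyx; simp [State.setReg, Expr.eval, hs]
      · simp (disch := omega) [State.setReg, hr y hy hyx]

end Stmt

end JuntaLearning

/-! ### Polynomials over a prime field -/

namespace JuntaLearning

open Finset

/-! The pseudo-random family: the polynomial over `ZMod q` whose coefficients are the digits of
`i`, evaluated at `v`. -/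

/-- The value at `v`, modulo `q`, of the polynomial with the base-`q` digits of `i`. -/
def polyVal (q i v : ℕ) : ℕ := Nat.ofDigits v (Nat.digits q i) % q

theorem polyVal_lt {q : ℕ} (hq : 0 < q) (i v : ℕ) : polyVal q i v < q := Nat.mod_lt _ hq

theorem polyVal_zero (q v : ℕ) : polyVal q 0 v = 0 := by simp [polyVal]

/-- Horner's rule. It lets the table of all values be filled row by row, with one product and one
reduction per entry. -/
theorem polyVal_add {q : ℕ} (hq : 2 ≤ q) {i r v : ℕ} (hr : r < q) :
    polyVal q (i * q + r) v = (r + v * polyVal q i v) % q := by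
  by_cases h : r = 0 ∧ i = 0
  · simp [h.1, h.2, polyVal_zero]
  · have : Nat.digits q (i * q + r) = r :: Nat.digits q i := by
      rw [add_comm, mul_comm]
      exact Nat.digits_add q (by omega) r i hr (by omega)
    rw [polyVal, this, Nat.ofDigits_cons, polyVal, Nat.add_mod, Nat.mul_mod, Nat.add_mod r,
      Nat.mul_mod v (_ % q), Nat.mod_mod]

/-- The polynomial with the base-`q` digits of `i`. -/
noncomputable def digitPoly (q i : ℕ) : Polynomial (ZMod q) :=
  Nat.ofDigits Polynomial.X (Nat.digits q i)

theorem ofDigits_X_coeff {q : ℕ} (L : List ℕ) (j : ℕ) :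
    (Nat.ofDigits (Polynomial.X : Polynomial (ZMod q)) L).coeff j = ((L.getD j 0 : ℕ) : ZMod q) := by
  induction L generalizing j with
  | nil => simp [Nat.ofDigits]
  | cons h t ih =>
    have hc : Nat.ofDigits (Polynomial.X : Polynomial (ZMod q)) (h :: t) =
        (h : Polynomial (ZMod q)) + Polynomial.X * Nat.ofDigits Polynomial.X t := rfl
    rw [hc]
    cases j with
    | zero => simp
    | succ j => simp [Polynomial.coeff_X_mul, ih, Polynomial.coeff_natCast_ite]

theorem eval_digitPoly (q i v : ℕ) :
    (digitPoly q i).eval (v : ZMod q) = (polyVal q i v : ZMod q) := by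
  rw [polyVal, ZMod.natCast_mod, digitPoly]
  induction Nat.digits q i with
  | nil => simp [Nat.ofDigits]
  | cons h t ih =>
    have hc : Nat.ofDigits (Polynomial.X : Polynomial (ZMod q)) (h :: t) =
        (h : Polynomial (ZMod q)) + Polynomial.X * Nat.ofDigits Polynomial.X t := rfl
    simp [Nat.ofDigits_cons, hc, ih]

theorem digitPoly_degree {q i k : ℕ} (hq : 2 ≤ q) (hi : i < q ^ k) :
    (digitPoly q i).degree < k := by
  rw [Polynomial.degree_lt_iff_coeff_zero]
  intro m hm
  rw [digitPoly, ofDigits_X_coeff, List.getD_eq_default]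
  · simp
  · exact ((Nat.digits_length_le_iff (by omega) i).2 hi).trans hm

theorem digitPoly_injective {q i j : ℕ} (hq : 2 ≤ q) (h : digitPoly q i = digitPoly q j) :
    i = j := by
  have hd : ∀ m, i / q ^ m % q = j / q ^ m % q := fun m => by
    have := congrArg (fun p => p.coeff m) h
    simp only [digitPoly, ofDigits_X_coeff, Nat.getD_digits _ _ hq] at this
    rw [ZMod.natCast_eq_natCast_iff'] at this
    simpa using this
  clear h
  -- The last digits agree, and after dropping them the digits of the quotients still agree; the sum
  -- `i + j` decreases unless both are zero.
  induction hs : i + j using Nat.strong_induction_on generalizing i j with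
  | _ s ih =>
    have h0 : i % q = j % q := by simpa using hd 0
    have hdiv : ∀ m, i / q / q ^ m % q = j / q / q ^ m % q := fun m => by
      have := hd (m + 1)
      rwa [pow_succ', ← Nat.div_div_eq_div_mul, ← Nat.div_div_eq_div_mul] at this
    rcases Nat.eq_zero_or_pos s with h | h
    · omega
    · have hlt : i / q + j / q < s := by
        have h1 := Nat.div_le_self i q
        have h2 := Nat.div_le_self j q
        rcases Nat.eq_zero_or_pos i with hi | hi
        · have := Nat.div_lt_self (by omega : 0 < j) hq
          omega
        · have := Nat.div_lt_self hi hq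
          omega
      rw [← Nat.div_add_mod i q, ← Nat.div_add_mod j q, ih _ hlt hdiv rfl, h0]

/-- Distinct polynomials of degree below `k` agree at fewer than `k` points. -/
theorem card_polyVal_eq_lt {q : ℕ} (hq : q.Prime) {k i j : ℕ} (hi : i < q ^ k) (hj : j < q ^ k)
    (hij : i ≠ j) : ((range q).filter fun v => polyVal q i v = polyVal q j v).card < k := by
  have := Fact.mk hq
  set p := digitPoly q i - digitPoly q j with hp
  have hp0 : p ≠ 0 := fun h => hij (digitPoly_injective hq.two_le (sub_eq_zero.1 h))
  have hdeg : p.degree < k := (Polynomial.degree_sub_le _ _).trans_lt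
    (max_lt (digitPoly_degree hq.two_le hi) (digitPoly_degree hq.two_le hj))
  have hc : ((range q).filter fun v => polyVal q i v = polyVal q j v).card ≤
      p.roots.toFinset.card := by
    refine card_le_card_of_injOn (fun v => (v : ZMod q)) ?_ ?_
    · intro v hv
      simp only [coe_filter, mem_range, Set.mem_ofPred_eq] at hv
      simp only [Multiset.mem_toFinset, mem_coe, Polynomial.mem_roots hp0, Polynomial.IsRoot.def]
      simp [hp, Polynomial.eval_sub, eval_digitPoly, hv.2]
    · intro v hv w hw h
      simp only [coe_filter, mem_range, Set.mem_ofPred_eq] at hv hw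
      have := (ZMod.natCast_eq_natCast_iff' v w q).1 h
      rwa [Nat.mod_eq_of_lt hv.1, Nat.mod_eq_of_lt hw.1] at this
  refine hc.trans_lt ((Multiset.toFinset_card_le _).trans_lt ?_)
  have := Polynomial.card_roots hp0
  exact_mod_cast this.trans_lt hdeg

/-- Interpolation at `k` distinct points. -/
theorem exists_polyVal_eq {q : ℕ} (hq : q.Prime) {k : ℕ} {U : Finset ℕ} (hU : U ⊆ range q)
    (hk : U.card = k) (z : ℕ → ℕ) (hz : ∀ v ∈ U, z v < q) :
    ∃ i < q ^ k, ∀ v ∈ U, polyVal q i v = z v := by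
  have hq0 := hq.pos
  -- Interpolation by counting: two indices agree at fewer than `k` points, hence not on all of `U`,
  -- so restriction to `U` is injective between two sets of size `q ^ k`.
  let φ : Fin (q ^ k) → (U → Fin q) := fun i v => ⟨polyVal q i v, polyVal_lt hq0 _ _⟩
  have hinj : Function.Injective φ := by
    intro i j h
    by_contra hij
    have := card_polyVal_eq_lt hq i.2 j.2 (fun h => hij (Fin.ext h))
    refine absurd this (not_lt.2 ?_)
    refine hk.symm.le.trans ?_
    refine card_le_card fun v hv => ?_
    simp only [mem_filter]
    exact ⟨hU hv, by simpa [φ] using congrFun h ⟨v, hv⟩⟩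
  have hbij : Function.Bijective φ := by
    rw [Fintype.bijective_iff_injective_and_card]
    exact ⟨hinj, by simp [hk]⟩
  obtain ⟨i, hi⟩ := hbij.2 fun v => ⟨z v, hz v v.2⟩
  refine ⟨i, i.2, fun v hv => ?_⟩
  simpa [φ] using congrFun hi ⟨v, hv⟩

end JuntaLearning

/-! ### Candidate assignments on which distinct juntas differ -/

namespace JuntaLearning

open Finset

/-- The bits of the `c`-th assignment of the pseudo-random family. -/
def bitAt (q c v : ℕ) : Bool := decide (polyVal q c v + polyVal q c v < q)

/-- Bernoulli: `(1 - 1/q) ^ (2 * d) ≥ 1 - 2 * d / q ≥ 1/2`. This is the price for avoiding the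
residue `0` at `2 * d` points. -/
theorem pow_le_two_mul_pred_pow {q d : ℕ} (hd : 4 * d < q) :
    q ^ (2 * d) ≤ 2 * (q - 1) ^ (2 * d) := by
  have hq : (0 : ℝ) < q := by exact_mod_cast (by omega : 0 < q)
  have hq1 : (1 : ℝ) ≤ q := by exact_mod_cast (by omega : 1 ≤ q)
  have hinv : (1 : ℝ) / q ≤ 1 := by rw [div_le_one hq]; exact hq1
  have hB := one_add_mul_le_pow (a := -(1 / (q : ℝ))) (by linarith) (2 * d)
  have hd' : (4 * d : ℝ) ≤ q := by exact_mod_cast hd.le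
  have h1 : (1 : ℝ) / 2 ≤ 1 + ((2 * d : ℕ) : ℝ) * -(1 / (q : ℝ)) := by
    have : (d : ℝ) / q ≤ 1 / 4 := by rw [div_le_div_iff₀ hq (by norm_num)]; linarith
    push_cast
    have e : (2 * (d : ℝ)) * -(1 / (q : ℝ)) = -2 * (d / q) := by ring
    rw [e]; linarith
  have h2 : ((q - 1 : ℕ) : ℝ) = q * (1 + -(1 / (q : ℝ))) := by
    rw [Nat.cast_sub (by omega)]; field_simp; push_cast; ring
  have h3 : (q : ℝ) ^ (2 * d) ≤ 2 * ((q - 1 : ℕ) : ℝ) ^ (2 * d) := by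
    rw [h2, mul_pow]
    have := pow_pos hq (2 * d)
    nlinarith
  exact_mod_cast h3

/-- The nonzero residues in the lower or the upper half. -/
def halfSet (q : ℕ) [NeZero q] (b : Bool) : Finset (ZMod q) :=
  univ.filter fun x => x ≠ 0 ∧ decide (x.val + x.val < q) = b

theorem card_halfSet {q : ℕ} [NeZero q] (hodd : Odd q) (b : Bool) :
    q - 1 ≤ 2 * (halfSet q b).card := by
  obtain ⟨h, rfl⟩ := hodd
  have : h ≤ (halfSet (2 * h + 1) b).card := by
    conv_lhs => rw [← card_range h]
    refine card_le_card_of_injOn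
      (fun x => ((if b then x + 1 else x + 1 + h : ℕ) : ZMod (2 * h + 1))) ?_ ?_
    · intro x hx
      have hx := mem_range.1 (mem_coe.1 hx)
      have hv : ((if b then x + 1 else x + 1 + h : ℕ) : ZMod (2 * h + 1)).val =
          if b then x + 1 else x + 1 + h := by
        rw [ZMod.val_natCast, Nat.mod_eq_of_lt]; split_ifs <;> omega
      simp only [halfSet, coe_filter, mem_univ, true_and, Set.mem_ofPred_eq]
      refine ⟨fun h0 => ?_, ?_⟩
      · rw [h0, ZMod.val_zero] at hv; split_ifs at hv; all_goals omega
      · rw [hv]; cases b <;> (simp; omega)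
    · intro x hx y hy hxy
      have hx := mem_range.1 (mem_coe.1 hx)
      have hy := mem_range.1 (mem_coe.1 hy)
      have := congrArg ZMod.val hxy
      simp only [ZMod.val_natCast] at this
      rw [Nat.mod_eq_of_lt (by split_ifs <;> omega), Nat.mod_eq_of_lt (by split_ifs <;> omega)]
        at this
      split_ifs at this <;> omega
  omega

/-- Here oddness of `q` and the exclusion of `0` matter: `x` and `q - x` lie in different halves, so
negation is a bijection of the residues that flips the bit. -/
theorem halfSet_neg {q : ℕ} [NeZero q] (hodd : Odd q) {x : ZMod q} (hx : x ≠ 0) :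
    decide ((-x).val + (-x).val < q) = !decide (x.val + x.val < q) := by
  have hv : (-x).val = q - x.val := by rw [ZMod.neg_val, if_neg hx]
  have h1 := ZMod.val_lt x
  have h2 : x.val ≠ 0 := by simpa using hx
  obtain ⟨h, rfl⟩ := hodd
  rw [hv]
  by_cases hlt : x.val + x.val < 2 * h + 1
  · simp [hlt]; omega
  · simp [hlt]; omega

/-- The functions on `U` with prescribed bits on `V`. -/
def bitCylinder (q : ℕ) [NeZero q] (U V : Finset ℕ) (a : ℕ → Bool) : Finset (U → ZMod q) :=
  Fintype.piFinset fun v => if v.1 ∈ V then halfSet q (a v) else univ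

/-- A prescribed bit leaves at least `(q - 1) / 2` of the residues, a free point all of them.
Replacing every `q` by `q - 1` costs a factor of at most `2`, and the prescribed bits cost `2 ^ d`.
-/
theorem card_bitCylinder {q d : ℕ} [NeZero q] (hodd : Odd q) (hd : 4 * d < q) {U V : Finset ℕ}
    (hU : U.card = 2 * d) (hV : V.card ≤ d) (a : ℕ → Bool) :
    q ^ (2 * d) ≤ 2 * 2 ^ d * (bitCylinder q U V a).card := by
  have h1 : (q - 1) ^ (2 * d) ≤ 2 ^ d * (bitCylinder q U V a).card := by
    calc (q - 1) ^ (2 * d) = ∏ _v : U, (q - 1) := by simp [hU]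
      _ ≤ ∏ v : U, ((if v.1 ∈ V then 2 else 1) *
            (if v.1 ∈ V then halfSet q (a v) else univ).card) := by
          refine prod_le_prod' fun v _ => ?_
          split_ifs
          · exact card_halfSet hodd _
          · simp [ZMod.card]
      _ = 2 ^ (univ.filter fun v : U => v.1 ∈ V).card * (bitCylinder q U V a).card := by
          rw [prod_mul_distrib, bitCylinder, Fintype.card_piFinset, prod_ite]
          simp
      _ ≤ 2 ^ d * (bitCylinder q U V a).card := by
          refine Nat.mul_le_mul_right _ (Nat.pow_le_pow_right (by norm_num) (le_trans ?_ hV))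
          exact card_le_card_of_injOn (fun v => v.1) (fun v hv => by simpa using hv)
            (fun v _ w _ h => Subtype.ext h)
  have := pow_le_two_mul_pred_pow hd
  calc q ^ (2 * d) ≤ 2 * (q - 1) ^ (2 * d) := this
    _ ≤ 2 * (2 ^ d * (bitCylinder q U V a).card) := Nat.mul_le_mul_left _ h1
    _ = _ := by ring

/-- Two juntas that differ somewhere differ on a fraction of about `2 ^ (-d)` of the family. -/
theorem weight_bound {q d : ℕ} (hq : q.Prime) (hd : 4 * d < q) (hodd : Odd q) {σ τ : ℕ → ℕ}
    (hσ : ∀ j < d, σ j < q) (hτ : ∀ j < d, τ j < q) {p r : (ℕ → Bool) → Bool}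
    (hp : ∀ a b : ℕ → Bool, (∀ j < d, a (σ j) = b (σ j)) → p a = p b)
    (hr : ∀ a b : ℕ → Bool, (∀ j < d, a (τ j) = b (τ j)) → r a = r b)
    {a : ℕ → Bool} (ha : p a ≠ r a) :
    q ^ (2 * d) ≤ 4 * 2 ^ d *
      ((range (q ^ (2 * d))).filter fun c => p (bitAt q c) ≠ r (bitAt q c)).card := by
  have := Fact.mk hq
  have : NeZero q := ⟨hq.ne_zero⟩
  set S := (range d).image σ with hS
  set T := (range d).image τ with hT
  have hSc : S.card ≤ d := card_image_le.trans (by simp)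
  have hTc : T.card ≤ d := card_image_le.trans (by simp)
  have hsub : S ∪ T ⊆ range q := by
    intro v hv
    rcases mem_union.1 hv with h | h
    · obtain ⟨j, hj, rfl⟩ := mem_image.1 h
      exact mem_range.2 (hσ j (mem_range.1 hj))
    · obtain ⟨j, hj, rfl⟩ := mem_image.1 h
      exact mem_range.2 (hτ j (mem_range.1 hj))
  obtain ⟨U, hU1, hU2, hU3⟩ := exists_subsuperset_card_eq (n := 2 * d) hsub
    ((card_union_le _ _).trans (by omega)) (by simp; omega)
  have hSU : ∀ j < d, σ j ∈ U := fun j hj =>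
    hU1 (mem_union_left _ (mem_image_of_mem _ (mem_range.2 hj)))
  have hTU : ∀ j < d, τ j ∈ U := fun j hj =>
    hU1 (mem_union_right _ (mem_image_of_mem _ (mem_range.2 hj)))
  -- Both tuples lie in the `2 * d` points of `U`, and every vector of values on `U` is taken by
  -- some candidate. So disagreements may be counted among these vectors.
  have hG : ∀ z : U → ZMod q, ∃ c < q ^ (2 * d), ∀ v : U, polyVal q c v = (z v).val := by
    intro z
    obtain ⟨c, hc, h⟩ := exists_polyVal_eq hq hU2 hU3
      (fun v => if h : v ∈ U then (z ⟨v, h⟩).val else 0)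
      (fun v hv => by simp only [hv, dite_true]; exact ZMod.val_lt _)
    exact ⟨c, hc, fun v => by simpa using h v v.2⟩
  choose G hG1 hG2 using hG
  let bits : (U → ZMod q) → ℕ → Bool := fun z v =>
    if h : v ∈ U then decide ((z ⟨v, h⟩).val + (z ⟨v, h⟩).val < q) else false
  have hbits : ∀ z, ∀ v ∈ U, bitAt q (G z) v = bits z v := fun z v hv => by
    simp only [bits, hv, dite_true, bitAt, hG2 z ⟨v, hv⟩]
  have hGp : ∀ z, p (bitAt q (G z)) = p (bits z) := fun z =>
    hp _ _ fun j hj => hbits z _ (hSU j hj)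
  have hGr : ∀ z, r (bitAt q (G z)) = r (bits z) := fun z =>
    hr _ _ fun j hj => hbits z _ (hTU j hj)
  set D := univ.filter fun z : U → ZMod q => p (bits z) ≠ r (bits z) with hD
  have hDc : D.card ≤ ((range (q ^ (2 * d))).filter
      fun c => p (bitAt q c) ≠ r (bitAt q c)).card := by
    refine card_le_card_of_injOn G (fun z hz => ?_) (fun z _ w _ h => ?_)
    · have hz : p (bits z) ≠ r (bits z) := by simpa [hD] using hz
      simpa [hG1 z, hGp, hGr] using hz
    · funext v
      refine ZMod.val_injective q ?_
      rw [← hG2, ← hG2, h]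
  have hcyl : ∀ {V : Finset ℕ} {b : ℕ → Bool} {z}, z ∈ bitCylinder q U V b →
      ∀ v ∈ U, v ∈ V → bits z v = b v := by
    intro V b z hz v hvU hv
    have := Fintype.mem_piFinset.1 hz ⟨v, hvU⟩
    simp only [hv, if_true, halfSet, mem_filter] at this
    simp only [bits, hvU, dite_true, this.2.2]
  have hmain : ∀ {M : ℕ}, q ^ (2 * d) ≤ 2 * 2 ^ d * M → M ≤ 2 * D.card → q ^ (2 * d) ≤ 4 * 2 ^ d *
      ((range (q ^ (2 * d))).filter fun c => p (bitAt q c) ≠ r (bitAt q c)).card := by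
    intro M h1 h2
    calc q ^ (2 * d) ≤ 2 * 2 ^ d * M := h1
      _ ≤ 2 * 2 ^ d * (2 * D.card) := Nat.mul_le_mul_left _ h2
      _ = 4 * 2 ^ d * D.card := by ring
      _ ≤ _ := Nat.mul_le_mul_left _ hDc
  -- If `r` is constant on the assignments that agree with `a` on `S`, then the whole cylinder of
  -- `a` over `S` consists of disagreements. Otherwise some `b` agrees with `a` on `S` but has
  -- another value of `r`, and half of the cylinder of `a` over `T` can be charged to disagreements.
  by_cases hcase : ∀ b : ℕ → Bool, (∀ j < d, b (σ j) = a (σ j)) → r b = r a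
  · refine hmain (card_bitCylinder hodd hd hU3 hSc a) (le_trans (card_le_card ?_)
      (Nat.le_mul_of_pos_left _ (by norm_num)))
    intro z hz
    have h1 : ∀ j < d, bits z (σ j) = a (σ j) := fun j hj =>
      hcyl hz _ (hSU j hj) (mem_image_of_mem _ (mem_range.2 hj))
    simp only [hD, mem_filter, mem_univ, true_and]
    rw [hp _ _ h1, hcase _ h1]
    exact ha
  · push Not at hcase
    obtain ⟨b, hb1, hb2⟩ := hcase
    set Z := bitCylinder q U T a with hZ
    -- Negating the points of `T` where `a` and `b` differ turns the bits of `a` on `T` into those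
    -- of `b`. No point of `S` is touched, so `p` is kept while `r` changes: of `z` and `ψ z` at
    -- least one is a disagreement.
    let ψ : (U → ZMod q) → (U → ZMod q) := fun z v =>
      if v.1 ∈ T ∧ a v ≠ b v then -z v else z v
    have hψ : Function.Injective ψ := by
      intro z w h
      funext v
      have := congrFun h v
      simp only [ψ] at this
      split_ifs at this
      · exact neg_injective this
      · exact this
    have hflip : ∀ z ∈ Z, z ∉ D → ψ z ∈ D := by
      intro z hz hzD
      have h1 : ∀ j < d, bits z (τ j) = a (τ j) := fun j hj =>
        hcyl hz _ (hTU j hj) (mem_image_of_mem _ (mem_range.2 hj))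
      have h2 : ∀ j < d, bits (ψ z) (τ j) = b (τ j) := fun j hj => by
        have hT' : τ j ∈ T := mem_image_of_mem _ (mem_range.2 hj)
        have hj1 := h1 j hj
        have hz0 := Fintype.mem_piFinset.1 hz ⟨τ j, hTU j hj⟩
        simp only [hT', if_true, halfSet, mem_filter] at hz0
        simp only [bits, hTU j hj, dite_true, ψ, hT', true_and] at hj1 ⊢
        split_ifs with hne
        · rw [halfSet_neg hodd hz0.2.1, hj1]
          revert hne; cases a (τ j) <;> cases b (τ j) <;> simp
        · rw [hj1]; simpa using hne
      have h3 : ∀ j < d, bits (ψ z) (σ j) = bits z (σ j) := fun j hj => by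
        simp [bits, ψ, hb1 j hj]
      simp only [hD, mem_filter, mem_univ, true_and, ne_eq, not_not] at hzD ⊢
      rw [hp _ _ h3, hr _ _ h2, hzD, hr _ _ h1]
      exact fun h => hb2 h.symm
    refine hmain (card_bitCylinder hodd hd hU3 hTc a) ?_
    have e1 : (Z.filter (· ∈ D)).card ≤ D.card :=
      card_le_card fun z hz => (mem_filter.1 hz).2
    have e2 : (Z.filter (· ∉ D)).card ≤ D.card :=
      card_le_card_of_injOn ψ (fun z hz => by
        have hz := mem_filter.1 (mem_coe.1 hz)
        exact hflip z hz.1 hz.2) hψ.injOn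
    have e3 := card_filter_add_card_filter_not (s := Z) (· ∈ D)
    change Z.card ≤ _
    omega

end JuntaLearning

/-! ### Bad classes, merging and the potential -/

namespace JuntaLearning

open Finset

/-- The number with the binary digits `a (σ 0), …, a (σ (d - 1))`. -/
def code (d : ℕ) (a : ℕ → Bool) (σ : ℕ → ℕ) : ℕ :=
  ∑ j ∈ range d, if a (σ j) then 2 ^ j else 0

theorem code_succ (d : ℕ) (a : ℕ → Bool) (σ : ℕ → ℕ) :
    code (d + 1) a σ = code d a σ + if a (σ d) then 2 ^ d else 0 := sum_range_succ _ _

theorem code_lt (d : ℕ) (a : ℕ → Bool) (σ : ℕ → ℕ) : code d a σ < 2 ^ d := by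
  induction d with
  | zero => simp [code]
  | succ d ih => rw [code_succ, pow_succ]; split_ifs <;> omega

theorem code_eq_iff {d : ℕ} {a b : ℕ → Bool} {σ τ : ℕ → ℕ} :
    code d a σ = code d b τ ↔ ∀ j < d, a (σ j) = b (τ j) := by
  constructor
  · induction d with
    | zero => intro _ j hj; omega
    | succ d ih =>
      intro h
      have h1 := code_lt d a σ
      have h2 := code_lt d b τ
      rw [code_succ, code_succ] at h
      have hd : a (σ d) = b (τ d) := by
        cases h3 : a (σ d) <;> cases h4 : b (τ d) <;> simp [h3, h4] at h ⊢ <;> omega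
      have hc : code d a σ = code d b τ := by rw [hd] at h; omega
      intro j hj
      rcases Nat.lt_succ_iff_lt_or_eq.1 hj with hj | rfl
      · exact ih hc j hj
      · exact hd
  · intro h
    exact sum_congr rfl fun j hj => by rw [h j (mem_range.1 hj)]

/-- The code of the restriction to `τ`, as a vertex on the right side. -/
def rcode (d : ℕ) (a : ℕ → Bool) (τ : ℕ → ℕ) : ℕ := 2 ^ d + code d a τ

open Classical in
/-- The labels whose classes can still be joined to others. -/
noncomputable def badLabels (d : ℕ) (σ τ : ℕ → ℕ) (lab : ℕ → ℕ) : Finset ℕ :=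
  (range (2 * 2 ^ d)).filter fun j =>
    ∃ a : ℕ → Bool, ¬(lab (code d a σ) = j ↔ lab (rcode d a τ) = j)

theorem badLabels_card_le (d : ℕ) (σ τ : ℕ → ℕ) (lab : ℕ → ℕ) :
    (badLabels d σ τ lab).card ≤ 2 * 2 ^ d := by
  classical
  exact (card_filter_le _ _).trans (by simp)

/-- The candidates that join two classes. -/
def joining (q d : ℕ) (σ τ : ℕ → ℕ) (lab : ℕ → ℕ) : Finset ℕ :=
  (range (q ^ (2 * d))).filter fun c =>
    lab (code d (bitAt q c) σ) ≠ lab (rcode d (bitAt q c) τ)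

/-- For a bad label `j`, the conditions that the left and that the right vertex have label `j` are
juntas that differ somewhere, so `weight_bound` supplies many candidates at which exactly one of
them holds. Such a candidate joins two classes and is counted for at most these two labels, whence
`8` instead of `4`. -/
theorem badLabels_le_joining {q d : ℕ} (hq : q.Prime) (hd : 4 * d < q) (hodd : Odd q)
    {σ τ : ℕ → ℕ} (hσ : ∀ j < d, σ j < q) (hτ : ∀ j < d, τ j < q) (lab : ℕ → ℕ) :
    q ^ (2 * d) * (badLabels d σ τ lab).card ≤ 8 * 2 ^ d * (joining q d σ τ lab).card := by
  classical
  have h1 : ∀ j ∈ badLabels d σ τ lab, q ^ (2 * d) ≤ 4 * 2 ^ d *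
      ((range (q ^ (2 * d))).filter fun c => decide (lab (code d (bitAt q c) σ) = j) ≠
        decide (lab (rcode d (bitAt q c) τ) = j)).card := by
    intro j hj
    obtain ⟨a, ha⟩ := (mem_filter.1 hj).2
    refine weight_bound hq hd hodd hσ hτ (p := fun a => decide (lab (code d a σ) = j))
      (r := fun a => decide (lab (rcode d a τ) = j)) ?_ ?_ (a := a) ?_
    · intro a b h
      simp only [code_eq_iff.2 h]
    · intro a b h
      exact decide_eq_decide.2 (by rw [rcode, rcode, code_eq_iff.2 h])
    · simpa using ha
  have h2 : ∑ j ∈ badLabels d σ τ lab,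
      ((range (q ^ (2 * d))).filter fun c => decide (lab (code d (bitAt q c) σ) = j) ≠
        decide (lab (rcode d (bitAt q c) τ) = j)).card ≤ 2 * (joining q d σ τ lab).card := by
    simp_rw [card_filter]
    rw [sum_comm, joining, card_filter, mul_sum]
    refine sum_le_sum fun c _ => ?_
    set x := lab (code d (bitAt q c) σ)
    set y := lab (rcode d (bitAt q c) τ)
    by_cases hxy : x = y
    · simp [hxy]
    · rw [if_pos hxy, ← card_filter]
      refine (card_le_card (t := {x, y}) fun j hj => ?_).trans (card_le_two)
      have hj := (mem_filter.1 hj).2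
      simp only [mem_insert, mem_singleton]
      by_contra hcon
      push Not at hcon
      exact hj (by simp [hcon.1.symm, hcon.2.symm])
  calc q ^ (2 * d) * (badLabels d σ τ lab).card
      = ∑ _j ∈ badLabels d σ τ lab, q ^ (2 * d) := by simp [mul_comm]
    _ ≤ _ := sum_le_sum h1
    _ = 4 * 2 ^ d * _ := (mul_sum _ _ _).symm
    _ ≤ 4 * 2 ^ d * (2 * (joining q d σ τ lab).card) := Nat.mul_le_mul_left _ h2
    _ = _ := by ring

/-- Relabelling the class of `y` by `x`. -/
def merge (x y : ℕ) (lab : ℕ → ℕ) (u : ℕ) : ℕ := if lab u = y then x else lab u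

/-- If two classes are joined, both of their labels were bad. Afterwards `y` is unused and no longer
bad, `x` may remain bad, and the classes of all other labels are unchanged. -/
theorem badLabels_merge {d : ℕ} {σ τ : ℕ → ℕ} {lab : ℕ → ℕ}
    (hlab : ∀ u < 2 * 2 ^ d, lab u < 2 * 2 ^ d) (a : ℕ → Bool) :
    (badLabels d σ τ (merge (lab (code d a σ)) (lab (rcode d a τ)) lab)).card +
      (if lab (code d a σ) ≠ lab (rcode d a τ) then 1 else 0) ≤ (badLabels d σ τ lab).card := by
  classical
  set x := lab (code d a σ) with hx
  set y := lab (rcode d a τ) with hy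
  have hxl : x < 2 * 2 ^ d := hlab _ ((code_lt d a σ).trans_le (by omega))
  have hyl : y < 2 * 2 ^ d := hlab _ (by have := code_lt d a τ; unfold rcode; omega)
  by_cases hxy : x = y
  · have : merge x y lab = lab := by
      funext u; unfold merge; split_ifs with h
      · rw [h, hxy]
      · rfl
    rw [this, if_neg (not_not.2 hxy), add_zero]
  · have hxb : x ∈ badLabels d σ τ lab :=
      mem_filter.2 ⟨mem_range.2 hxl, a, fun h => hxy (h.1 rfl).symm⟩
    have hyb : y ∈ badLabels d σ τ lab :=
      mem_filter.2 ⟨mem_range.2 hyl, a, fun h => hxy (h.2 rfl)⟩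
    have hsub : badLabels d σ τ (merge x y lab) ⊆ (badLabels d σ τ lab).erase y := by
      intro j hj
      obtain ⟨hj1, b, hb⟩ := mem_filter.1 hj
      have hjy : j ≠ y := by
        rintro rfl
        refine hb ?_
        have : ∀ u, merge x y lab u ≠ y := fun u => by
          unfold merge; split_ifs with h
          · exact hxy
          · exact h
        simp [this]
      refine mem_erase.2 ⟨hjy, ?_⟩
      by_cases hjx : j = x
      · exact hjx ▸ hxb
      · have : ∀ u, merge x y lab u = j ↔ lab u = j := fun u => by
          unfold merge; split_ifs with h
          · rw [h]; exact ⟨fun h => absurd h.symm hjx, fun h => absurd h.symm hjy⟩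
          · rfl
        rw [this, this] at hb
        exact mem_filter.2 ⟨hj1, b, hb⟩
    have := card_le_card hsub
    rw [card_erase_of_mem hyb] at this
    have hpos := card_pos.2 ⟨y, hyb⟩
    rw [if_pos hxy]
    omega

theorem joined_of_badLabels_eq_empty {d : ℕ} {σ τ : ℕ → ℕ} {lab : ℕ → ℕ}
    (hlab : ∀ u < 2 * 2 ^ d, lab u < 2 * 2 ^ d) (h : badLabels d σ τ lab = ∅) (a : ℕ → Bool) :
    lab (code d a σ) = lab (rcode d a τ) := by
  classical
  by_contra hne
  have : lab (code d a σ) ∈ badLabels d σ τ lab := mem_filter.2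
    ⟨mem_range.2 (hlab _ ((code_lt d a σ).trans_le (by omega))), a, fun h => hne (h.1 rfl).symm⟩
  simp [h] at this

/-- The `s`-th tuple of variables. -/
def tuple (q s j : ℕ) : ℕ := polyVal q s j

/-- The total number of bad labels. -/
noncomputable def potential (q d : ℕ) (lab : ℕ → ℕ → ℕ → ℕ) : ℕ :=
  ∑ s ∈ range (q ^ d), ∑ t ∈ range (q ^ d), (badLabels d (tuple q s) (tuple q t) (lab s t)).card

/-- The number of pairs of tuples for which the candidate `c` joins two classes. -/
def score (q d : ℕ) (lab : ℕ → ℕ → ℕ → ℕ) (c : ℕ) : ℕ :=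
  ∑ s ∈ range (q ^ d), ∑ t ∈ range (q ^ d),
    if lab s t (code d (bitAt q c) (tuple q s)) ≠ lab s t (rcode d (bitAt q c) (tuple q t))
    then 1 else 0

/-- The best candidate does well on average. -/
theorem potential_le_score {q d : ℕ} (hq : q.Prime) (hd : 4 * d < q) (hodd : Odd q)
    (lab : ℕ → ℕ → ℕ → ℕ) {b : ℕ} (hb : ∀ c < q ^ (2 * d), score q d lab c ≤ score q d lab b) :
    potential q d lab ≤ 8 * 2 ^ d * score q d lab b := by
  have hpos : 0 < q ^ (2 * d) := pow_pos hq.pos _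
  refine Nat.le_of_mul_le_mul_left ?_ hpos
  -- Averaging: summed over all candidates, the scores count the joining candidates of all pairs,
  -- and the maximum is at least the mean.
  calc q ^ (2 * d) * potential q d lab
      = ∑ s ∈ range (q ^ d), ∑ t ∈ range (q ^ d),
          q ^ (2 * d) * (badLabels d (tuple q s) (tuple q t) (lab s t)).card := by
        simp only [potential, mul_sum]
    _ ≤ ∑ s ∈ range (q ^ d), ∑ t ∈ range (q ^ d),
          8 * 2 ^ d * (joining q d (tuple q s) (tuple q t) (lab s t)).card :=
        sum_le_sum fun s _ => sum_le_sum fun t _ => badLabels_le_joining hq hd hodd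
          (fun _ _ => polyVal_lt hq.pos _ _) (fun _ _ => polyVal_lt hq.pos _ _) _
    _ = 8 * 2 ^ d * ∑ c ∈ range (q ^ (2 * d)), score q d lab c := by
        simp only [joining, card_filter, score, ← mul_sum]
        congr 1
        exact (sum_comm.trans (sum_congr rfl fun s _ => sum_comm)).symm
    _ ≤ 8 * 2 ^ d * ∑ _c ∈ range (q ^ (2 * d)), score q d lab b :=
        Nat.mul_le_mul_left _ (sum_le_sum fun c hc => hb c (mem_range.1 hc))
    _ = _ := by simp; ring

/-- One round of the greedy construction. -/
def mergeAll (q d c : ℕ) (lab : ℕ → ℕ → ℕ → ℕ) (s t : ℕ) : ℕ → ℕ :=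
  merge (lab s t (code d (bitAt q c) (tuple q s))) (lab s t (rcode d (bitAt q c) (tuple q t)))
    (lab s t)

theorem potential_mergeAll {q d : ℕ} {lab : ℕ → ℕ → ℕ → ℕ}
    (hlab : ∀ s < q ^ d, ∀ t < q ^ d, ∀ u < 2 * 2 ^ d, lab s t u < 2 * 2 ^ d) (c : ℕ) :
    potential q d (mergeAll q d c lab) + score q d lab c ≤ potential q d lab := by
  simp only [potential, score, ← sum_add_distrib]
  exact sum_le_sum fun s hs => sum_le_sum fun t ht =>
    badLabels_merge (hlab s (mem_range.1 hs) t (mem_range.1 ht)) _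

/-- A round removes at least the fraction `1 / K`. After `K * l` rounds at most `(1 - 1/K) ^ (K * l)
≤ exp (-l) ≤ 2 ^ (-l)` of the start is left, which is below `1`, and an integer below `1` is zero.
-/
theorem decay {K : ℕ} (hK : 1 ≤ K) {Φ : ℕ → ℕ} {N : ℕ}
    (h : ∀ r < N, ∃ x, Φ r ≤ K * x ∧ Φ (r + 1) + x ≤ Φ r) {l : ℕ} (h0 : Φ 0 < 2 ^ l)
    (hN : K * l ≤ N) : Φ N = 0 := by
  have hKr : (1 : ℝ) ≤ K := by exact_mod_cast hK
  have hf : (0 : ℝ) ≤ 1 - 1 / K := by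
    rw [sub_nonneg, div_le_one (by linarith)]; exact hKr
  have hstep : ∀ r ≤ N, (Φ r : ℝ) ≤ (1 - 1 / K) ^ r * Φ 0 := by
    intro r
    induction r with
    | zero => intro _; simp
    | succ r ih =>
      intro hr
      obtain ⟨x, h1, h2⟩ := h r (by omega)
      have h1 : (Φ r : ℝ) ≤ K * x := by exact_mod_cast h1
      have h2 : (Φ (r + 1) : ℝ) + x ≤ Φ r := by exact_mod_cast h2
      have h3 : (Φ r : ℝ) / K ≤ x := by rw [div_le_iff₀ (by linarith)]; linarith
      calc (Φ (r + 1) : ℝ) ≤ (1 - 1 / K) * Φ r := by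
            have : (1 - 1 / (K : ℝ)) * Φ r = Φ r - Φ r / K := by ring
            rw [this]; linarith
        _ ≤ (1 - 1 / K) * ((1 - 1 / K) ^ r * Φ 0) := mul_le_mul_of_nonneg_left (ih (by omega)) hf
        _ = _ := by ring
  have hfe : (1 - 1 / K : ℝ) ≤ Real.exp (-(1 / K)) := by
    have := Real.add_one_le_exp (-(1 / (K : ℝ))); linarith
  have hpow : (1 - 1 / K : ℝ) ^ N ≤ Real.exp (-l) := by
    calc (1 - 1 / K : ℝ) ^ N ≤ Real.exp (-(1 / K)) ^ N := pow_le_pow_left₀ hf hfe N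
      _ = Real.exp (-(N / K)) := by rw [← Real.exp_nat_mul]; congr 1; ring
      _ ≤ Real.exp (-l) := by
          rw [Real.exp_le_exp, neg_le_neg_iff, le_div_iff₀ (by linarith)]
          have : ((K * l : ℕ) : ℝ) ≤ N := by exact_mod_cast hN
          push_cast at this; linarith
  have h2l : Real.exp (-l) * (2 : ℝ) ^ l ≤ 1 := by
    have h2 : (2 : ℝ) ≤ Real.exp 1 := by have := Real.add_one_le_exp (1 : ℝ); linarith
    have : (2 : ℝ) ^ l ≤ Real.exp l := by
      calc (2 : ℝ) ^ l ≤ Real.exp 1 ^ l := pow_le_pow_left₀ (by norm_num) h2 l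
        _ = Real.exp l := by rw [← Real.exp_nat_mul]; simp
    calc Real.exp (-l) * (2 : ℝ) ^ l ≤ Real.exp (-l) * Real.exp l :=
          mul_le_mul_of_nonneg_left this (Real.exp_pos _).le
      _ = 1 := by rw [← Real.exp_add]; simp
  have hlt : (Φ N : ℝ) < 1 := by
    have h0' : (Φ 0 : ℝ) < 2 ^ l := by exact_mod_cast h0
    calc (Φ N : ℝ) ≤ (1 - 1 / K) ^ N * Φ 0 := hstep N le_rfl
      _ ≤ Real.exp (-l) * Φ 0 := mul_le_mul_of_nonneg_right hpow (by positivity)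
      _ < Real.exp (-l) * 2 ^ l := mul_lt_mul_of_pos_left h0' (Real.exp_pos _)
      _ ≤ 1 := h2l
  have : Φ N < 1 := by exact_mod_cast hlt
  omega

end JuntaLearning

/-! ### Determining families and the recovery of sensitive variables -/

namespace JuntaLearning

open Finset

/-- The family `A` of `N` assignments determines every relation between a function of a tuple of
variables and a function of another tuple. -/
def Determining (q d N : ℕ) (A : ℕ → ℕ) : Prop :=
  ∀ s < q ^ d, ∀ t < q ^ d, ∀ g h : ℕ → Prop,
    (∀ r < N, g (code d (bitAt q (A r)) (tuple q s)) ↔ h (code d (bitAt q (A r)) (tuple q t))) →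
    ∀ a : ℕ → Bool, g (code d a (tuple q s)) ↔ h (code d a (tuple q t))

/-- The labels after `r` rounds. -/
def labSeq (q d : ℕ) (A : ℕ → ℕ) : ℕ → ℕ → ℕ → ℕ → ℕ
  | 0 => fun _ _ u => u
  | r + 1 => mergeAll q d (A r) (labSeq q d A r)

theorem labSeq_congr {q d : ℕ} {A A' : ℕ → ℕ} {r : ℕ} (h : ∀ i < r, A i = A' i) :
    labSeq q d A r = labSeq q d A' r := by
  induction r with
  | zero => rfl
  | succ r ih => rw [labSeq, labSeq, ih fun i hi => h i (by omega), h r (by omega)]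

theorem rcode_lt (d : ℕ) (a : ℕ → Bool) (τ : ℕ → ℕ) : rcode d a τ < 2 * 2 ^ d := by
  have := code_lt d a τ; unfold rcode; omega

theorem code_lt_two_mul (d : ℕ) (a : ℕ → Bool) (τ : ℕ → ℕ) : code d a τ < 2 * 2 ^ d := by
  have := code_lt d a τ; omega

theorem labSeq_lt {q d : ℕ} (A : ℕ → ℕ) (r s t : ℕ) :
    ∀ u < 2 * 2 ^ d, labSeq q d A r s t u < 2 * 2 ^ d := by
  induction r with
  | zero => exact fun u hu => hu
  | succ r ih =>
    intro u hu
    simp only [labSeq, mergeAll, merge]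
    split_ifs
    · exact ih _ (code_lt_two_mul _ _ _)
    · exact ih u hu

/-- Give each left vertex the truth value of `g` and each right vertex that of `h`. By assumption
the two ends of each chosen edge have the same value, so the value is constant on every class formed
by merging along chosen edges. -/
theorem labSeq_sound {q d : ℕ} {A : ℕ → ℕ} {s t : ℕ} {g h : ℕ → Prop} {r : ℕ}
    (hA : ∀ i < r, g (code d (bitAt q (A i)) (tuple q s)) ↔
      h (code d (bitAt q (A i)) (tuple q t))) {u u' : ℕ}
    (huu : labSeq q d A r s t u = labSeq q d A r s t u') :
    (if u < 2 ^ d then g u else h (u - 2 ^ d)) ↔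
      (if u' < 2 ^ d then g u' else h (u' - 2 ^ d)) := by
  induction r generalizing u u' with
  | zero =>
    simp only [labSeq] at huu
    rw [huu]
  | succ r ih =>
    have ih' := fun {u u'} => @ih (fun i hi => hA i (by omega)) u u'
    have hr := hA r (by omega)
    have hlr : (if code d (bitAt q (A r)) (tuple q s) < 2 ^ d
        then g (code d (bitAt q (A r)) (tuple q s))
        else h (code d (bitAt q (A r)) (tuple q s) - 2 ^ d)) ↔
        (if rcode d (bitAt q (A r)) (tuple q t) < 2 ^ d
        then g (rcode d (bitAt q (A r)) (tuple q t))
        else h (rcode d (bitAt q (A r)) (tuple q t) - 2 ^ d)) := by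
      rw [if_pos (code_lt _ _ _), if_neg (by unfold rcode; omega)]
      simpa [rcode] using hr
    simp only [labSeq, mergeAll, merge] at huu
    split_ifs at huu with h1 h2 h2
    · exact ih' (h1.trans h2.symm)
    · exact (ih' h1).trans (hlr.symm.trans (ih' huu))
    · exact (ih' huu).trans (hlr.trans (ih' h2.symm))
    · exact ih' huu

/-- The greedy construction yields a determining family. -/
theorem determining_of_greedy {q d l N : ℕ} (hq : q.Prime) (hd : 4 * d < q) (hodd : Odd q)
    {A : ℕ → ℕ}
    (hA : ∀ r < N, ∀ c < q ^ (2 * d),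
      score q d (labSeq q d A r) c ≤ score q d (labSeq q d A r) (A r))
    (hl : q ^ d * (q ^ d * (2 * 2 ^ d)) < 2 ^ l) (hN : 8 * 2 ^ d * l ≤ N) :
    Determining q d N A := by
  have hpot : potential q d (labSeq q d A N) = 0 := by
    refine decay (K := 8 * 2 ^ d) (Φ := fun r => potential q d (labSeq q d A r))
      (Nat.mul_pos (by norm_num) (by positivity)) (l := l) ?_ ?_ hN
    · intro r hr
      exact ⟨_, potential_le_score hq hd hodd _ (hA r hr),
        potential_mergeAll (fun s _ t _ => labSeq_lt A r s t) _⟩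
    · refine lt_of_le_of_lt ?_ hl
      calc potential q d (labSeq q d A 0)
          ≤ ∑ _s ∈ range (q ^ d), ∑ _t ∈ range (q ^ d), 2 * 2 ^ d :=
            sum_le_sum fun s _ => sum_le_sum fun t _ => badLabels_card_le _ _ _ _
        _ = _ := by simp
  intro s hs t ht g h hgh a
  have hb : badLabels d (tuple q s) (tuple q t) (labSeq q d A N s t) = ∅ := by
    have h1 := (sum_eq_zero_iff.1 hpot) s (mem_range.2 hs)
    exact card_eq_zero.1 ((sum_eq_zero_iff.1 h1) t (mem_range.2 ht))
  have := labSeq_sound hgh (joined_of_badLabels_eq_empty (labSeq_lt A N s t) hb a)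
  rw [if_pos (code_lt _ _ _), if_neg (by unfold rcode; omega)] at this
  simpa [rcode] using this

/-! Reconstruction. -/

/-- Some point is sensitive to `v`. -/
def Sensitive {ι : Type*} [DecidableEq ι] (F : (ι → Bool) → Bool) (v : ι) : Prop :=
  ∃ a : ι → Bool, F (Function.update a v false) ≠ F (Function.update a v true)

theorem eq_of_not_sensitive {ι : Type*} [DecidableEq ι] {F : (ι → Bool) → Bool} {v : ι}
    (h : ¬ Sensitive F v) (a : ι → Bool) (c : Bool) : F (Function.update a v c) = F a := by
  unfold Sensitive at h
  push Not at h
  have h1 : ∀ c c', F (Function.update a v c) = F (Function.update a v c') := by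
    intro c c'
    cases c <;> cases c' <;> simp [h a]
  rw [h1 c (a v), Function.update_eq_self]

/-- A function depends on its sensitive variables only. -/
theorem eq_of_sensitive {ι : Type*} [DecidableEq ι] {F : (ι → Bool) → Bool} {R : Finset ι}
    (hR : ∀ a b : ι → Bool, (∀ v ∈ R, a v = b v) → F a = F b) {a b : ι → Bool}
    (hab : ∀ v ∈ R, Sensitive F v → a v = b v) : F a = F b := by
  -- The coordinates in `R` are moved from `a` to `b` one at a time; each of them is either
  -- insensitive or already equal.
  have key : ∀ D : Finset ι, D ⊆ R → F (fun v => if v ∈ D then b v else a v) = F a := by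
    intro D
    induction D using Finset.induction_on with
    | empty => intro _; simp
    | insert v D hv ih =>
      intro hD
      have ih := ih ((subset_insert v D).trans hD)
      have e : (fun u => if u ∈ insert v D then b u else a u) =
          Function.update (fun u => if u ∈ D then b u else a u) v (b v) := by
        funext u
        by_cases hu : u = v
        · subst hu; simp
        · simp [hu]
      rw [e]
      by_cases hs : Sensitive F v
      · rw [← ih]
        congr 1
        funext u
        by_cases hu : u = v
        · subst hu; simp [hv, hab u (hD (mem_insert_self u D)) hs]
        · simp [hu]
      · rw [eq_of_not_sensitive hs, ih]
  rw [← key R Subset.rfl]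
  exact hR _ _ fun v hv => by simp [hv]

/-- By interpolation at `0`, …, `d - 1` every sequence of `d` field elements is a tuple, in
particular a list of `R` padded with `w`. -/
theorem exists_tuple {q d : ℕ} (hq : q.Prime) (hd : d ≤ q) {R : Finset ℕ} (hR : R ⊆ range q)
    (hRd : R.card ≤ d) {w : ℕ} (hw : w < q) :
    ∃ t < q ^ d, (∀ v ∈ R, ∃ j < d, tuple q t j = v) ∧
      ∀ j < d, tuple q t j ∈ R ∨ tuple q t j = w := by
  have hmem : ∀ j, R.toList.getD j w ∈ R ∨ R.toList.getD j w = w := by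
    intro j
    by_cases hj : j < R.toList.length
    · left
      rw [List.getD_eq_getElem _ _ hj]
      exact mem_toList.1 (List.getElem_mem hj)
    · right
      exact List.getD_eq_default _ _ (by omega)
  obtain ⟨t, ht, h⟩ := exists_polyVal_eq hq (U := range d) (k := d)
    (range_subset_range.2 hd) (by simp) (fun j => R.toList.getD j w) (fun j _ => by
      rcases hmem j with h | h
      · exact mem_range.1 (hR h)
      · rw [h]; exact hw)
  have ht' : ∀ j < d, tuple q t j = R.toList.getD j w := fun j hj => h j (mem_range.2 hj)
  refine ⟨t, ht, fun v hv => ?_, fun j hj => ?_⟩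
  · obtain ⟨j, hj, rfl⟩ := List.mem_iff_getElem.1 (mem_toList.2 hv)
    have hjd : j < d := lt_of_lt_of_le (by simpa using hj) hRd
    exact ⟨j, hjd, by rw [ht' j hjd, List.getD_eq_getElem _ _ hj]⟩
  · rw [ht' j hj]; exact hmem j

/-- The answers are compatible with a function of the `t`-th tuple. -/
def Consistent (q d N : ℕ) (A : ℕ → ℕ) (F : (ℕ → Bool) → Bool) (t : ℕ) : Prop :=
  ∀ r < N, ∀ r' < N, code d (bitAt q (A r)) (tuple q t) = code d (bitAt q (A r')) (tuple q t) →
    F (bitAt q (A r)) = F (bitAt q (A r'))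

/-- `Determining` is applied to a tuple `s` that covers `R`, with `g` the true function on `s`, and
to `t`, with `h` the lookup of a positive answer with the same `t`-code. Consistency says that they
agree on the family; hence they agree everywhere, and `F` is a function of `t`. -/
theorem eq_of_consistent {q d N : ℕ} (hq : q.Prime) (hd : d ≤ q) {A : ℕ → ℕ}
    (hA : Determining q d N A) {F : (ℕ → Bool) → Bool} {R : Finset ℕ} (hR : R ⊆ range q)
    (hRd : R.card ≤ d) (hF : ∀ a b : ℕ → Bool, (∀ v ∈ R, a v = b v) → F a = F b) {t : ℕ}
    (ht : t < q ^ d) (hc : Consistent q d N A F t) {a b : ℕ → Bool}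
    (hab : ∀ j < d, a (tuple q t j) = b (tuple q t j)) : F a = F b := by
  obtain ⟨s, hs, hs1, -⟩ := exists_tuple hq hd hR hRd hq.pos
  have key := hA s hs t ht (fun u => ∃ a, code d a (tuple q s) = u ∧ F a = true)
    (fun u => ∃ r < N, code d (bitAt q (A r)) (tuple q t) = u ∧ F (bitAt q (A r)) = true) ?_
  · have hg : ∀ a, (∃ a', code d a' (tuple q s) = code d a (tuple q s) ∧ F a' = true) ↔
        F a = true := by
      intro a
      refine ⟨?_, fun h => ⟨a, rfl, h⟩⟩
      rintro ⟨a', h1, h2⟩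
      rw [← h2]
      refine hF _ _ fun v hv => ?_
      obtain ⟨j, hj, rfl⟩ := hs1 v hv
      exact (code_eq_iff.1 h1 j hj).symm
    have e := code_eq_iff.2 hab
    have h1 := key a
    have h2 := key b
    simp only [hg] at h1 h2
    rw [e] at h1
    exact Bool.eq_iff_iff.2 (h1.trans h2.symm)
  · intro r hr
    constructor
    · rintro ⟨a', h1, h2⟩
      refine ⟨r, hr, rfl, ?_⟩
      rw [← h2]
      refine hF _ _ fun v hv => ?_
      obtain ⟨j, hj, rfl⟩ := hs1 v hv
      exact (code_eq_iff.1 h1 j hj).symm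
    · rintro ⟨r', hr', h1, h2⟩
      exact ⟨_, rfl, by rw [hc r hr r' hr' h1.symm, h2]⟩

/-- The sensitive variables are those in all consistent tuples. -/
theorem sensitive_iff {q d N : ℕ} (hq : q.Prime) (hd : d ≤ q) {A : ℕ → ℕ}
    (hA : Determining q d N A) {F : (ℕ → Bool) → Bool} {R : Finset ℕ} (hR : R ⊆ range q)
    (hRd : R.card ≤ d) (hF : ∀ a b : ℕ → Bool, (∀ v ∈ R, a v = b v) → F a = F b) (v : ℕ) :
    Sensitive F v ↔ ∀ t < q ^ d, Consistent q d N A F t → ∃ j < d, tuple q t j = v := by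
  classical
  constructor
  · rintro ⟨a, ha⟩ t ht hc
    by_contra hcon
    push Not at hcon
    exact ha (eq_of_consistent hq hd hA hR hRd hF ht hc fun j hj => by simp [hcon j hj])
  · intro h
    by_contra hv
    -- The padding has to differ from `v`, so that `v` can occur in the tuple only as a sensitive
    -- variable.
    obtain ⟨w, hw, hwv⟩ : ∃ w < q, w ≠ v := by
      by_cases h0 : v = 0
      · exact ⟨1, hq.one_lt, by omega⟩
      · exact ⟨0, hq.pos, by omega⟩
    obtain ⟨t, ht, ht1, ht2⟩ := exists_tuple hq hd (R := R.filter (Sensitive F))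
      ((filter_subset _ _).trans hR) ((card_filter_le _ _).trans hRd) hw
    obtain ⟨j, hj, hjv⟩ := h t ht (by
      intro r _ r' _ hrr
      refine eq_of_sensitive hF fun u hu hs => ?_
      obtain ⟨j, hj, rfl⟩ := ht1 u (mem_filter.2 ⟨hu, hs⟩)
      exact code_eq_iff.1 hrr j hj)
    rcases ht2 j hj with h | h
    · rw [hjv] at h; exact hv (mem_filter.1 h).2
    · exact hwv (h.symm.trans hjv)

end JuntaLearning

/-! ### Hash functions and relevant variables -/

namespace JuntaLearning

open Finset

/-- The target after identifying variables with the `α`-th hash function. -/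
def hashed {n : ℕ} (q : ℕ) (f : (Fin n → Bool) → Bool) (α : ℕ) (a : ℕ → Bool) : Bool :=
  f fun i => a (polyVal q i α)

open Classical in
/-- The relevant variables. -/
noncomputable def relevantSet {n : ℕ} (f : (Fin n → Bool) → Bool) : Finset (Fin n) :=
  univ.filter (Relevant f)

theorem mem_relevantSet {n : ℕ} {f : (Fin n → Bool) → Bool} {i : Fin n} :
    i ∈ relevantSet f ↔ Relevant f i := by simp [relevantSet]

theorem card_relevantSet_le {n d : ℕ} {f : (Fin n → Bool) → Bool} (hf : f ∈ Junta n d) :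
    (relevantSet f).card ≤ d := by
  classical
  have : {i : Fin n | Relevant f i} = ↑(relevantSet f) := by
    ext i; simp [mem_relevantSet]
  rw [Junta, Set.mem_ofPred_eq, this, Set.ncard_coe_finset] at hf
  exact hf

theorem eq_of_relevantSet {n : ℕ} {f : (Fin n → Bool) → Bool} {x y : Fin n → Bool}
    (h : ∀ i ∈ relevantSet f, x i = y i) : f x = f y :=
  eq_of_sensitive (R := univ) (fun a b hab => by rw [funext fun i => hab i (mem_univ i)])
    fun i _ hi => h i (mem_relevantSet.2 hi)

open Classical in
/-- The sensitive classes of variables of the `α`-th hash function. -/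
noncomputable def classes {n : ℕ} (q : ℕ) (f : (Fin n → Bool) → Bool) (α : ℕ) : Finset ℕ :=
  (range q).filter (Sensitive (hashed q f α))

/-- The image of the relevant variables. -/
noncomputable def hashedSet {n : ℕ} (q : ℕ) (f : (Fin n → Bool) → Bool) (α : ℕ) : Finset ℕ :=
  (relevantSet f).image fun i : Fin n => polyVal q i α

theorem hashed_congr {n q : ℕ} {f : (Fin n → Bool) → Bool} {α : ℕ} (a b : ℕ → Bool)
    (h : ∀ v ∈ hashedSet q f α, a v = b v) : hashed q f α a = hashed q f α b :=
  eq_of_relevantSet fun _ hi => h _ (mem_image_of_mem _ hi)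

theorem hashedSet_subset {n q : ℕ} (hq : 0 < q) (f : (Fin n → Bool) → Bool) (α : ℕ) :
    hashedSet q f α ⊆ range q := by
  intro v hv
  obtain ⟨i, _, rfl⟩ := mem_image.1 hv
  exact mem_range.2 (polyVal_lt hq _ _)

theorem classes_subset {n q : ℕ} (f : (Fin n → Bool) → Bool) (α : ℕ) :
    classes q f α ⊆ hashedSet q f α := by
  classical
  intro v hv
  obtain ⟨a, ha⟩ := (mem_filter.1 hv).2
  by_contra hcon
  refine ha (hashed_congr _ _ fun u hu => ?_)
  have : u ≠ v := fun h => hcon (h ▸ hu)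
  simp [this]

theorem classes_card_le {n q : ℕ} (f : (Fin n → Bool) → Bool) (α : ℕ) :
    (classes q f α).card ≤ (relevantSet f).card :=
  (card_le_card (classes_subset f α)).trans card_image_le

theorem exists_comp_hash {n q : ℕ} {S : Finset (Fin n)} {α : ℕ}
    (hinj : Set.InjOn (fun i : Fin n => polyVal q i α) S) (x : Fin n → Bool) :
    ∃ a : ℕ → Bool, ∀ i ∈ S, a (polyVal q i α) = x i := by
  classical
  refine ⟨fun v => decide (∃ i ∈ S, polyVal q i α = v ∧ x i = true), fun i hi => ?_⟩
  refine Bool.eq_iff_iff.2 ?_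
  rw [decide_eq_true_iff]
  constructor
  · rintro ⟨j, hj, h1, h2⟩
    rwa [hinj hj hi h1] at h2
  · exact fun h => ⟨i, hi, rfl, h⟩

/-- If the hash function separates the relevant variables, the hashed target is the target with
renamed relevant variables: changing the class of `i` changes `i` and no other relevant variable. -/
theorem classes_eq {n q : ℕ} (hq : 0 < q) {f : (Fin n → Bool) → Bool} {α : ℕ}
    (hinj : Set.InjOn (fun i : Fin n => polyVal q i α) (relevantSet f)) :
    classes q f α = hashedSet q f α := by
  classical
  refine Subset.antisymm (classes_subset f α) fun v hv => ?_
  refine mem_filter.2 ⟨hashedSet_subset hq f α hv, ?_⟩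
  obtain ⟨i, hi, rfl⟩ := mem_image.1 hv
  obtain ⟨x, hx⟩ := mem_relevantSet.1 hi
  obtain ⟨a, ha⟩ := exists_comp_hash hinj x
  have key : ∀ c, hashed q f α (Function.update a (polyVal q i α) c) =
      f (Function.update x i c) := by
    intro c
    refine eq_of_relevantSet fun j hj => ?_
    by_cases hji : j = i
    · subst hji; simp
    · have : polyVal q j α ≠ polyVal q i α := fun h => hji (hinj hj hi h)
      simp [this, hji, ha j hj]
  exact ⟨a, by rwa [key, key]⟩

/-- The sensitive classes lie in the image of the relevant variables, and this image has full size
only if the hash function is injective on them. So the number of classes, which can be observed,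
reveals whether a hash function is good. -/
theorem classes_card_eq_iff {n q : ℕ} (hq : 0 < q) {f : (Fin n → Bool) → Bool} {α : ℕ} :
    (classes q f α).card = (relevantSet f).card ↔
      Set.InjOn (fun i : Fin n => polyVal q i α) (relevantSet f) := by
  constructor
  · intro h
    refine card_image_iff.1 (le_antisymm card_image_le ?_)
    rw [← h]
    exact card_le_card (classes_subset f α)
  · intro h
    rw [classes_eq hq h]
    exact card_image_iff.2 h

/-- A perfect hash function exists among the first ones. -/
theorem exists_injOn {n q d k m : ℕ} (hq : q.Prime) (hn : n ≤ q ^ k) (hk : 1 ≤ k)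
    (hm : 2 * d ^ 2 * k ≤ m) (hmq : m ≤ q) (hd : 1 ≤ d) {S : Finset (Fin n)}
    (hS : S.card ≤ d + 1) :
    ∃ α < m, Set.InjOn (fun i : Fin n => polyVal q i α) S := by
  classical
  by_contra hcon
  push Not at hcon
  have hcov : range m ⊆ S.offDiag.biUnion fun p =>
      (range q).filter fun v => polyVal q p.1 v = polyVal q p.2 v := by
    intro α hα
    have hαm := mem_range.1 hα
    have := hcon α hαm
    simp only [Set.InjOn, not_forall] at this
    obtain ⟨i, hi, j, hj, hij, hne⟩ := this
    refine mem_biUnion.2 ⟨(i, j), mem_offDiag.2 ⟨hi, hj, hne⟩, ?_⟩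
    exact mem_filter.2 ⟨mem_range.2 (by omega), hij⟩
  -- If every `α < m` had a collision, then at most `k - 1` collision points for each of at most `(d
  -- + 1) * d ≤ 2 * d ^ 2` ordered pairs would cover `m ≥ 2 * d ^ 2 * k` points.
  have h1 : m ≤ S.offDiag.card * (k - 1) := by
    have h := card_le_card hcov
    rw [card_range] at h
    refine h.trans (card_biUnion_le_card_mul _ _ _ fun p hp => ?_)
    have hne := (mem_offDiag.1 hp).2.2
    have := card_polyVal_eq_lt hq (p.1.2.trans_le hn) (p.2.2.trans_le hn)
      (fun h => hne (Fin.ext h))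
    omega
  have h2 : S.offDiag.card ≤ 2 * d ^ 2 := by
    rw [offDiag_card]
    have : S.card * S.card - S.card = S.card * (S.card - 1) := by
      rw [Nat.mul_sub, mul_one]
    rw [this]
    calc S.card * (S.card - 1) ≤ (d + 1) * d := Nat.mul_le_mul hS (by omega)
      _ ≤ 2 * d ^ 2 := by nlinarith
  obtain ⟨k, rfl⟩ := Nat.exists_eq_add_of_le' hk
  have h3 : S.offDiag.card * (k + 1 - 1) ≤ 2 * d ^ 2 * k := by
    simpa using Nat.mul_le_mul_right k h2
  have h4 : 0 < d ^ 2 := by positivity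
  nlinarith

/-- The hash functions with the most classes are those that separate the relevant variables. -/
theorem maximal_iff {n q d k m : ℕ} (hq : q.Prime) (hn : n ≤ q ^ k) (hk : 1 ≤ k)
    (hm : 2 * d ^ 2 * k ≤ m) (hmq : m ≤ q) (hd : 1 ≤ d) {f : (Fin n → Bool) → Bool}
    (hf : f ∈ Junta n d) (α : ℕ) :
    (∀ β < m, (classes q f β).card ≤ (classes q f α).card) ↔
      Set.InjOn (fun i : Fin n => polyVal q i α) (relevantSet f) := by
  rw [← classes_card_eq_iff hq.pos]
  constructor
  · intro h
    obtain ⟨β, hβ, hinj⟩ := exists_injOn hq hn hk hm hmq hd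
      (S := relevantSet f) (by have := card_relevantSet_le hf; omega)
    refine le_antisymm (classes_card_le f α) ?_
    rw [← (classes_card_eq_iff hq.pos).2 hinj]
    exact h β hβ
  · intro h β _
    rw [h]
    exact classes_card_le f β

/-- The relevant variables are those whose class is sensitive for all good hash functions. -/
theorem mem_relevantSet_iff {n q d k m : ℕ} (hq : q.Prime) (hn : n ≤ q ^ k) (hk : 1 ≤ k)
    (hm : 2 * d ^ 2 * k ≤ m) (hmq : m ≤ q) (hd : 1 ≤ d) {f : (Fin n → Bool) → Bool}
    (hf : f ∈ Junta n d) (i : Fin n) :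
    i ∈ relevantSet f ↔ ∀ α < m, (∀ β < m, (classes q f β).card ≤ (classes q f α).card) →
      polyVal q i α ∈ classes q f α := by
  classical
  simp only [maximal_iff hq hn hk hm hmq hd hf]
  constructor
  · intro hi α _ hα
    rw [classes_eq hq.pos hα]
    exact mem_image_of_mem _ hi
  · intro h
    -- This is why `d + 1` variables have to be separated: here `α` separates `i` from the relevant
    -- variables too, so a sensitive class of `i` forces `i` to be one of them.
    obtain ⟨α, hα, hinj⟩ := exists_injOn hq hn hk hm hmq hd
      (S := insert i (relevantSet f)) (by
        have := card_relevantSet_le hf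
        exact (card_insert_le _ _).trans (by omega))
    have hinj' : Set.InjOn (fun i : Fin n => polyVal q i α) (relevantSet f) :=
      hinj.mono (by simp)
    have := h α hα hinj'
    rw [classes_eq hq.pos hinj'] at this
    obtain ⟨j, hj, hji⟩ := mem_image.1 this
    have := hinj (mem_coe.2 (mem_insert_of_mem hj)) (mem_coe.2 (mem_insert_self _ _)) hji
    exact this ▸ hj

/-- Every assignment to the relevant variables is queried. -/
theorem exists_query {n q d k m N : ℕ} (hq : q.Prime) (hn : n ≤ q ^ k) (hk : 1 ≤ k)
    (hm : 2 * d ^ 2 * k ≤ m) (hmq : m ≤ q) (hd : 1 ≤ d) (hdq : d ≤ q)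
    {f : (Fin n → Bool) → Bool}
    (hf : f ∈ Junta n d) {A : ℕ → ℕ} (hA : Determining q d N A) (x : Fin n → Bool) :
    ∃ α < m, ∃ r < N, ∀ i ∈ relevantSet f, bitAt q (A r) (polyVal q i α) = x i := by
  obtain ⟨α, hα, hinj⟩ := exists_injOn hq hn hk hm hmq hd
    (S := relevantSet f) (by have := card_relevantSet_le hf; omega)
  obtain ⟨a, ha⟩ := exists_comp_hash hinj x
  obtain ⟨t, ht, ht1, -⟩ := exists_tuple hq hdq (hashedSet_subset hq.pos f α)
    (card_image_le.trans (card_relevantSet_le hf)) hq.pos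
  -- If no member of the family had this code, its indicator and the constant `False` would agree on
  -- the family but not at `a`.
  have : ∃ r < N, code d (bitAt q (A r)) (tuple q t) = code d a (tuple q t) := by
    by_contra hcon
    push Not at hcon
    exact (hA t ht t ht (fun u => u = code d a (tuple q t)) (fun _ => False)
      (fun r hr => iff_of_false (hcon r hr) id) a).1 rfl
  obtain ⟨r, hr, hc⟩ := this
  refine ⟨α, hα, r, hr, fun i hi => ?_⟩
  obtain ⟨j, hj, h⟩ := ht1 _ (mem_image_of_mem _ hi)
  rw [← ha i hi]
  have := code_eq_iff.1 hc j hj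
  rwa [h] at this

theorem mem_classes_iff {n q d N : ℕ} (hq : q.Prime) (hdq : d ≤ q) {f : (Fin n → Bool) → Bool}
    (hf : f ∈ Junta n d) {A : ℕ → ℕ} (hA : Determining q d N A) (α v : ℕ) :
    v ∈ classes q f α ↔ v < q ∧
      ∀ t < q ^ d, Consistent q d N A (hashed q f α) t → ∃ j < d, tuple q t j = v := by
  simp only [classes, mem_filter, mem_range]
  exact and_congr_right fun _ => sensitive_iff hq hdq hA (hashedSet_subset hq.pos f α)
    (card_image_le.trans (card_relevantSet_le hf)) hashed_congr v

end JuntaLearning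

/-! ### The algorithm and its tables -/

namespace JuntaLearning

open Finset

/-! The algorithm. Registers: `1` is `d`, `2` is `n`, `3` is `8 n³`, `4` is `log n`, `6` is the
field size `q`, `7` the number of base-`q` digits of `n`, `8` is `log q`, `9` the number `m` of
hash functions, `10` is `2^d`, `11` is `q^d`, `12` is `q^(2d)`, `13` is `q^(2d) + n`, `14` is the
number `N` of assignments per hash function, `15` is `2 * 2^d`, `16` is `m * N`, `17` the arity of
the hypothesis; `20`, …, `28` are loop counters. Arrays: `4` powers of `2`, `5` powers of `q`,
`6` values of polynomials, `7` the chosen assignments, `8` labels, `9` scratch, `10` sensitive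
classes, `11` relevant variables. -/

namespace Term

/-- If `a = b` then `x` else `y`. -/
def ifEq (a b x y : Term) : Term := ite a b y (ite b a y x)

theorem eval_ifEq (m : ℕ → ℕ → ℕ) (ρ : ℕ → ℕ) (a b x y : Term) :
    (ifEq a b x y).eval m ρ = if a.eval m ρ = b.eval m ρ then x.eval m ρ else y.eval m ρ := by
  simp only [ifEq, eval]
  split_ifs <;> first | rfl | omega

/-- If `a` is positive then `x` else `y`. -/
def ifPos (a x y : Term) : Term := ite (const 0) a x y

theorem eval_ifPos (m : ℕ → ℕ → ℕ) (ρ : ℕ → ℕ) (a x y : Term) :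
    (ifPos a x y).eval m ρ = if 0 < a.eval m ρ then x.eval m ρ else y.eval m ρ := rfl

/-- The product with the register `p`. -/
def times (p : ℕ) (a : Term) : Term := mul p a (var p)

theorem eval_times (m : ℕ → ℕ → ℕ) (ρ : ℕ → ℕ) (p : ℕ) (a : Term) :
    (times p a).eval m ρ = a.eval m ρ * ρ p := by simp [times, eval]

/-- The value of a polynomial, from the table. -/
def look (c v : Term) : Term := load 6 (add (times 6 c) v)

/-- If the bit of the assignment `c` at `v` is set then `x` else `y`. -/
def ifBit (c v x y : Term) : Term := ite (add (look c v) (look c v)) (var 6) x y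

/-- The code of the restriction of the assignment `c` to the `s`-th tuple. -/
def codeOf (c s : Term) : Term :=
  sum 28 1 (ifBit c (look s (var 28)) (load 4 (var 28)) (const 0))

/-- The residue modulo register `6`, for numbers below its square plus itself. -/
def modq (y : Term) : Term :=
  sub y (times 6 (sum 23 6 (ite y (times 6 (add (var 23) (const 1))) (const 0) (const 1))))

/-- The label of the vertex `u` for the tuples `s`, `t`: address and value. -/
def labAddr (s t u : Term) : Term := add (times 15 (add (times 11 s) t)) u
def labOf (s t u : Term) : Term := load 8 (labAddr s t u)

/-- The labels of the two vertices of the assignment `c`. -/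
def labLeft (s t c : Term) : Term := labOf s t (codeOf c s)
def labRight (s t c : Term) : Term := labOf s t (add (var 10) (codeOf c t))

/-- The score of the candidate `c`. -/
def scoreOf (c : Term) : Term :=
  sum 22 11 (sum 23 11 (ifEq (labLeft (var 22) (var 23) c) (labRight (var 22) (var 23) c)
    (const 0) (const 1)))

/-- Not prime. -/
def composite (y : Term) : Term :=
  sum 22 3 (sum 23 3 (ifEq (mul 3 (add (var 22) (const 2)) (add (var 23) (const 2))) y
    (const 1) (const 0)))

/-- The number of conflicts of the answers for hash function `20` on the tuple `22`. -/
def conflicts : Term :=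
  sum 24 14 (sum 25 14 (ifEq (codeOf (load 7 (var 24)) (var 22)) (codeOf (load 7 (var 25)) (var 22))
    (ifEq (load 1 (add (times 14 (var 20)) (var 24))) (load 1 (add (times 14 (var 20)) (var 25)))
      (const 0) (const 1)) (const 0)))

/-- The class `21` is sensitive for the hash function `20`. -/
def sensitiveClass : Term :=
  ifPos (sum 22 11 (ifPos conflicts (const 0)
    (ifPos (sum 26 1 (ifEq (look (var 22) (var 26)) (var 21) (const 1) (const 0)))
      (const 0) (const 1)))) (const 0) (const 1)

/-- The number of sensitive classes. -/
def countClasses (α : Term) : Term := sum 23 6 (load 10 (add (times 6 α) (var 23)))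

/-- The variable `20` is relevant. -/
def relevantVar : Term :=
  ifPos (sum 21 9 (ifPos (sum 22 9 (ite (countClasses (var 21)) (countClasses (var 22))
      (const 1) (const 0))) (const 0)
    (ifPos (load 10 (add (times 6 (var 21)) (look (var 20) (var 21)))) (const 0) (const 1))))
    (const 0) (const 1)

end Term

namespace Stmt

open Term

/-- The table of powers of `2`. -/
def powersOfTwo : Stmt :=
  seq (store 4 (const 0) (const 1))
    (rep 20 3 (store 4 (add (var 20) (const 1)) (add (load 4 (var 20)) (load 4 (var 20)))))

/-- The table of powers of `q`. -/
def powersOfQ : Stmt :=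
  seq (store 5 (const 0) (const 1))
    (rep 20 3 (store 5 (add (var 20) (const 1)) (times 6 (load 5 (var 20)))))

/-- The table of values of polynomials. -/
def polyTable : Stmt :=
  rep 20 13 (rep 21 6 (rep 22 6 (store 6
    (add (times 6 (add (times 6 (var 20)) (var 21))) (var 22))
    (modq (add (var 21) (mul 6 (look (var 20) (var 22)) (var 22)))))))

/-- The initial labels. -/
def initLabels : Stmt :=
  rep 20 11 (rep 21 11 (rep 22 15 (store 8 (labAddr (var 20) (var 21) (var 22)) (var 22))))

/-- Choose the best candidate of round `20`. -/
def choose : Stmt :=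
  seq (store 9 (const 0) (const 0)) (seq (store 7 (var 20) (const 0))
    (rep 21 12 (ite (load 9 (const 0)) (scoreOf (var 21))
      (seq (store 7 (var 20) (var 21)) (store 9 (const 0) (scoreOf (var 21))))
      (store 9 (const 0) (load 9 (const 0))))))

/-- Merge the classes that are joined by the chosen candidate. -/
def mergeLabels : Stmt :=
  -- Both labels are saved first, because the relabelling overwrites the cells from which they are
  -- read.
  rep 22 11 (rep 23 11 (seq (store 9 (const 1) (labLeft (var 22) (var 23) (load 7 (var 20))))
    (seq (store 9 (const 2) (labRight (var 22) (var 23) (load 7 (var 20))))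
      (rep 24 15 (store 8 (labAddr (var 22) (var 23) (var 24))
        (ifEq (labOf (var 22) (var 23) (var 24)) (load 9 (const 2)) (load 9 (const 1))
          (labOf (var 22) (var 23) (var 24))))))))

/-- The greedy construction. -/
def greedy : Stmt := rep 20 14 (seq choose mergeLabels)

/-- Write the queries. -/
def writeQueries : Stmt :=
  rep 20 9 (rep 21 14 (rep 22 2 (store 0
    (add (times 2 (add (times 14 (var 20)) (var 21))) (var 22))
    (ifBit (load 7 (var 21)) (look (var 22) (var 20)) (const 1) (const 0)))))

/-- Find the sensitive classes. -/
def findClasses : Stmt :=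
  rep 20 9 (rep 21 6 (store 10 (add (times 6 (var 20)) (var 21)) sensitiveClass))

/-- Find the relevant variables. -/
def findRelevant : Stmt := rep 20 2 (store 11 (var 20) relevantVar)

/-- List the relevant variables. -/
def listRelevant : Stmt :=
  rep 20 2 (ite (const 0) (load 11 (var 20))
    -- A relevant variable goes to the position given by the number of relevant variables before it.
    -- The other branch writes to scratch and stands for doing nothing.
    (store 2 (sum 21 20 (load 11 (var 21))) (var 20)) (store 9 (const 0) (const 0)))

/-- Write the truth table. -/
def writeTable : Stmt :=
  rep 20 16 (store 3
    (sum 21 17 (Term.ite (const 0) (load 0 (add (times 2 (var 20)) (load 2 (var 21))))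
      (load 4 (var 21)) (const 0))) (load 1 (var 20)))

end Stmt

/-! Correctness of the phases. -/

/-- The registers hold the parameters. -/
structure IsEnv (ρ : ℕ → ℕ) (n d q m N : ℕ) : Prop where
  r1 : ρ 1 = d
  r2 : ρ 2 = n
  r6 : ρ 6 = q
  r9 : ρ 9 = m
  r10 : ρ 10 = 2 ^ d
  r11 : ρ 11 = q ^ d
  r12 : ρ 12 = q ^ (2 * d)
  r13 : ρ 13 = q ^ (2 * d) + n
  r14 : ρ 14 = N
  r15 : ρ 15 = 2 * 2 ^ d
  r16 : ρ 16 = m * N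

theorem IsEnv.update {ρ : ℕ → ℕ} {n d q m N : ℕ} (h : IsEnv ρ n d q m N) {x : ℕ} (hx : 17 ≤ x)
    (i : ℕ) : IsEnv (Function.update ρ x i) n d q m N := by
  obtain ⟨h1, h2, h3, h4, h5, h6, h7, h8, h9, h10, h11⟩ := h
  constructor <;> rw [Function.update_of_ne (by omega)] <;> assumption

/-- The tables hold the powers of `2` and the values of the polynomials. -/
structure HasTables (M : ℕ → ℕ → ℕ) (n d q : ℕ) : Prop where
  pow : ∀ j ≤ d, M 4 j = 2 ^ j
  poly : ∀ i < q ^ (2 * d) + n, ∀ v < q, M 6 (i * q + v) = polyVal q i v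

theorem HasTables.congr {M M' : ℕ → ℕ → ℕ} {n d q : ℕ} (h : HasTables M n d q)
    (h4 : M' 4 = M 4) (h6 : M' 6 = M 6) : HasTables M' n d q :=
  ⟨by rw [h4]; exact h.pow, by rw [h6]; exact h.poly⟩

namespace Term

theorem eval_look {M : ℕ → ℕ → ℕ} {ρ : ℕ → ℕ} {n d q m N : ℕ} (hρ : IsEnv ρ n d q m N)
    (hM : HasTables M n d q) {c v : Term} (hc : c.eval M ρ < q ^ (2 * d) + n)
    (hv : v.eval M ρ < q) : (look c v).eval M ρ = polyVal q (c.eval M ρ) (v.eval M ρ) := by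
  rw [look, eval, eval, eval_times, hρ.r6, hM.poly _ hc _ hv]

theorem eval_ifBit {M : ℕ → ℕ → ℕ} {ρ : ℕ → ℕ} {n d q m N : ℕ} (hρ : IsEnv ρ n d q m N)
    (hM : HasTables M n d q) {c v x y : Term} (hc : c.eval M ρ < q ^ (2 * d) + n)
    (hv : v.eval M ρ < q) : (ifBit c v x y).eval M ρ =
      if bitAt q (c.eval M ρ) (v.eval M ρ) then x.eval M ρ else y.eval M ρ := by
  simp only [ifBit, eval, eval_look hρ hM hc hv, hρ.r6]
  simp [bitAt]

theorem pow_le_bound {q d : ℕ} (hq : 0 < q) (n : ℕ) : q ^ d ≤ q ^ (2 * d) + n :=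
  (Nat.pow_le_pow_right hq (by omega)).trans (Nat.le_add_right _ _)

/-- The conditions `hc` and `hs` say that the values of `c` and `s` do not depend on the loop
register `28`. -/
theorem eval_codeOf {M : ℕ → ℕ → ℕ} {ρ : ℕ → ℕ} {n d q m N : ℕ} (hρ : IsEnv ρ n d q m N)
    (hM : HasTables M n d q) (hd : d ≤ q) {c s : Term} {cv sv : ℕ}
    (hc : ∀ j, c.eval M (Function.update ρ 28 j) = cv)
    (hs : ∀ j, s.eval M (Function.update ρ 28 j) = sv)
    (hcv : cv < q ^ (2 * d)) (hsv : sv < q ^ d) :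
    (codeOf c s).eval M ρ = code d (bitAt q cv) (tuple q sv) := by
  rw [codeOf, eval, hρ.r1, code]
  refine sum_congr rfl fun j hj => ?_
  have hj := mem_range.1 hj
  have hq : 0 < q := by omega
  have hρ' := hρ.update (x := 28) (by norm_num) j
  have hlook : (look s (var 28)).eval M (Function.update ρ 28 j) = tuple q sv j := by
    rw [eval_look hρ' hM (by rw [hs]; exact hsv.trans_le (pow_le_bound hq n))
      (by simp [eval]; omega), hs]
    simp [eval, tuple]
  rw [eval_ifBit hρ' hM (by rw [hc]; omega) (by rw [hlook]; exact polyVal_lt hq _ _), hlook, hc]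
  simp [eval, hM.pow j hj.le]

end Term

namespace Stmt

open Term

theorem run_powersOfTwo {ρ : ℕ → ℕ} {M : ℕ → ℕ → ℕ} :
    ∀ j ≤ ρ 3, (powersOfTwo.run ρ M) 4 j = 2 ^ j := by
  rw [powersOfTwo, run]
  refine run_rep (n := ρ 3) rfl (fun i M' => ∀ j ≤ i, M' 4 j = 2 ^ j) ?_ ?_
  · intro j hj
    obtain rfl : j = 0 := by omega
    simp [run, eval]
  · intro i hi M' hM' j hj
    by_cases hji : j = i + 1
    · subst hji
      simp [run, eval, hM' i le_rfl]; ring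
    · simp [run, eval, hji, hM' j (by omega)]

theorem run_powersOfQ {ρ : ℕ → ℕ} {M : ℕ → ℕ → ℕ} :
    ∀ j ≤ ρ 3, (powersOfQ.run ρ M) 5 j = ρ 6 ^ j := by
  rw [powersOfQ, run]
  refine run_rep (n := ρ 3) rfl (fun i M' => ∀ j ≤ i, M' 5 j = ρ 6 ^ j) ?_ ?_
  · intro j hj
    obtain rfl : j = 0 := by omega
    simp [run, eval]
  · intro i hi M' hM' j hj
    by_cases hji : j = i + 1
    · subst hji
      simp [run, eval, eval_times, hM' i le_rfl]; ring
    · simp [run, eval, hji, hM' j (by omega)]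

/-- The quotient is found by counting the positive multiples of `ρ 6` up to `yv`. The loop has `ρ 6`
rounds, so the quotient must not exceed `ρ 6`, which is what the bound on `yv` ensures. -/
theorem eval_modq {M : ℕ → ℕ → ℕ} {ρ : ℕ → ℕ} {y : Term} {yv : ℕ}
    (hy : y.eval M ρ = yv) (hy' : ∀ j, y.eval M (Function.update ρ 23 j) = yv)
    (h : yv < ρ 6 * (ρ 6 + 1)) : (modq y).eval M ρ = yv % ρ 6 := by
  have hq : 0 < ρ 6 := by by_contra h0; simp [Nat.eq_zero_of_not_pos h0] at h
  have hsum : (sum 23 6 (Term.ite y (times 6 (add (var 23) (const 1))) (const 0) (const 1))).eval M ρ =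
      yv / ρ 6 := by
    have hle : yv / ρ 6 ≤ ρ 6 := by
      rw [← Nat.lt_succ_iff]; exact Nat.div_lt_of_lt_mul h
    calc _ = ∑ i ∈ range (ρ 6), if i < yv / ρ 6 then 1 else 0 := by
          rw [eval]
          refine sum_congr rfl fun i _ => ?_
          simp only [eval, eval_times, hy']
          have : i < yv / ρ 6 ↔ ¬ yv < (i + 1) * ρ 6 := by
            rw [not_lt, ← Nat.le_div_iff_mul_le hq, Nat.succ_le_iff]
          simp only [this, Function.update_self, ne_eq, Nat.reduceEqDiff, not_false_eq_true,
            Function.update_of_ne]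
          split_ifs <;> rfl
      _ = yv / ρ 6 := by
          rw [← card_filter]
          have : (range (ρ 6)).filter (· < yv / ρ 6) = range (yv / ρ 6) := by
            ext x; simp; omega
          rw [this, card_range]
  rw [modq, eval, eval_times, hsum, hy, mul_comm]
  have := Nat.div_add_mod yv (ρ 6)
  omega

/-- Row `I * q + R` is computed from row `I`, which comes earlier unless `I = 0`. Row `0` belongs to
the zero polynomial and is correct from the start because the array is zero; hence the alternative
`i = 0` in the invariants. -/
theorem run_polyTable {ρ : ℕ → ℕ} {M : ℕ → ℕ → ℕ} (hq : 2 ≤ ρ 6) (h0 : ∀ v, M 6 v = 0) :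
    ∀ i < ρ 13, ∀ v < ρ 6, (polyTable.run ρ M) 6 (i * ρ 6 + v) = polyVal (ρ 6) i v := by
  set q := ρ 6 with hqd
  have main : ∀ i, (i < ρ 13 * q ∨ i = 0) → ∀ v < q,
      (polyTable.run ρ M) 6 (i * q + v) = polyVal q i v := by
    refine run_rep (n := ρ 13) rfl (fun I M' => ∀ i, (i < I * q ∨ i = 0) → ∀ v < q,
      M' 6 (i * q + v) = polyVal q i v) ?_ ?_
    · intro i hi v hv
      obtain rfl : i = 0 := by simpa using hi
      simp [h0, polyVal_zero]
    intro I hI M' hM'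
    have key := run_rep (x := 21) (p := 6)
      (q := rep 22 6 (store 6 (add (times 6 (add (times 6 (var 20)) (var 21))) (var 22))
        (modq (add (var 21) (mul 6 (look (var 20) (var 22)) (var 22))))))
      (ρ := Function.update ρ 20 I) (m := M') (n := q) (by simp [hqd])
      (fun R M' => ∀ i, (i < I * q + R ∨ i = 0) → ∀ v < q, M' 6 (i * q + v) = polyVal q i v)
      (by simpa using hM') ?_
    · intro i hi v hv
      exact key i (by rcases hi with hi | hi
                      · left; rw [add_mul] at hi; omega
                      · exact Or.inr hi) v hv
    intro R hR M' hM'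
    have key := run_rep (x := 22) (p := 6)
      (q := store 6 (add (times 6 (add (times 6 (var 20)) (var 21))) (var 22))
        (modq (add (var 21) (mul 6 (look (var 20) (var 22)) (var 22)))))
      (ρ := Function.update (Function.update ρ 20 I) 21 R) (m := M') (n := q) (by simp [hqd])
      (fun V M' => (∀ i, (i < I * q + R ∨ i = 0) → ∀ v < q, M' 6 (i * q + v) = polyVal q i v) ∧
        ∀ v < V, M' 6 ((I * q + R) * q + v) = polyVal q (I * q + R) v)
      ⟨hM', fun v hv => by omega⟩ ?_
    · intro i hi v hv
      rcases hi with hi | hi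
      · rcases Nat.lt_succ_iff_lt_or_eq.1 hi with hi | rfl
        · exact key.1 i (Or.inl hi) v hv
        · exact key.2 v hv
      · exact key.1 i (Or.inr hi) v hv
    rintro V hV M' ⟨hM1, hM2⟩
    have hval : (modq (add (var 21) (mul 6 (look (var 20) (var 22)) (var 22)))).eval M'
        (Function.update (Function.update (Function.update ρ 20 I) 21 R) 22 V) =
        polyVal q (I * q + R) V := by
      have hI : M' 6 (I * q + V) = polyVal q I V := by
        refine hM1 I ?_ V hV
        rcases Nat.eq_zero_or_pos I with h | h
        · exact Or.inr h
        · left; nlinarith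
      have hlt := polyVal_lt (q := q) (by omega) I V
      rw [polyVal_add hq hR]
      rw [eval_modq (yv := R + V * polyVal q I V)]
      · simp [hqd]
      · simp [eval, look, eval_times, ← hqd, hI, min_eq_left hV.le, mul_comm]
      · intro j
        simp [eval, look, eval_times, ← hqd, hI, min_eq_left hV.le, mul_comm]
      · simp only [ne_eq, Nat.reduceEqDiff, not_false_eq_true, Function.update_of_ne, ← hqd]
        nlinarith
    have haddr : (add (times 6 (add (times 6 (var 20)) (var 21))) (var 22)).eval M'
        (Function.update (Function.update (Function.update ρ 20 I) 21 R) 22 V) =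
        (I * q + R) * q + V := by simp [eval, eval_times, ← hqd]
    have hdec : ∀ {i v}, v < q → i * q + v = (I * q + R) * q + V → i = I * q + R ∧ v = V := by
      intro i v hv h
      have h1 := congrArg (· % q) h
      simp only [Nat.mul_add_mod_self_right, Nat.mod_eq_of_lt hv, Nat.mod_eq_of_lt hV] at h1
      subst h1
      exact ⟨Nat.eq_of_mul_eq_mul_right (by omega) (Nat.add_right_cancel h), rfl⟩
    have hw : ∀ i v, v < q → (M' 6 (i * q + v) = polyVal q i v ∨ (i = I * q + R ∧ v = V)) →
        (run (store 6 (add (times 6 (add (times 6 (var 20)) (var 21))) (var 22))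
        (modq (add (var 21) (mul 6 (look (var 20) (var 22)) (var 22)))))
        (Function.update (Function.update (Function.update ρ 20 I) 21 R) 22 V) M') 6 (i * q + v) =
        polyVal q i v := by
      intro i v hv h
      rw [run, haddr, hval, Function.update_self]
      by_cases he : i * q + v = (I * q + R) * q + V
      · obtain ⟨rfl, rfl⟩ := hdec hv he
        rw [Function.update_self]
      · rw [Function.update_of_ne he]
        rcases h with h | ⟨rfl, rfl⟩
        · exact h
        · exact absurd rfl he
    refine ⟨fun i hi v hv => hw i v hv (Or.inl (hM1 i hi v hv)), fun v hv => ?_⟩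
    refine hw _ v (by omega) ?_
    rcases Nat.lt_succ_iff_lt_or_eq.1 hv with hv | rfl
    · exact Or.inl (hM2 v hv)
    · exact Or.inr ⟨rfl, rfl⟩
  intro i hi v hv
  refine main i (Or.inl ?_) v hv
  nlinarith

end Stmt

end JuntaLearning

/-! ### Correctness of the greedy construction and of the queries -/

namespace JuntaLearning

open Finset

theorem mul_add_inj {q i v i' v' : ℕ} (hv : v < q) (hv' : v' < q)
    (h : i * q + v = i' * q + v') : i = i' ∧ v = v' := by
  have h1 := congrArg (· % q) h
  simp only [Nat.mul_add_mod_self_right, Nat.mod_eq_of_lt hv, Nat.mod_eq_of_lt hv'] at h1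
  subst h1
  exact ⟨Nat.eq_of_mul_eq_mul_right (by omega) (Nat.add_right_cancel h), rfl⟩

/-- The labels are stored in array `8`. -/
def HasLabels (M : ℕ → ℕ → ℕ) (q d : ℕ) (lab : ℕ → ℕ → ℕ → ℕ) : Prop :=
  ∀ s < q ^ d, ∀ t < q ^ d, ∀ u < 2 * 2 ^ d,
    M 8 ((s * q ^ d + t) * (2 * 2 ^ d) + u) = lab s t u

namespace Term

theorem eval_labOf {M : ℕ → ℕ → ℕ} {ρ : ℕ → ℕ} {n d q m N : ℕ} (hρ : IsEnv ρ n d q m N)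
    (s t u : Term) : (labOf s t u).eval M ρ =
      M 8 ((s.eval M ρ * q ^ d + t.eval M ρ) * (2 * 2 ^ d) + u.eval M ρ) := by
  simp only [labOf, labAddr, eval, eval_times, hρ.r11, hρ.r15]

theorem eval_labLeft {M : ℕ → ℕ → ℕ} {ρ : ℕ → ℕ} {n d q m N : ℕ} (hρ : IsEnv ρ n d q m N)
    (hM : HasTables M n d q) (hd : d ≤ q) {lab : ℕ → ℕ → ℕ → ℕ} {s t cv : ℕ}
    (hl : ∀ u < 2 * 2 ^ d, M 8 ((s * q ^ d + t) * (2 * 2 ^ d) + u) = lab s t u) {c : Term}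
    (hs : ρ 22 = s) (ht : ρ 23 = t) (hsq : s < q ^ d)
    (hc : ∀ j, c.eval M (Function.update ρ 28 j) = cv) (hcv : cv < q ^ (2 * d)) :
    (labLeft (var 22) (var 23) c).eval M ρ = lab s t (code d (bitAt q cv) (tuple q s)) := by
  rw [labLeft, eval_labOf hρ,
    eval_codeOf hρ hM hd hc (sv := s) (fun j => by simp [eval, hs]) hcv hsq]
  simp only [eval, hs, ht]
  exact hl _ (code_lt_two_mul _ _ _)

theorem eval_labRight {M : ℕ → ℕ → ℕ} {ρ : ℕ → ℕ} {n d q m N : ℕ} (hρ : IsEnv ρ n d q m N)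
    (hM : HasTables M n d q) (hd : d ≤ q) {lab : ℕ → ℕ → ℕ → ℕ} {s t cv : ℕ}
    (hl : ∀ u < 2 * 2 ^ d, M 8 ((s * q ^ d + t) * (2 * 2 ^ d) + u) = lab s t u) {c : Term}
    (hs : ρ 22 = s) (ht : ρ 23 = t) (htq : t < q ^ d)
    (hc : ∀ j, c.eval M (Function.update ρ 28 j) = cv) (hcv : cv < q ^ (2 * d)) :
    (labRight (var 22) (var 23) c).eval M ρ = lab s t (rcode d (bitAt q cv) (tuple q t)) := by
  rw [labRight, eval_labOf hρ]
  simp only [eval, hs, ht, hρ.r10]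
  rw [eval_codeOf hρ hM hd hc (sv := t) (fun j => by simp [eval, ht]) hcv htq]
  exact hl _ (rcode_lt _ _ _)

theorem eval_scoreOf {M : ℕ → ℕ → ℕ} {ρ : ℕ → ℕ} {n d q m N : ℕ} (hρ : IsEnv ρ n d q m N)
    (hM : HasTables M n d q) (hd : d ≤ q) {lab : ℕ → ℕ → ℕ → ℕ} (hl : HasLabels M q d lab)
    (hc : ρ 21 < q ^ (2 * d)) : (scoreOf (var 21)).eval M ρ = score q d lab (ρ 21) := by
  rw [scoreOf, eval, hρ.r11, score]
  refine sum_congr rfl fun s hs => ?_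
  have h1 := hρ.update (x := 22) (by norm_num) s
  rw [eval, h1.r11]
  refine sum_congr rfl fun t ht => ?_
  have h2 := h1.update (x := 23) (by norm_num) t
  rw [eval_ifEq, eval_labLeft h2 hM hd (hl s (mem_range.1 hs) t (mem_range.1 ht)) (cv := ρ 21)
      (by simp) (by simp) (mem_range.1 hs) (fun j => by simp [eval]) hc,
    eval_labRight h2 hM hd (hl s (mem_range.1 hs) t (mem_range.1 ht)) (cv := ρ 21)
      (by simp) (by simp) (mem_range.1 ht) (fun j => by simp [eval]) hc]
  simp only [eval]
  split_ifs <;> simp_all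

end Term

namespace Stmt

open Term

/-- Under the condition `J`, which is preserved, the statement writes the values `T` into array
`k`, at least at the addresses in `S`. -/
def Fills (p : Stmt) (ρ : ℕ → ℕ) (J : (ℕ → ℕ → ℕ) → Prop) (k : ℕ) (T : ℕ → ℕ) (S : Set ℕ) : Prop :=
  ∀ M, J M → J (p.run ρ M) ∧ ∀ a, (a ∈ S ∨ M k a = T a) → p.run ρ M k a = T a

/-- The value to be written is a function of the address alone. The order of the writes and repeated
writes are therefore immaterial, and only the union of the addresses has to be tracked. -/
theorem Fills.rep {x p n : ℕ} {q : Stmt} {ρ : ℕ → ℕ} {J : (ℕ → ℕ → ℕ) → Prop} {k : ℕ} {T : ℕ → ℕ}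
    {S : ℕ → Set ℕ} (hn : ρ p = n)
    (h : ∀ i < n, Fills q (Function.update ρ x i) J k T (S i)) :
    Fills (.rep x p q) ρ J k T {a | ∃ i < n, a ∈ S i} := by
  intro M hM
  have := run_rep (x := x) (q := q) (m := M) hn
    (fun j M' => J M' ∧ ∀ a, ((∃ i < j, a ∈ S i) ∨ M k a = T a) → M' k a = T a)
    ⟨hM, fun a ha => ha.resolve_left (by simp)⟩ (by
      rintro i hi M' ⟨hJ, hM'⟩
      obtain ⟨h1, h2⟩ := h i hi M' hJ
      refine ⟨h1, fun a ha => h2 a ?_⟩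
      rcases ha with ⟨i', hi', ha⟩ | ha
      · rcases Nat.lt_succ_iff_lt_or_eq.1 hi' with hi' | rfl
        · exact Or.inr (hM' a (Or.inl ⟨i', hi', ha⟩))
        · exact Or.inl ha
      · exact Or.inr (hM' a (Or.inr ha)))
  exact this

/-- All arrays but `k` are as in `M`. -/
def SameBut (k : ℕ) (M M' : ℕ → ℕ → ℕ) : Prop := ∀ k', k' ≠ k → M' k' = M k'

theorem Fills.store {k : ℕ} {a e : Term} {ρ : ℕ → ℕ} {M₀ : ℕ → ℕ → ℕ} {T : ℕ → ℕ} {av : ℕ}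
    (h : ∀ M, SameBut k M₀ M → a.eval M ρ = av ∧ e.eval M ρ = T av) :
    Fills (.store k a e) ρ (SameBut k M₀) k T {av} := by
  intro M hM
  obtain ⟨h1, h2⟩ := h M hM
  rw [run, h1, h2]
  refine ⟨fun k' hk => by rw [Function.update_of_ne hk, hM k' hk], fun b hb => ?_⟩
  rw [Function.update_self]
  by_cases hba : b = av
  · rw [hba, Function.update_self]
  · rw [Function.update_of_ne hba]
    exact hb.resolve_left hba

theorem run_initLabels {ρ : ℕ → ℕ} {n d q m N : ℕ} (hρ : IsEnv ρ n d q m N) (M : ℕ → ℕ → ℕ) :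
    HasLabels (initLabels.run ρ M) q d fun _ _ u => u := by
  have hf : Fills initLabels ρ (SameBut 8 M) 8 (fun a => a % (2 * 2 ^ d)) _ :=
    Fills.rep hρ.r11 fun s _ => Fills.rep (hρ.update (by norm_num) s).r11 fun t _ =>
      Fills.rep ((hρ.update (by norm_num) s).update (by norm_num) t).r15 fun u hu =>
        Fills.store (av := (s * q ^ d + t) * (2 * 2 ^ d) + u) fun M' _ => by
          have h := (((hρ.update (x := 20) (by norm_num) s).update (x := 21) (by norm_num) t).update
            (x := 22) (by norm_num) u)
          refine ⟨?_, ?_⟩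
          · simp only [labAddr, eval, eval_times, h.r11, h.r15]
            simp
          · rw [Nat.mul_add_mod_self_right, Nat.mod_eq_of_lt hu]
            simp [eval]
  intro s hs t ht u hu
  rw [(hf M fun _ _ => rfl).2 _ (Or.inl ⟨s, hs, t, ht, u, hu, rfl⟩)]
  exact (Nat.mul_add_mod_self_right _ _ _).trans (Nat.mod_eq_of_lt hu)

theorem run_choose {ρ : ℕ → ℕ} {M : ℕ → ℕ → ℕ} {n d q m N : ℕ} (hρ : IsEnv ρ n d q m N)
    (hM : HasTables M n d q) (hq : 0 < q) (hd : d ≤ q) {lab : ℕ → ℕ → ℕ → ℕ}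
    (hl : HasLabels M q d lab) :
    (∀ i, i ≠ ρ 20 → choose.run ρ M 7 i = M 7 i) ∧ choose.run ρ M 7 (ρ 20) < q ^ (2 * d) ∧
      ∀ c < q ^ (2 * d), score q d lab c ≤ score q d lab (choose.run ρ M 7 (ρ 20)) := by
  set r := ρ 20 with hr
  have hpos : 0 < q ^ (2 * d) := pow_pos hq _
  rw [choose, run, run]
  -- Cell `0` of array `9` is an upper bound for the scores of all candidates tried so far and a
  -- lower bound for the score of the chosen one.
  have main := run_rep (x := 21) (p := 12) (q := .ite (load 9 (const 0)) (scoreOf (var 21))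
      (seq (store 7 (var 20) (var 21)) (store 9 (const 0) (scoreOf (var 21))))
      (store 9 (const 0) (load 9 (const 0))))
    (m := (store 7 (var 20) (const 0)).run ρ ((store 9 (const 0) (const 0)).run ρ M)) hρ.r12
    (fun j M' => (∀ k, k ≠ 7 → k ≠ 9 → M' k = M k) ∧ (∀ i, i ≠ r → M' 7 i = M 7 i) ∧
      M' 7 r < q ^ (2 * d) ∧ M' 9 0 ≤ score q d lab (M' 7 r) ∧
      ∀ c < j, score q d lab c ≤ M' 9 0) ?_ ?_
  · obtain ⟨_, h2, h3, h4, h5⟩ := main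
    exact ⟨h2, h3, fun c hc => (h5 c hc).trans h4⟩
  · refine ⟨fun k h7 h9 => ?_, fun i hi => ?_, ?_, ?_, ?_⟩
    · simp [run, h7, h9]
    · simp [run, eval, ← hr, hi]
    · simp [run, eval, ← hr, hpos]
    · simp [run, eval]
    · simp
  · rintro c hc M' ⟨h1, h2, h3, h4, h5⟩
    have hρ' := hρ.update (x := 21) (by norm_num) c
    have hT : HasTables M' n d q := hM.congr (h1 4 (by norm_num) (by norm_num))
      (h1 6 (by norm_num) (by norm_num))
    have hL : HasLabels M' q d lab := by
      intro s hs t ht u hu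
      rw [h1 8 (by norm_num) (by norm_num)]; exact hl s hs t ht u hu
    have hsc := eval_scoreOf hρ' hT hd hL (by simpa using hc)
    have hT2 : HasTables ((store 7 (var 20) (var 21)).run (Function.update ρ 21 c) M') n d q :=
      hT.congr (by simp [run]) (by simp [run])
    have hL2 : HasLabels ((store 7 (var 20) (var 21)).run (Function.update ρ 21 c) M') q d lab := by
      intro s hs t ht u hu
      rw [← hL s hs t ht u hu]; simp [run]
    have hsc2 := eval_scoreOf hρ' hT2 hd hL2 (by simpa using hc)
    simp only [Function.update_self] at hsc hsc2
    by_cases hlt : M' 9 0 < score q d lab c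
    · have hlt' : (load 9 (const 0)).eval M' (Function.update ρ 21 c) <
          (scoreOf (var 21)).eval M' (Function.update ρ 21 c) := by
        rw [hsc]; simpa [eval] using hlt
      rw [run, if_pos hlt', run]
      set M2 := (store 7 (var 20) (var 21)).run (Function.update ρ 21 c) M' with hM2
      have hM27 : ∀ i, M2 7 i = if i = r then c else M' 7 i := by
        intro i
        simp [hM2, run, eval, Function.update_apply, ← hr]
      rw [run, hsc2]
      refine ⟨fun k h7 h9 => ?_, fun i hi => ?_, ?_, ?_, ?_⟩
      · simp [hM2, run, h7, h9, h1 k h7 h9]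
      · simp [hM27, hi, h2 i hi]
      · simp [hM27, hc]
      · simp [hM27, eval]
      · intro c' hc'
        simp only [eval, Function.update_self]
        rcases Nat.lt_succ_iff_lt_or_eq.1 hc' with h | rfl
        · exact (h5 c' h).trans hlt.le
        · exact le_rfl
    · have hlt' : ¬ (load 9 (const 0)).eval M' (Function.update ρ 21 c) <
          (scoreOf (var 21)).eval M' (Function.update ρ 21 c) := by
        rw [hsc]; simpa [eval] using hlt
      rw [run, if_neg hlt', run]
      have : Function.update M' 9 (Function.update (M' 9) ((const 0).eval M' (Function.update ρ 21 c))
          ((load 9 (const 0)).eval M' (Function.update ρ 21 c))) = M' := by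
        simp [eval]
      rw [this]
      refine ⟨h1, h2, h3, h4, fun c' hc' => ?_⟩
      rcases Nat.lt_succ_iff_lt_or_eq.1 hc' with h | rfl
      · exact h5 c' h
      · exact not_lt.1 hlt

theorem run_mergeLabels {ρ : ℕ → ℕ} {M : ℕ → ℕ → ℕ} {n d q m N : ℕ} (hρ : IsEnv ρ n d q m N)
    (hM : HasTables M n d q) (hd : d ≤ q) {lab : ℕ → ℕ → ℕ → ℕ}
    (hl : HasLabels M q d lab) (hc : M 7 (ρ 20) < q ^ (2 * d)) :
    HasLabels (mergeLabels.run ρ M) q d (mergeAll q d (M 7 (ρ 20)) lab) := by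
  set c := M 7 (ρ 20) with hcd
  set Q := q ^ d with hQ
  set D := 2 * 2 ^ d with hD
  let J : (ℕ → ℕ → ℕ) → Prop := fun M' => ∀ k, k ≠ 8 → k ≠ 9 → M' k = M k
  -- The pairs of tuples are numbered by `s * Q + t`: those before `w` are finished, and in pair `w`
  -- the first `v` vertices are relabelled.
  let I : ℕ → ℕ → (ℕ → ℕ → ℕ) → Prop := fun w v M' => J M' ∧ ∀ s < Q, ∀ t < Q, ∀ u < D,
    M' 8 ((s * Q + t) * D + u) =
      if s * Q + t < w ∨ (s * Q + t = w ∧ u < v) then mergeAll q d c lab s t u else lab s t u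
  have shift : ∀ w M', I w D M' → I (w + 1) 0 M' := by
    rintro w M' ⟨h1, h2⟩
    refine ⟨h1, fun s hs t ht u hu => ?_⟩
    rw [h2 s hs t ht u hu]
    congr 1
    simp only [eq_iff_iff]; omega
  have hT : ∀ M', J M' → HasTables M' n d q := fun M' h =>
    hM.congr (h 4 (by norm_num) (by norm_num)) (h 6 (by norm_num) (by norm_num))
  have main : I (Q * Q) 0 (mergeLabels.run ρ M) := by
    refine run_rep hρ.r11 (fun s M' => I (s * Q) 0 M') ?_ ?_
    · exact ⟨fun _ _ _ => rfl, fun s hs t ht u hu => by simpa using hl s hs t ht u hu⟩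
    intro s hs M' hM'
    have hρ1 := hρ.update (x := 22) (by norm_num) s
    rw [add_mul, one_mul]
    refine run_rep hρ1.r11 (fun t M' => I (s * Q + t) 0 M') hM' ?_
    intro t ht M1 hM1
    have hρ2 := hρ1.update (x := 23) (by norm_num) t
    refine shift _ _ ?_
    set ρ2 := Function.update (Function.update ρ 22 s) 23 t with hρ2d
    have h20 : ρ2 20 = ρ 20 := by simp [hρ2d]
    have hlab1 : ∀ u < D, M1 8 ((s * Q + t) * D + u) = lab s t u := fun u hu => by
      rw [hM1.2 s hs t ht u hu]; simp
    set x := lab s t (code d (bitAt q c) (tuple q s)) with hx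
    set y := lab s t (rcode d (bitAt q c) (tuple q t)) with hy
    have hcev : ∀ M', J M' → ∀ j, (load 7 (var 20)).eval M' (Function.update ρ2 28 j) = c := by
      intro M' h j
      simp [eval, h20, h 7 (by norm_num) (by norm_num), hcd]
    have e1 : (labLeft (var 22) (var 23) (load 7 (var 20))).eval M1 ρ2 = x :=
      eval_labLeft hρ2 (hT M1 hM1.1) hd hlab1 (by simp [hρ2d]) (by simp [hρ2d]) hs
        (hcev M1 hM1.1) hc
    rw [run, run]
    set M2 := (store 9 (const 1) (labLeft (var 22) (var 23) (load 7 (var 20)))).run ρ2 M1 with hM2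
    have hM2' : M2 = Function.update M1 9 (Function.update (M1 9) 1 x) := by
      rw [hM2, run, e1]; simp [eval]
    have hJ2 : J M2 := fun k h8 h9 => by
      rw [hM2', Function.update_of_ne h9]; exact hM1.1 k h8 h9
    have hlab2 : ∀ u < D, M2 8 ((s * Q + t) * D + u) = lab s t u := fun u hu => by
      rw [hM2', Function.update_of_ne (by norm_num)]; exact hlab1 u hu
    have e2 : (labRight (var 22) (var 23) (load 7 (var 20))).eval M2 ρ2 = y :=
      eval_labRight hρ2 (hT M2 hJ2) hd hlab2 (by simp [hρ2d]) (by simp [hρ2d]) ht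
        (hcev M2 hJ2) hc
    set M3 := (store 9 (const 2) (labRight (var 22) (var 23) (load 7 (var 20)))).run ρ2 M2 with hM3
    have hM3' : M3 = Function.update M2 9 (Function.update (M2 9) 2 y) := by
      rw [hM3, run, e2]; simp [eval]
    have hI3 : I (s * Q + t) 0 M3 := by
      refine ⟨fun k h8 h9 => ?_, ?_⟩
      · rw [hM3', Function.update_of_ne h9]; exact hJ2 k h8 h9
      · rw [hM3', Function.update_of_ne (by norm_num), hM2', Function.update_of_ne (by norm_num)]
        exact hM1.2
    have h31 : M3 9 1 = x := by rw [hM3', hM2']; simp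
    have h32 : M3 9 2 = y := by rw [hM3']; simp
    refine (run_rep hρ2.r15 (fun v M' => I (s * Q + t) v M' ∧ M' 9 1 = x ∧ M' 9 2 = y)
      ⟨hI3, h31, h32⟩ ?_).1
    rintro v hv M4 ⟨hI4, h41, h42⟩
    have hρ3 := hρ2.update (x := 24) (by norm_num) v
    have haddr : (labAddr (var 22) (var 23) (var 24)).eval M4 (Function.update ρ2 24 v) =
        (s * Q + t) * D + v := by
      simp only [labAddr, eval, eval_times, hρ3.r11, hρ3.r15]
      simp [hρ2d, hQ, hD]
    have hlo : (labOf (var 22) (var 23) (var 24)).eval M4 (Function.update ρ2 24 v) =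
        lab s t v := by
      rw [labOf, eval, haddr, hI4.2 s hs t ht v hv]
      simp
    have hval : (ifEq (labOf (var 22) (var 23) (var 24)) (load 9 (const 2)) (load 9 (const 1))
        (labOf (var 22) (var 23) (var 24))).eval M4 (Function.update ρ2 24 v) =
        mergeAll q d c lab s t v := by
      rw [eval_ifEq, hlo]
      simp only [eval, h41, h42]
      rfl
    rw [run, haddr, hval]
    refine ⟨⟨fun k h8 h9 => ?_, ?_⟩, by simp [h41], by simp [h42]⟩
    · rw [Function.update_of_ne h8]; exact hI4.1 k h8 h9
    · intro s' hs' t' ht' u hu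
      rw [Function.update_self]
      by_cases he : (s' * Q + t') * D + u = (s * Q + t) * D + v
      · obtain ⟨h1, rfl⟩ := mul_add_inj hu hv he
        obtain ⟨rfl, rfl⟩ := mul_add_inj ht' ht h1
        rw [Function.update_self, if_pos (Or.inr ⟨rfl, Nat.lt_succ_self _⟩)]
      · rw [Function.update_of_ne he, hI4.2 s' hs' t' ht' u hu]
        congr 1
        simp only [eq_iff_iff]
        constructor
        · rintro (h | h)
          · exact Or.inl h
          · exact Or.inr ⟨h.1, by omega⟩
        · rintro (h | ⟨h, h'⟩)
          · exact Or.inl h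
          · refine Or.inr ⟨h, ?_⟩
            rcases Nat.lt_succ_iff_lt_or_eq.1 h' with h' | rfl
            · exact h'
            · exact absurd (by rw [h]) he
  intro s hs t ht u hu
  rw [main.2 s hs t ht u hu, if_pos]
  left
  nlinarith

/-- The greedy construction chooses the best candidate in each round. -/
theorem run_greedy {ρ : ℕ → ℕ} {M : ℕ → ℕ → ℕ} {n d q m N : ℕ} (hρ : IsEnv ρ n d q m N)
    (hM : HasTables M n d q) (hq : 0 < q) (hd : d ≤ q)
    (hl : HasLabels M q d fun _ _ u => u) :
    (∀ r < N, greedy.run ρ M 7 r < q ^ (2 * d)) ∧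
      ∀ r < N, ∀ c < q ^ (2 * d), score q d (labSeq q d (greedy.run ρ M 7) r) c ≤
        score q d (labSeq q d (greedy.run ρ M 7) r) (greedy.run ρ M 7 r) := by
  have main := run_rep (x := 20) (q := seq choose mergeLabels) (m := M) hρ.r14
    (fun r M' => (∀ k, k ≠ 7 → k ≠ 8 → k ≠ 9 → M' k = M k) ∧
      HasLabels M' q d (labSeq q d (M' 7) r) ∧ (∀ i < r, M' 7 i < q ^ (2 * d)) ∧
      ∀ i < r, ∀ c < q ^ (2 * d), score q d (labSeq q d (M' 7) i) c ≤
        score q d (labSeq q d (M' 7) i) (M' 7 i)) ?_ ?_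
  · exact ⟨main.2.2.1, main.2.2.2⟩
  · exact ⟨fun _ _ _ _ => rfl, hl, fun i hi => by omega, fun i hi => by omega⟩
  rintro r hr M' ⟨h1, h2, h3, h4⟩
  have hρ' := hρ.update (x := 20) (by norm_num) r
  have hT : HasTables M' n d q := hM.congr (h1 4 (by norm_num) (by norm_num) (by norm_num))
    (h1 6 (by norm_num) (by norm_num) (by norm_num))
  obtain ⟨c1, c2, c3⟩ := run_choose hρ' hT hq hd h2
  rw [run]
  set M1 := choose.run (Function.update ρ 20 r) M' with hM1
  have hfr : ∀ k, k ≠ 7 → k ≠ 9 → M1 k = M' k := fun k h7 h9 =>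
    run_frame _ _ _ (by simp [choose, Writes, h7, h9])
  simp only [Function.update_self] at c1 c2 c3
  -- The labels after `i` rounds depend on the first `i` choices only, so recording choice `r`
  -- leaves them alone.
  have hseq : ∀ i ≤ r, labSeq q d (M1 7) i = labSeq q d (M' 7) i := fun i hi =>
    labSeq_congr fun j hj => c1 j (by omega)
  have hT1 : HasTables M1 n d q :=
    hT.congr (hfr 4 (by norm_num) (by norm_num)) (hfr 6 (by norm_num) (by norm_num))
  have hL1 : HasLabels M1 q d (labSeq q d (M1 7) r) := by
    intro s hs t ht u hu
    rw [hseq r le_rfl, hfr 8 (by norm_num) (by norm_num)]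
    exact h2 s hs t ht u hu
  have hm := run_mergeLabels hρ' hT1 hd hL1 (by simpa using c2)
  have hfr2 : ∀ k, k ≠ 8 → k ≠ 9 → mergeLabels.run (Function.update ρ 20 r) M1 k = M1 k :=
    fun k h8 h9 => run_frame _ _ _ (by simp [mergeLabels, Writes, h8, h9])
  have h7 := hfr2 7 (by norm_num) (by norm_num)
  rw [h7]
  refine ⟨fun k k7 k8 k9 => ?_, ?_, ?_, ?_⟩
  · rw [hfr2 k k8 k9, hfr k k7 k9, h1 k k7 k8 k9]
  · simpa [labSeq] using hm
  · intro i hi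
    rcases Nat.lt_succ_iff_lt_or_eq.1 hi with hi | rfl
    · rw [c1 i (by omega)]; exact h3 i hi
    · exact c2
  · intro i hi c hc
    rw [hseq i (by omega)]
    rcases Nat.lt_succ_iff_lt_or_eq.1 hi with hi | rfl
    · rw [c1 i (by omega)]; exact h4 i hi c hc
    · exact c3 c hc

theorem run_writeQueries {ρ : ℕ → ℕ} {M : ℕ → ℕ → ℕ} {n d q m N : ℕ} (hρ : IsEnv ρ n d q m N)
    (hM : HasTables M n d q) (hmq : m ≤ q) (hA : ∀ r < N, M 7 r < q ^ (2 * d)) :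
    ∀ α < m, ∀ r < N, ∀ i < n, writeQueries.run ρ M 0 ((α * N + r) * n + i) =
      if bitAt q (M 7 r) (polyVal q i α) then 1 else 0 := by
  set T : ℕ → ℕ := fun a => if bitAt q (M 7 (a / n % N)) (polyVal q (a % n) (a / n / N)) then 1 else 0
    with hT
  have hTa : ∀ α < m, ∀ r < N, ∀ i < n, T ((α * N + r) * n + i) =
      if bitAt q (M 7 r) (polyVal q i α) then 1 else 0 := by
    intro α hα r hr i hi
    have h1 : ((α * N + r) * n + i) / n = α * N + r := by
      rw [Nat.add_div_of_dvd_right (Dvd.intro_left _ rfl), Nat.mul_div_cancel _ (by omega),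
        Nat.div_eq_of_lt hi, add_zero]
    have h2 : (α * N + r) / N = α := by
      rw [Nat.add_div_of_dvd_right (Dvd.intro_left _ rfl), Nat.mul_div_cancel _ (by omega),
        Nat.div_eq_of_lt hr, add_zero]
    simp only [hT, h1, h2, Nat.mul_add_mod_self_right, Nat.mod_eq_of_lt hi, Nat.mod_eq_of_lt hr]
  have hf : Fills writeQueries ρ (SameBut 0 M) 0 T _ :=
    Fills.rep hρ.r9 fun α hα => Fills.rep (hρ.update (by norm_num) α).r14 fun r hr =>
      Fills.rep ((hρ.update (by norm_num) α).update (by norm_num) r).r2 fun i hi =>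
        Fills.store (av := (α * N + r) * n + i) fun M' hM' => by
          have h := (((hρ.update (x := 20) (by norm_num) α).update (x := 21) (by norm_num) r).update
            (x := 22) (by norm_num) i)
          have hM1 : HasTables M' n d q := hM.congr (hM' 4 (by norm_num)) (hM' 6 (by norm_num))
          refine ⟨?_, ?_⟩
          · simp only [eval, eval_times, h.r2, h.r14]
            simp
          · rw [hTa α hα r hr i hi]
            have hq : 0 < q := by omega
            have e1 : (look (var 22) (var 20)).eval M' (Function.update (Function.update
                (Function.update ρ 20 α) 21 r) 22 i) = polyVal q i α := by
              rw [eval_look h hM1]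
              · simp [eval]
              · simp only [eval, Function.update_self]; omega
              · simp only [eval]; simp; omega
            rw [eval_ifBit h hM1, e1]
            · simp [eval, hM' 7]
            · simp only [eval]
              simp only [hM' 7 (by norm_num)]
              simp
              have := hA r hr
              omega
            · rw [e1]; exact polyVal_lt hq _ _
  intro α hα r hr i hi
  rw [(hf M fun _ _ => rfl).2 _ (Or.inl ⟨α, hα, r, hr, i, hi, rfl⟩), hTa α hα r hr i hi]

end Stmt

end JuntaLearning

/-! ### Correctness of the reconstruction phases -/

namespace JuntaLearning

open Finset

namespace Term

/-- A positive sum acts as an existential quantifier. Together with `eval_not` and `eval_and_not` it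
turns the logical descriptions of sensitive classes and relevant variables into terms; universal
statements enter through their negations. -/
theorem eval_sum_pos {M : ℕ → ℕ → ℕ} {ρ : ℕ → ℕ} {x p n : ℕ} {e : Term} (hn : ρ p = n) :
    0 < (sum x p e).eval M ρ ↔ ∃ i < n, 0 < e.eval M (Function.update ρ x i) := by
  subst hn
  rw [eval, Nat.pos_iff_ne_zero, ne_eq, sum_eq_zero_iff]
  simp [Nat.pos_iff_ne_zero]

theorem eval_not {M : ℕ → ℕ → ℕ} {ρ : ℕ → ℕ} {a : Term} :
    0 < (ifPos a (const 0) (const 1)).eval M ρ ↔ ¬ 0 < a.eval M ρ := by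
  rw [eval_ifPos]; split_ifs with h <;> simp [eval, h]

theorem eval_and_not {M : ℕ → ℕ → ℕ} {ρ : ℕ → ℕ} {a b : Term} :
    0 < (ifPos a (const 0) b).eval M ρ ↔ ¬ 0 < a.eval M ρ ∧ 0 < b.eval M ρ := by
  rw [eval_ifPos]; split_ifs with h <;> simp [eval, h]

theorem eval_not_eq {M : ℕ → ℕ → ℕ} {ρ : ℕ → ℕ} {a : Term} {P : Prop} [Decidable P]
    (h : 0 < a.eval M ρ ↔ ¬ P) :
    (ifPos a (const 0) (const 1)).eval M ρ = if P then 1 else 0 := by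
  rw [eval_ifPos]
  by_cases hP : P
  · rw [if_neg (fun h' => h.1 h' hP), if_pos hP]; rfl
  · rw [if_pos (h.2 hP), if_neg hP]; rfl

end Term

/-- The memory after the answers for `f` have been handed over. -/
structure HasAnswers {n : ℕ} (M : ℕ → ℕ → ℕ) (d q m N : ℕ) (f : (Fin n → Bool) → Bool) :
    Prop where
  tables : HasTables M n d q
  lt : ∀ r < N, M 7 r < q ^ (2 * d)
  determining : Determining q d N (M 7)
  answers : ∀ α < m, ∀ r < N, M 1 (α * N + r) = (hashed q f α (bitAt q (M 7 r))).toNat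

namespace Term

theorem eval_conflicts {n : ℕ} {M : ℕ → ℕ → ℕ} {ρ : ℕ → ℕ} {d q m N : ℕ}
    {f : (Fin n → Bool) → Bool} (hρ : IsEnv ρ n d q m N) (hM : HasAnswers M d q m N f) (hd : d ≤ q)
    (h20 : ρ 20 < m) (h22 : ρ 22 < q ^ d) :
    0 < conflicts.eval M ρ ↔ ¬ Consistent q d N (M 7) (hashed q f (ρ 20)) (ρ 22) := by
  rw [conflicts, eval_sum_pos hρ.r14, Consistent]
  push Not
  refine exists_congr fun r => and_congr_right fun hr => ?_
  have h1 := hρ.update (x := 24) (by norm_num) r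
  rw [eval_sum_pos h1.r14]
  refine exists_congr fun r' => and_congr_right fun hr' => ?_
  have h2 := h1.update (x := 25) (by norm_num) r'
  set ρ' := Function.update (Function.update ρ 24 r) 25 r' with hρ'
  rw [eval_ifEq, eval_ifEq,
    eval_codeOf h2 hM.tables hd (cv := M 7 r) (sv := ρ 22) (fun j => by simp [eval, hρ'])
      (fun j => by simp [eval, hρ']) (hM.lt r hr) h22,
    eval_codeOf h2 hM.tables hd (cv := M 7 r') (sv := ρ 22) (fun j => by simp [eval, hρ'])
      (fun j => by simp [eval, hρ']) (hM.lt r' hr') h22]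
  have e1 : (load 1 (add (times 14 (var 20)) (var 24))).eval M ρ' =
      (hashed q f (ρ 20) (bitAt q (M 7 r))).toNat := by
    simp only [eval, eval_times, h2.r14]
    simpa [hρ'] using hM.answers _ h20 r hr
  have e2 : (load 1 (add (times 14 (var 20)) (var 25))).eval M ρ' =
      (hashed q f (ρ 20) (bitAt q (M 7 r'))).toNat := by
    simp only [eval, eval_times, h2.r14]
    simpa [hρ'] using hM.answers _ h20 r' hr'
  rw [e1, e2]
  simp only [eval]
  by_cases hc : code d (bitAt q (M 7 r)) (tuple q (ρ 22)) =
    code d (bitAt q (M 7 r')) (tuple q (ρ 22))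
  · cases h3 : hashed q f (ρ 20) (bitAt q (M 7 r)) <;>
      cases h4 : hashed q f (ρ 20) (bitAt q (M 7 r')) <;> simp [hc]
  · simp [hc]

open Classical in
theorem eval_sensitiveClass {n : ℕ} {M : ℕ → ℕ → ℕ} {ρ : ℕ → ℕ} {d q m N : ℕ}
    {f : (Fin n → Bool) → Bool} (hρ : IsEnv ρ n d q m N) (hM : HasAnswers M d q m N f)
    (hq : q.Prime) (hd : d ≤ q) (hf : f ∈ Junta n d)
    (h20 : ρ 20 < m) (h21 : ρ 21 < q) :
    sensitiveClass.eval M ρ = if ρ 21 ∈ classes q f (ρ 20) then 1 else 0 := by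
  refine eval_not_eq ?_
  rw [mem_classes_iff hq hd hf hM.determining, eval_sum_pos hρ.r11]
  push Not
  simp only [h21, true_implies]
  refine exists_congr fun t => and_congr_right fun ht => ?_
  have h1 := hρ.update (x := 22) (by norm_num) t
  rw [eval_and_not, eval_not, eval_conflicts h1 hM hd (by simpa using h20) (by simpa using ht),
    not_not, eval_sum_pos h1.r1]
  simp only [Function.update_self, ne_eq, Nat.reduceEqDiff, not_false_eq_true,
    Function.update_of_ne]
  refine and_congr_right fun _ => ?_
  push Not
  refine forall_congr' fun j => forall_congr' fun hj => ?_
  have h2 := h1.update (x := 26) (by norm_num) j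
  rw [eval_ifEq, eval_look h2 hM.tables]
  · simp only [eval]
    simp only [Function.update_self, ne_eq, Nat.reduceEqDiff, not_false_eq_true,
      Function.update_of_ne, tuple]
    split_ifs with h <;> simp [h]
  · simpa [eval] using ht.trans_le (pow_le_bound hq.pos n)
  · simp [eval]; omega

end Term

/-- The number `i` is the index of a relevant variable. -/
def RelevantIndex {n : ℕ} (f : (Fin n → Bool) → Bool) (i : ℕ) : Prop :=
  ∃ h : i < n, (⟨i, h⟩ : Fin n) ∈ relevantSet f

open Classical in
theorem sum_relevantIndex {n : ℕ} (f : (Fin n → Bool) → Bool) :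
    ∑ i ∈ range n, (if RelevantIndex f i then 1 else 0) = (relevantSet f).card := by
  rw [sum_range, ← card_filter]
  congr 1
  ext i
  simp [RelevantIndex]

namespace Stmt

open Term

open Classical in
theorem run_findClasses {n : ℕ} {M : ℕ → ℕ → ℕ} {ρ : ℕ → ℕ} {d q m N : ℕ}
    {f : (Fin n → Bool) → Bool} (hρ : IsEnv ρ n d q m N) (hM : HasAnswers M d q m N f)
    (hq : q.Prime) (hd : d ≤ q) (hf : f ∈ Junta n d) :
    ∀ α < m, ∀ v < q, findClasses.run ρ M 10 (α * q + v) =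
      if v ∈ classes q f α then 1 else 0 := by
  set T : ℕ → ℕ := fun a => if a % q ∈ classes q f (a / q) then 1 else 0 with hT
  have hTa : ∀ α v, v < q → T (α * q + v) = if v ∈ classes q f α then 1 else 0 := by
    intro α v hv
    have h1 : (α * q + v) / q = α := by
      rw [Nat.add_div_of_dvd_right (Dvd.intro_left _ rfl), Nat.mul_div_cancel _ (by omega),
        Nat.div_eq_of_lt hv, add_zero]
    simp only [hT, h1, Nat.mul_add_mod_self_right, Nat.mod_eq_of_lt hv]
  have hfill : Fills findClasses ρ (SameBut 10 M) 10 T _ :=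
    Fills.rep hρ.r9 fun α hα => Fills.rep (hρ.update (by norm_num) α).r6 fun v hv =>
      Fills.store (av := α * q + v) fun M' hM' => by
        have h := ((hρ.update (x := 20) (by norm_num) α).update (x := 21) (by norm_num) v)
        have h7 := hM' 7 (by norm_num)
        have hM1 : HasAnswers M' d q m N f :=
          ⟨hM.tables.congr (hM' 4 (by norm_num)) (hM' 6 (by norm_num)), by rw [h7]; exact hM.lt,
            by rw [h7]; exact hM.determining,
            by rw [h7, hM' 1 (by norm_num)]; exact hM.answers⟩
        refine ⟨?_, ?_⟩
        · simp only [eval, eval_times, h.r6]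
          simp
        · rw [hTa α v hv, eval_sensitiveClass h hM1 hq hd hf (by simpa using hα) (by simpa using hv)]
          simp
  intro α hα v hv
  rw [(hfill M fun _ _ => rfl).2 _ (Or.inl ⟨α, hα, v, hv, rfl⟩), hTa α v hv]

open Classical in
theorem run_findRelevant {n : ℕ} {M : ℕ → ℕ → ℕ} {ρ : ℕ → ℕ} {d q m N k : ℕ}
    {f : (Fin n → Bool) → Bool} (hρ : IsEnv ρ n d q m N) (hM : HasTables M n d q)
    (hq : q.Prime) (hf : f ∈ Junta n d) (hn : n ≤ q ^ k) (hk : 1 ≤ k)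
    (hm : 2 * d ^ 2 * k ≤ m) (hmq : m ≤ q) (hd : 1 ≤ d)
    (hcl : ∀ α < m, ∀ v < q, M 10 (α * q + v) = if v ∈ classes q f α then 1 else 0) :
    ∀ i < n, findRelevant.run ρ M 11 i = if RelevantIndex f i then 1 else 0 := by
  have hfill : Fills findRelevant ρ (SameBut 11 M) 11
      (fun i => if RelevantIndex f i then 1 else 0) _ :=
    Fills.rep hρ.r2 fun i hi => Fills.store (av := i) fun M' hM' => by
      have h := hρ.update (x := 20) (by norm_num) i
      have hM1 : HasTables M' n d q := hM.congr (hM' 4 (by norm_num)) (hM' 6 (by norm_num))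
      have h10 := hM' 10 (by norm_num)
      refine ⟨by simp [eval], eval_not_eq ?_⟩
      have hrel : RelevantIndex f i ↔ (⟨i, hi⟩ : Fin n) ∈ relevantSet f :=
        ⟨fun h => h.2, fun h => ⟨hi, h⟩⟩
      have hcnt : ∀ (ρ' : ℕ → ℕ) (a : Term), IsEnv ρ' n d q m N →
          (∀ j, a.eval M' (Function.update ρ' 23 j) = a.eval M' ρ') → a.eval M' ρ' < m →
          (countClasses a).eval M' ρ' = (classes q f (a.eval M' ρ')).card := by
        intro ρ' a hρ' ha ham
        rw [countClasses, eval, hρ'.r6]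
        have : ∀ v ∈ range q, (load 10 (add (times 6 a) (var 23))).eval M'
            (Function.update ρ' 23 v) = if v ∈ classes q f (a.eval M' ρ') then 1 else 0 := by
          intro v hv
          simp only [eval, eval_times, (hρ'.update (x := 23) (by norm_num) v).r6, ha,
            Function.update_self, h10]
          exact hcl _ ham v (mem_range.1 hv)
        rw [sum_congr rfl this, ← card_filter]
        congr 1
        ext v
        simp only [mem_filter, mem_range, and_iff_right_iff_imp]
        exact fun hv => mem_range.1 (mem_of_mem_filter v hv)
      rw [hrel, mem_relevantSet_iff hq hn hk hm hmq hd hf, eval_sum_pos h.r9]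
      push Not
      refine exists_congr fun α => and_congr_right fun hα => ?_
      have h1 := h.update (x := 21) (by norm_num) α
      rw [eval_and_not, eval_not, eval_sum_pos h1.r9]
      refine and_congr ?_ ?_
      · push Not
        refine forall_congr' fun β => forall_congr' fun hβ => ?_
        have h2 := h1.update (x := 22) (by norm_num) β
        simp only [eval]
        rw [hcnt _ _ h2 (by simp [eval]) (by simpa [eval] using hα),
          hcnt _ _ h2 (by simp [eval]) (by simpa [eval] using hβ)]
        simp only [eval]
        simp only [Function.update_self, ne_eq, Nat.reduceEqDiff, not_false_eq_true,
          Function.update_of_ne]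
        split_ifs with hlt <;> simp <;> omega
      · have hlook : (look (var 20) (var 21)).eval M' (Function.update (Function.update ρ 20 i) 21 α)
            = polyVal q i α := by
          rw [eval_look h1 hM1]
          · simp [eval]
          · simp [eval]; omega
          · simp [eval]; omega
        simp only [eval, eval_times, hlook, h1.r6, Function.update_self, h10]
        rw [hcl α hα _ (polyVal_lt hq.pos _ _)]
        split_ifs with hin <;> simp [hin]
  intro i hi
  exact (hfill M fun _ _ => rfl).2 _ (Or.inl ⟨i, hi, rfl⟩)

theorem run_listRelevant {M : ℕ → ℕ → ℕ} {ρ : ℕ → ℕ} {n : ℕ} {P : ℕ → Prop}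
    [DecidablePred P] (hn : ρ 2 = n)
    (hM : ∀ i < n, M 11 i = if P i then 1 else 0) :
    (∀ l < ∑ i ∈ range n, (if P i then 1 else 0), P (listRelevant.run ρ M 2 l) ∧
      listRelevant.run ρ M 2 l < n) ∧
    ∀ i < n, P i → ∃ l < ∑ i ∈ range n, (if P i then 1 else 0), listRelevant.run ρ M 2 l = i := by
  have main := run_rep (x := 20) (q := .ite (const 0) (load 11 (var 20))
    (store 2 (sum 21 20 (load 11 (var 21))) (var 20)) (store 9 (const 0) (const 0))) (m := M) hn
    (fun j M' => M' 11 = M 11 ∧ (∀ l < ∑ i ∈ range j, (if P i then 1 else 0),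
        P (M' 2 l) ∧ M' 2 l < n) ∧
      ∀ i < j, P i → ∃ l < ∑ i ∈ range j, (if P i then 1 else 0), M' 2 l = i) ?_ ?_
  · exact main.2
  · exact ⟨rfl, by simp, by simp⟩
  rintro i hi M' ⟨h1, h2, h3⟩
  have hv : (load 11 (var 20)).eval M' (Function.update ρ 20 i) = if P i then 1 else 0 := by
    simp [eval, h1, hM i hi]
  have hs : (sum 21 20 (load 11 (var 21))).eval M' (Function.update ρ 20 i) =
      ∑ i ∈ range i, (if P i then 1 else 0) := by
    simp only [eval, Function.update_self, h1]
    exact sum_congr rfl fun j hj => hM j (by have := mem_range.1 hj; omega)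
  rw [run, hv, sum_range_succ]
  by_cases hP : P i
  · rw [if_pos (by simp [eval, hP]), if_pos hP, run, hs]
    refine ⟨by simp [h1], fun l hl => ?_, fun i' hi' hPi' => ?_⟩
    · rcases Nat.lt_succ_iff_lt_or_eq.1 hl with hl | rfl
      · rw [Function.update_self, Function.update_of_ne hl.ne]; exact h2 l hl
      · simp [eval, hP, hi]
    · rcases Nat.lt_succ_iff_lt_or_eq.1 hi' with hi' | rfl
      · obtain ⟨l, hl, he⟩ := h3 i' hi' hPi'
        exact ⟨l, by omega, by rw [Function.update_self, Function.update_of_ne hl.ne]; exact he⟩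
      · exact ⟨_, Nat.lt_succ_self _, by simp [eval]⟩
  · rw [if_neg (by simp [eval, hP]), if_neg hP, run, add_zero]
    refine ⟨by simp [h1], by simpa using h2, fun i' hi' hPi' => ?_⟩
    rcases Nat.lt_succ_iff_lt_or_eq.1 hi' with hi' | rfl
    · simpa using h3 i' hi' hPi'
    · exact absurd hPi' hP

/-- Several queries may select the same row. By `hcons` they carry the same answer, so the row
determines the entry and later writes do no harm. Nothing is claimed about rows that no query
selects. -/
theorem run_writeTable {M : ℕ → ℕ → ℕ} {ρ : ℕ → ℕ} {n d q m N w : ℕ} (hρ : IsEnv ρ n d q m N)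
    (hw : ρ 17 = w) (hwd : w ≤ d) (hM : HasTables M n d q) (row : ℕ → ℕ)
    (hrow : ∀ j < m * N, row j = ∑ l ∈ range w, if 0 < M 0 (j * n + M 2 l) then 2 ^ l else 0)
    (hcons : ∀ j < m * N, ∀ j' < m * N, row j = row j' → M 1 j = M 1 j') :
    ∀ j < m * N, writeTable.run ρ M 3 (row j) = M 1 j := by
  classical
  set T : ℕ → ℕ := fun a => if h : ∃ j < m * N, row j = a then M 1 h.choose else 0 with hT
  have hTa : ∀ j < m * N, T (row j) = M 1 j := by
    intro j hj
    have h : ∃ j' < m * N, row j' = row j := ⟨j, hj, rfl⟩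
    rw [hT]
    simp only [h, dite_true]
    exact hcons _ h.choose_spec.1 j hj h.choose_spec.2
  have hfill : Fills writeTable ρ (SameBut 3 M) 3 T _ :=
    Fills.rep hρ.r16 fun j hj => Fills.store (av := row j) fun M' hM' => by
      have h := hρ.update (x := 20) (by norm_num) j
      refine ⟨?_, ?_⟩
      · rw [eval]
        simp only [ne_eq, Nat.reduceEqDiff, not_false_eq_true, Function.update_of_ne, hw]
        rw [hrow j hj]
        refine sum_congr rfl fun l hl => ?_
        have hl := mem_range.1 hl
        have h2 := (h.update (x := 21) (by norm_num) l).r2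
        simp only [eval, eval_times, h2, hM' 0 (by norm_num), hM' 2 (by norm_num),
          hM' 4 (by norm_num)]
        simp only [Function.update_self, ne_eq, Nat.reduceEqDiff, not_false_eq_true,
          Function.update_of_ne, hM.pow l (by omega)]
      · rw [hTa j hj]
        simp [eval, hM' 1]
  intro j hj
  rw [(hfill M fun _ _ => rfl).2 _ (Or.inl ⟨j, hj, rfl⟩), hTa j hj]

end Stmt

end JuntaLearning

/-! ### The output hypothesis and the composition of programs -/

namespace JuntaLearning

open Finset

theorem hypRow_eq {n : ℕ} (s : State) (x : Fin n → Bool) {w : ℕ} (hw : s.reg 0 = w)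
    (hidx : ∀ l < w, s.mem 2 l < n) (a : ℕ → Bool) (hx : ∀ i : Fin n, x i = a i) :
    hypRow n s x = code w a (s.mem 2) := by
  rw [hypRow, hypArity, hw, code]
  refine sum_congr rfl fun l hl => ?_
  rw [dif_pos (hidx l (mem_range.1 hl)), hx]
  cases a (s.mem 2 l) <;> simp

/-- The bits of an assignment, extended by zeros. -/
def extend {n : ℕ} (x : Fin n → Bool) (i : ℕ) : Bool := if h : i < n then x ⟨i, h⟩ else false

/-- The memory and the arity that the reconstruction leaves form a hypothesis for `f`. -/
theorem outputs_of_reconstruct {n : ℕ} {M : ℕ → ℕ → ℕ} {ρ : ℕ → ℕ} {d q m N k : ℕ}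
    {f : (Fin n → Bool) → Bool} (hρ : IsEnv ρ n d q m N) (hM : HasAnswers M d q m N f)
    (hq : q.Prime) (hf : f ∈ Junta n d) (hn : n ≤ q ^ k) (hk : 1 ≤ k)
    (hm : 2 * d ^ 2 * k ≤ m) (hmq : m ≤ q) (hd : 1 ≤ d) (hdq : d ≤ q)
    (hqueries : ∀ α < m, ∀ r < N, ∀ i < n, M 0 ((α * N + r) * n + i) =
      if bitAt q (M 7 r) (polyVal q i α) then 1 else 0)
    {M₂ : ℕ → ℕ → ℕ} (hM₂ : M₂ = Stmt.findRelevant.run ρ (Stmt.findClasses.run ρ M))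
    {w : ℕ} (hw : w = ∑ i ∈ range n, M₂ 11 i)
    {ρ' : ℕ → ℕ} (hρ' : ρ' = Function.update ρ 17 w) {s : State}
    (hs : s.mem = Stmt.writeTable.run ρ' (Stmt.listRelevant.run ρ' M₂)) (hs0 : s.reg 0 = w) :
    Outputs d s f := by
  classical
  set M₁ := Stmt.findClasses.run ρ M with hM₁
  have hf1 : ∀ k, k ≠ 10 → M₁ k = M k := fun k hk =>
    Stmt.run_frame _ _ _ (by simp [Stmt.findClasses, Stmt.Writes, hk])
  have hf2 : ∀ k, k ≠ 10 → k ≠ 11 → M₂ k = M k := fun k hk hk' => by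
    rw [hM₂, Stmt.run_frame _ _ _ (by simp [Stmt.findRelevant, Stmt.Writes, hk']), hf1 k hk]
  have hrel : ∀ i < n, M₂ 11 i = if RelevantIndex f i then 1 else 0 := by
    rw [hM₂]
    exact Stmt.run_findRelevant hρ (hM.tables.congr (hf1 4 (by norm_num)) (hf1 6 (by norm_num)))
      hq hf hn hk hm hmq hd (Stmt.run_findClasses hρ hM hq hdq hf)
  have hw' : w = (relevantSet f).card := by
    rw [hw, ← sum_relevantIndex f]
    exact sum_congr rfl fun i hi => hrel i (mem_range.1 hi)
  have hwd : w ≤ d := hw' ▸ card_relevantSet_le hf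
  have hρ2 : IsEnv ρ' n d q m N := hρ' ▸ hρ.update (by norm_num) w
  set M₃ := Stmt.listRelevant.run ρ' M₂ with hM₃
  have hf3 : ∀ k, k ≠ 10 → k ≠ 11 → k ≠ 2 → k ≠ 9 → M₃ k = M k := fun k h10 h11 h2 h9 => by
    rw [hM₃, Stmt.run_frame _ _ _ (by simp [Stmt.listRelevant, Stmt.Writes, h2, h9]), hf2 k h10 h11]
  obtain ⟨hl1, hl2⟩ := Stmt.run_listRelevant hρ2.r2 hrel
  rw [sum_relevantIndex, ← hw', ← hM₃] at hl1 hl2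
  have h32 : s.mem 2 = M₃ 2 := by
    rw [hs]; exact Stmt.run_frame _ _ _ (by simp [Stmt.writeTable, Stmt.Writes])
  have h30 := hf3 0 (by norm_num) (by norm_num) (by norm_num) (by norm_num)
  have h31 := hf3 1 (by norm_num) (by norm_num) (by norm_num) (by norm_num)
  have hagree : ∀ a b : ℕ → Bool, code w a (M₃ 2) = code w b (M₃ 2) →
      f (fun i => a i) = f (fun i => b i) := by
    intro a b hab
    refine eq_of_relevantSet fun i hi => ?_
    obtain ⟨l, hl, hli⟩ := hl2 i i.2 ⟨i.2, hi⟩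
    have := code_eq_iff.1 hab l hl
    rwa [hli] at this
  let asg : ℕ → ℕ → Bool := fun j i => decide (0 < M 0 (j * n + i))
  have hdec : ∀ j < m * N, ∃ α < m, ∃ r < N, j = α * N + r := by
    intro j hj
    have hN : 0 < N := Nat.pos_of_ne_zero fun h => by simp [h] at hj
    refine ⟨j / N, Nat.div_lt_of_lt_mul (by rwa [mul_comm]), j % N, Nat.mod_lt _ hN, ?_⟩
    rw [mul_comm]; exact (Nat.div_add_mod _ _).symm
  have hasg : ∀ α < m, ∀ r < N, ∀ i < n,
      asg (α * N + r) i = bitAt q (M 7 r) (polyVal q i α) := by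
    intro α hα r hr i hi
    simp only [asg, hqueries α hα r hr i hi]
    cases bitAt q (M 7 r) (polyVal q i α) <;> simp
  have hans : ∀ j < m * N, M₃ 1 j = (f fun i => asg j i).toNat := by
    intro j hj
    obtain ⟨α, hα, r, hr, rfl⟩ := hdec j hj
    rw [h31, hM.answers α hα r hr, hashed]
    congr 2
    funext i
    exact (hasg α hα r hr i i.2).symm
  have htab := Stmt.run_writeTable (w := w) (M := M₃) hρ2 (by simp [hρ']) hwd
    (hM.tables.congr (hf3 4 (by norm_num) (by norm_num) (by norm_num) (by norm_num))
      (hf3 6 (by norm_num) (by norm_num) (by norm_num) (by norm_num)))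
    (fun j => code w (asg j) (M₃ 2))
    (fun j _ => by
      rw [code, h30]
      exact sum_congr rfl fun l _ => by simp [asg])
    (fun j hj j' hj' hjj => by
      rw [hans j hj, hans j' hj', hagree _ _ hjj])
  rw [← hs] at htab
  refine ⟨by rw [hypArity, hs0]; exact hwd, fun l hl => ?_, ?_⟩
  · rw [hypArity, hs0] at hl
    rw [h32]; exact (hl1 l hl).2
  · funext x
    -- Some query agrees with `x` on all relevant variables. It selects the same row as `x` and has
    -- the same value of `f`.
    obtain ⟨α, hα, r, hr, hx⟩ := exists_query hq hn hk hm hmq hd hdq hf hM.determining x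
    have hj : α * N + r < m * N := by nlinarith
    have hrow : hypRow n s x = code w (asg (α * N + r)) (M₃ 2) := by
      rw [hypRow_eq s x hs0 (fun l hl => by rw [h32]; exact (hl1 l hl).2) (extend x)
        (fun i => by simp [extend]), h32, code_eq_iff]
      intro l hl
      obtain ⟨⟨hln, hlr⟩, -⟩ := hl1 l hl
      rw [hasg α hα r hr _ hln, extend, dif_pos hln]
      exact (hx _ hlr).symm
    rw [hypothesis, hrow, htab _ hj, hans _ hj]
    have : f (fun i => asg (α * N + r) i) = f x :=
      eq_of_relevantSet fun i hi => by rw [hasg α hα r hr i i.2, hx i hi]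
    rw [this]
    cases f x <;> simp

/-! Composition of programs. -/

/-- From registers `ρ` and memory `M`, the program leads to `ρ'` and `M'`. -/
def Leads (B : ℕ) (p : Prog) (w : ℕ) (ρ : ℕ → ℕ) (M : ℕ → ℕ → ℕ) (ρ' : ℕ → ℕ)
    (M' : ℕ → ℕ → ℕ) : Prop :=
  ∀ s : State, (∀ x < 32, s.reg x = ρ x) → s.mem = M →
    ∃ t s', Exec p s t s' ∧ t ≤ (B + 10) ^ w ∧ (∀ x < 32, s'.reg x = ρ' x) ∧ s'.mem = M'

theorem Leads.seq {B : ℕ} {p p' : Prog} {w w' : ℕ} {ρ ρ' ρ'' : ℕ → ℕ} {M M' M'' : ℕ → ℕ → ℕ}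
    (h : Leads B p w ρ M ρ' M') (h' : Leads B p' w' ρ' M' ρ'' M'') :
    Leads B (.seq p p') (w + w' + 1) ρ M ρ'' M'' := by
  intro s hs hm
  obtain ⟨t, s', h1, h2, h3, h4⟩ := h s hs hm
  obtain ⟨t', s'', h1', h2', h3', h4'⟩ := h' s' h3 h4
  refine ⟨_, s'', Exec.seq h1 h1', ?_, h3', h4'⟩
  have := pow_sum_bound (a := w) (b := w') (β := B + 10) (by omega)
  omega

/-- Assignment of a term to a register. -/
def assignTerm (x : ℕ) (e : Term) : Prog := .seq (e.compile 32) (.assign x (.reg 32))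

theorem Leads.assign {B x : ℕ} {e : Term} {ρ : ℕ → ℕ} {M : ℕ → ℕ → ℕ} (he : e.Below 32)
    (hB : ∀ y < 32, ρ y ≤ B) :
    Leads B (assignTerm x e) (e.weight + 1) ρ M (Function.update ρ x (e.eval M ρ)) M := by
  rintro s hs rfl
  obtain ⟨t, s', h1, h2, h3, h4, h5⟩ := e.exec_compile 32 s le_rfl he
    (fun y hy => by rw [hs y hy]; exact hB y hy)
  refine ⟨_, _, Exec.seq h1 (Exec.assign _ _ _), ?_, fun y hy => ?_, h3⟩
  · have := pow_step (a := e.weight) (b := e.weight + 1) (β := B + 10) (by omega) (by omega)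
    simp only [Expr.cost]; omega
  · simp only [State.setReg, Expr.eval, h4, Term.eval_congr _ he hs]
    by_cases hyx : y = x
    · simp [hyx]
    · simp [hyx, h5 y hy, hs y hy]

theorem Leads.stmt {B : ℕ} {p : Stmt} {ρ : ℕ → ℕ} {M : ℕ → ℕ → ℕ} (hp : p.Below 32)
    (hB : ∀ y < 32, ρ y ≤ B) :
    Leads B (p.compile 32) p.weight ρ M ρ (p.run ρ M) := by
  rintro s hs rfl
  obtain ⟨t, s', h1, h2, h3, h4⟩ := p.exec_compile 32 s le_rfl hp
    (fun y hy => by rw [hs y hy]; exact hB y hy)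
  refine ⟨t, s', h1, h2, fun y hy => by rw [h4 y hy, hs y hy], ?_⟩
  rw [h3, Stmt.run_congr p _ hp hs]

/-- The registers hold the entries of a list. -/
def regs (l : List ℕ) (x : ℕ) : ℕ := l.getD x 0

theorem regs_le {l : List ℕ} {B : ℕ} (h : ∀ y ∈ l, y ≤ B) (x : ℕ) : regs l x ≤ B := by
  rw [regs]
  by_cases hx : x < l.length
  · rw [List.getD_eq_getElem _ _ hx]; exact h _ (List.getElem_mem hx)
  · rw [List.getD_eq_default _ _ (by omega)]; omega

theorem regs_append (l : List ℕ) (v : ℕ) :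
    regs (l ++ [v]) = Function.update (regs l) l.length v := by
  funext x
  simp only [regs, Function.update_apply]
  split_ifs with h
  · subst h; simp
  · rcases Nat.lt_or_gt_of_ne h with h | h
    · rw [List.getD_append _ _ _ _ h]
    · rw [List.getD_eq_default _ _ (by simp; omega), List.getD_eq_default _ _ (by omega)]

theorem Leads.push {B : ℕ} (l : List ℕ) (v : ℕ) {e : Term} {M : ℕ → ℕ → ℕ} (he : e.Below 32)
    (hB : ∀ y ∈ l, y ≤ B) (hv : e.eval M (regs l) = v) :
    Leads B (assignTerm l.length e) (e.weight + 1) (regs l) M (regs (l ++ [v])) M := by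
  rw [regs_append, ← hv]
  exact Leads.assign he fun y _ => regs_le hB y

theorem Leads.replace {B : ℕ} (v₀ : ℕ) (l : List ℕ) (v : ℕ) {e : Term} {M : ℕ → ℕ → ℕ}
    (he : e.Below 32) (hB : ∀ y ∈ v₀ :: l, y ≤ B) (hv : e.eval M (regs (v₀ :: l)) = v) :
    Leads B (assignTerm 0 e) (e.weight + 1) (regs (v₀ :: l)) M (regs (v :: l)) M := by
  have : regs (v :: l) = Function.update (regs (v₀ :: l)) 0 v := by
    funext x; cases x <;> simp [regs]
  rw [this, ← hv]
  exact Leads.assign he fun y _ => regs_le hB y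

end JuntaLearning

/-! ### Parameters: logarithms, the prime and the number of rounds -/

namespace JuntaLearning

open Finset

/-! Parameters of the algorithm. -/

theorem clog_le_self {b n : ℕ} (hb : 2 ≤ b) : Nat.clog b n ≤ n :=
  Nat.clog_le_of_le_pow (Nat.lt_pow_self hb).le

theorem sum_eq_clog {b n : ℕ} (hb : 2 ≤ b) :
    ∑ i ∈ range n, (if b ^ i < n then 1 else 0) = Nat.clog b n := by
  rw [← card_filter, ← card_range (Nat.clog b n)]
  congr 1
  ext i
  have h1 : b ^ i < n ↔ i < Nat.clog b n := (Nat.lt_clog_iff_pow_lt hb).symm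
  have h2 := clog_le_self (n := n) hb
  simp only [mem_filter, mem_range, h1]
  omega

namespace Term

/-- Both factors are shifted by `2` to exclude trivial ones. The clipping is harmless: a clipped
factor is still at least `2`, and genuine factors of `v ≤ ρ 3` are not clipped. -/
theorem eval_composite {M : ℕ → ℕ → ℕ} {ρ : ℕ → ℕ} {y : Term} {v : ℕ}
    (hy : ∀ i j, y.eval M (Function.update (Function.update ρ 22 i) 23 j) = v)
    (hv : 2 ≤ v) (hvρ : v ≤ ρ 3) : 0 < (composite y).eval M ρ ↔ ¬ v.Prime := by
  rw [composite, eval_sum_pos rfl]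
  have key : ∀ i, 0 < (sum 23 3 (ifEq (mul 3 (add (var 22) (const 2)) (add (var 23) (const 2))) y
      (const 1) (const 0))).eval M (Function.update ρ 22 i) ↔
      ∃ j < ρ 3, (i + 2) * min (j + 2) (ρ 3) = v := by
    intro i
    rw [eval_sum_pos (n := ρ 3) (by simp)]
    refine exists_congr fun j => and_congr_right fun _ => ?_
    rw [eval_ifEq, hy]
    simp only [eval, Function.update_self, ne_eq, Nat.reduceEqDiff, not_false_eq_true,
      Function.update_of_ne]
    split_ifs with h <;> simp [h]
  simp only [key]
  constructor
  · rintro ⟨i, -, j, -, h⟩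
    rw [← h]
    refine Nat.not_prime_mul (by omega) ?_
    omega
  · intro h
    obtain ⟨a, b, ha, hb, hab⟩ := (Nat.not_prime_iff_exists_mul_eq hv).1 h
    have ha' : 2 ≤ a := by
      rcases Nat.lt_or_ge a 2 with h | h
      · interval_cases a <;> omega
      · exact h
    have hb' : 2 ≤ b := by
      rcases Nat.lt_or_ge b 2 with h | h
      · interval_cases b <;> omega
      · exact h
    refine ⟨a - 2, by omega, b - 2, by omega, ?_⟩
    rw [Nat.sub_add_cancel ha', Nat.sub_add_cancel hb', min_eq_left (by omega), hab]

/-- The least prime above register `5`. -/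
def nextPrime : Term :=
  add (add (var 5) (const 1)) (sum 20 5 (ifPos (sum 21 5 (ite (var 20) (var 21) (const 0)
    (ifPos (composite (add (add (var 5) (const 1)) (var 21))) (const 0) (const 1))))
    (const 0) (const 1)))

/-- By Bertrand's postulate it suffices to search `X + 1`, …, `2 * X`. The outer sum counts the `j`
for which none of `X + 1`, …, `X + 1 + j` is prime, and this number is the offset of the first
prime. -/
theorem exists_eval_nextPrime {X : ℕ} (hX : 1 ≤ X) : ∃ q, q.Prime ∧ X < q ∧ q ≤ 2 * X ∧
    ∀ M ρ, ρ 5 = X → 2 * X ≤ ρ 3 → nextPrime.eval M ρ = q := by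
  classical
  obtain ⟨p, hp, hXp, hp2⟩ := Nat.exists_prime_lt_and_le_two_mul X (by omega)
  have hex : ∃ j, (X + 1 + j).Prime := ⟨p - (X + 1), by rwa [Nat.add_sub_cancel' hXp]⟩
  set j₀ := Nat.find hex with hj₀
  have hj₀X : j₀ < X := by
    have : j₀ ≤ p - (X + 1) := Nat.find_min' hex (by rwa [Nat.add_sub_cancel' hXp])
    omega
  refine ⟨X + 1 + j₀, Nat.find_spec hex, by omega, by omega, fun M ρ h5 h3 => ?_⟩
  simp only [nextPrime, eval, h5]
  congr 1
  have : ∀ j ∈ range X, (ifPos (sum 21 5 (ite (var 20) (var 21) (const 0)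
      (ifPos (composite (add (add (var 5) (const 1)) (var 21))) (const 0) (const 1))))
      (const 0) (const 1)).eval M (Function.update ρ 20 j) = if j < j₀ then 1 else 0 := by
    intro j hj
    have hj := mem_range.1 hj
    refine eval_not_eq ?_
    rw [eval_sum_pos (n := X) (by simp [h5])]
    rw [hj₀, Nat.lt_find_iff]
    push Not
    refine exists_congr fun i => ?_
    rw [eval]
    simp only [eval, Function.update_self, ne_eq, Nat.reduceEqDiff, not_false_eq_true,
      Function.update_of_ne]
    split_ifs with hij
    · simp; omega
    · by_cases hiX : i < X
      · rw [eval_not, eval_composite (v := X + 1 + i) (fun _ _ => by simp [eval, h5]) (by omega)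
          (by simp; omega), not_not]
        simp; omega
      · simp only [hiX, false_and, false_iff, not_and]
        intro hle; omega
  rw [sum_congr rfl this, ← card_filter]
  refine Eq.trans (congrArg card ?_) (card_range j₀)
  ext i
  simp only [mem_filter, mem_range]; omega

end Term

/-- The parameters: `L = log n`, the field size `q`, the number `k` of base-`q` digits of `n`, and
`lam = log q`. -/
structure Params (n d L q k lam : ℕ) : Prop where
  n_ge : 2 ≤ n
  d_pos : 1 ≤ d
  d_le : d ≤ n
  log_eq : L = Nat.clog 2 n
  prime : q.Prime
  lt : 4 * d ^ 2 * L < q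
  le : q ≤ 8 * d ^ 2 * L
  digits_eq : k = Nat.clog q n
  lam_eq : lam = Nat.clog 2 q

/-- The number of assignments per hash function. -/
def rounds (d lam : ℕ) : ℕ := 32 * 2 ^ d * lam * d

namespace Params

variable {n d L q k lam : ℕ} (h : Params n d L q k lam)
include h

theorem log_pos : 1 ≤ L := h.log_eq ▸ Nat.clog_pos (by norm_num) h.n_ge

theorem log_le : L ≤ n := h.log_eq ▸ clog_le_self le_rfl

theorem four_mul_lt : 4 * d < q := by
  have := h.log_pos
  have := h.d_pos
  have := h.lt
  have : 4 * d * 1 * 1 ≤ 4 * d * d * L := by gcongr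
  nlinarith

theorem odd : Odd q := by
  have := h.four_mul_lt
  have := h.d_pos
  exact h.prime.odd_of_ne_two (by omega)

theorem digits_pos : 1 ≤ k := h.digits_eq ▸ Nat.clog_pos h.prime.one_lt h.n_ge

theorem digits_le_log : k ≤ L := by
  rw [h.digits_eq, h.log_eq]
  exact Nat.clog_anti_left (by norm_num) h.prime.two_le

theorem le_pow : n ≤ q ^ k := h.digits_eq ▸ Nat.le_pow_clog h.prime.one_lt n

theorem hashes_le : 2 * d ^ 2 * k ≤ q := by
  have : 2 * d ^ 2 * k ≤ 4 * d ^ 2 * L := by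
    gcongr
    · norm_num
    · exact h.digits_le_log
  exact this.trans h.lt.le

theorem le_two_pow : q ≤ 2 ^ lam := h.lam_eq ▸ Nat.le_pow_clog (by norm_num) q

theorem lam_ge : 2 ≤ lam := by
  by_contra hlt
  have h1 : 2 ^ lam ≤ 2 ^ 1 := Nat.pow_le_pow_right (by norm_num) (by omega)
  have := h.le_two_pow
  have := h.four_mul_lt
  have := h.d_pos
  omega

theorem lam_le : lam ≤ q := h.lam_eq ▸ clog_le_self le_rfl

/-- The left side bounds the initial potential: `q ^ d * q ^ d` pairs of tuples with at most `2 * 2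
^ d` bad labels each. The exponent on the right is the `l` of `decay`. -/
theorem pairs_lt : q ^ d * (q ^ d * (2 * 2 ^ d)) < 2 ^ (2 * d * lam + d + 2) := by
  have h1 : q ^ d ≤ 2 ^ (lam * d) := by
    rw [pow_mul]; exact Nat.pow_le_pow_left h.le_two_pow d
  calc _ ≤ 2 ^ (lam * d) * (2 ^ (lam * d) * (2 * 2 ^ d)) := by gcongr
    _ = 2 ^ (2 * d * lam + d + 1) := by ring
    _ < _ := Nat.pow_lt_pow_right (by norm_num) (by omega)

theorem rounds_ge : 8 * 2 ^ d * (2 * d * lam + d + 2) ≤ rounds d lam := by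
  have h1 := h.lam_ge
  have h2 := h.d_pos
  have h3 : 2 * d * lam + d + 2 ≤ 4 * d * lam := by nlinarith
  calc _ ≤ 8 * 2 ^ d * (4 * d * lam) := by gcongr
    _ = _ := by rw [rounds]; ring

theorem le_cube : 8 * d ^ 2 * L ≤ 8 * n ^ 3 := by
  calc 8 * d ^ 2 * L ≤ 8 * n ^ 2 * n := by
        gcongr
        · exact h.d_le
        · exact h.log_le
    _ = _ := by ring

/-- The number of digits times the logarithm of the base is of the order of `log n`. -/
theorem digits_mul_lam_le : (k * lam : ℝ) ≤ 21 * Real.log n := by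
  have h1 : q ^ (k - 1) < n := by
    rw [← Nat.lt_clog_iff_pow_lt h.prime.one_lt, ← h.digits_eq]
    have := h.digits_pos; omega
  have h2 : 2 ^ (lam - 1) < q := by
    rw [← Nat.lt_clog_iff_pow_lt (by norm_num), ← h.lam_eq]
    have := h.lam_ge; omega
  have h3 : q ≤ n ^ 6 := by
    calc q ≤ 2 ^ 3 * n ^ 3 := h.le.trans h.le_cube
      _ ≤ n ^ 3 * n ^ 3 := by gcongr; exact h.n_ge
      _ = _ := by ring
  -- Indeed `2 ^ (lam - 1) < q` and `q ^ (k - 1) < n`, so the left side is at most `q ^ k ≤ n * q ≤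
  -- n ^ 7`. The rounding in `lam` costs a factor of `2`, and `14 / log 2 < 21`.
  have h4 : 2 ^ ((lam - 1) * k) ≤ n ^ 7 := by
    obtain ⟨k', rfl⟩ : ∃ k', k = k' + 1 := ⟨k - 1, by have := h.digits_pos; omega⟩
    rw [pow_mul]
    calc (2 ^ (lam - 1)) ^ (k' + 1) ≤ q ^ (k' + 1) := Nat.pow_le_pow_left h2.le _
      _ = q ^ k' * q := pow_succ _ _
      _ ≤ n * n ^ 6 := Nat.mul_le_mul h1.le h3
      _ = _ := by ring
  have h5 : ((lam - 1) * k : ℕ) * Real.log 2 ≤ 7 * Real.log n := by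
    have : ((2 ^ ((lam - 1) * k) : ℕ) : ℝ) ≤ ((n ^ 7 : ℕ) : ℝ) := by exact_mod_cast h4
    have := Real.log_le_log (by positivity) this
    push_cast at this
    rw [Real.log_pow, Real.log_pow] at this
    exact_mod_cast this
  have h6 : ((k * lam : ℕ) : ℝ) ≤ (2 * ((lam - 1) * k) : ℕ) := by
    have := h.lam_ge
    exact_mod_cast (by nlinarith [Nat.sub_add_cancel (by omega : 1 ≤ lam)] :
      k * lam ≤ 2 * ((lam - 1) * k))
  push_cast at h5 h6
  have h7 := Real.log_two_gt_d9
  have h8 : 0 ≤ ((lam - 1 : ℕ) : ℝ) * k := by positivity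
  nlinarith

end Params
end JuntaLearning

/-! ### Size bounds and the two programs -/

namespace JuntaLearning

open Finset

/-- This keeps `(log n) ^ d` polynomial in `d ^ d` and `n`: the rising factorial `(L + 1) ⋯ (L + d)`
equals `d!` times a binomial coefficient. -/
theorem pow_le_pow_self_mul (L d : ℕ) : L ^ d ≤ d ^ d * 2 ^ (L + d) := by
  calc L ^ d ≤ (L + 1) ^ d := Nat.pow_le_pow_left (by omega) d
    _ ≤ (L + 1).ascFactorial d := Nat.pow_succ_le_ascFactorial _ _
    _ = d.factorial * (L + d).choose d := Nat.ascFactorial_eq_factorial_mul_choose _ _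
    _ ≤ _ := Nat.mul_le_mul (Nat.factorial_le_pow d) (Nat.choose_le_two_pow _ _)

/-- All registers are at most this. -/
def bound (n d : ℕ) : ℕ := (d ^ d + n) ^ 24

namespace Params

variable {n d L q k lam : ℕ} (h : Params n d L q k lam)
include h

theorem two_pow_le : 2 ^ d ≤ d ^ d + n := by
  have h1 := h.d_pos
  have h2 := h.n_ge
  rcases Nat.lt_or_ge d 2 with hd | hd
  · obtain rfl : d = 1 := by omega
    omega
  · exact (Nat.pow_le_pow_left hd d).trans (Nat.le_add_right _ _)

theorem size_ge : 3 ≤ d ^ d + n := by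
  have := Nat.one_le_pow d d h.d_pos
  have := h.n_ge
  omega

/-- In `(8 * d ^ 2 * L) ^ d` the factor `8 ^ d` is `(2 ^ d) ^ 3`, the next is `(d ^ d) ^ 2`, and `L
^ d ≤ d ^ d * 2 ^ L * 2 ^ d` with `2 ^ L ≤ 2 * n`. -/
theorem pow_le_size : q ^ d ≤ (d ^ d + n) ^ 9 := by
  set Z := d ^ d + n with hZ
  have hdZ : d ^ d ≤ Z := Nat.le_add_right _ _
  have hnZ : n ≤ Z := Nat.le_add_left _ _
  have h2 := h.two_pow_le
  have hZ3 := h.size_ge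
  have hL : 2 ^ L ≤ 2 * n := by
    have hlt : 2 ^ (L - 1) < n := by
      rw [← Nat.lt_clog_iff_pow_lt (by norm_num), ← h.log_eq]
      have := h.log_pos; omega
    have : 2 ^ L = 2 * 2 ^ (L - 1) := by
      rw [← pow_succ', Nat.sub_add_cancel h.log_pos]
    omega
  calc q ^ d ≤ (8 * d ^ 2 * L) ^ d := Nat.pow_le_pow_left h.le d
    _ = (2 ^ d) ^ 3 * (d ^ d) ^ 2 * L ^ d := by
        rw [mul_pow, mul_pow, ← pow_mul, ← pow_mul, ← pow_mul, mul_comm d 3, pow_mul 2 3 d,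
          mul_comm d 2]
        norm_num
    _ ≤ (2 ^ d) ^ 3 * (d ^ d) ^ 2 * (d ^ d * (2 ^ L * 2 ^ d)) := by
        rw [← pow_add]; gcongr; exact pow_le_pow_self_mul L d
    _ ≤ Z ^ 3 * Z ^ 2 * (Z * (2 * Z * Z)) := by
        gcongr
        exact hL.trans (by omega)
    _ = 2 * Z ^ 8 := by ring
    _ ≤ Z * Z ^ 8 := by gcongr; omega
    _ = _ := by ring

theorem le_size : q ≤ (d ^ d + n) ^ 9 :=
  (Nat.le_self_pow (by have := h.d_pos; omega) q).trans h.pow_le_size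

theorem rounds_le : rounds d lam ≤ (d ^ d + n) ^ 15 := by
  have hdn : d ≤ d ^ d + n := h.d_le.trans (Nat.le_add_left _ _)
  have h2 := h.two_pow_le
  have h3 := h.lam_le.trans h.le_size
  have h4 := h.size_ge
  set Z := d ^ d + n
  have h5 : 32 ≤ Z ^ 4 := by
    calc 32 ≤ 3 ^ 4 := by norm_num
      _ ≤ _ := Nat.pow_le_pow_left h4 4
  calc rounds d lam ≤ Z ^ 4 * Z * Z ^ 9 * Z := by rw [rounds]; gcongr
    _ = _ := by ring

theorem pow_le_bound {i v : ℕ} (hv : v ≤ (d ^ d + n) ^ i) (hi : i ≤ 24) : v ≤ bound n d :=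
  hv.trans (Nat.pow_le_pow_right (by have := h.size_ge; omega) hi)

/-- Exponents `9` for the hash functions and `15` for the rounds give the `24` in `bound`. -/
theorem queries_le : 2 * d ^ 2 * k * rounds d lam ≤ bound n d := by
  refine h.pow_le_bound (i := 24) ?_ le_rfl
  calc _ ≤ (d ^ d + n) ^ 9 * (d ^ d + n) ^ 15 :=
        Nat.mul_le_mul (h.hashes_le.trans h.le_size) h.rounds_le
    _ = _ := by ring

/-- The contents of the registers are bounded. -/
theorem registers_le {r₀ : ℕ} (h₀ : r₀ = n ∨ r₀ = 2 * d ^ 2 * k * rounds d lam) :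
    ∀ y ∈ [r₀, d, n, 8 * n ^ 3, L, 4 * d ^ 2 * L, q, k, lam, 2 * d ^ 2 * k, 2 ^ d, q ^ d, q ^ (2 * d), q ^ (2 * d) + n, rounds d lam, 2 * 2 ^ d,
    2 * d ^ 2 * k * rounds d lam, d], y ≤ bound n d := by
  have hn : n ≤ (d ^ d + n) ^ 1 := by rw [pow_one]; exact Nat.le_add_left _ _
  have hZ := h.size_ge
  have hnB := h.pow_le_bound hn (by norm_num)
  have hq := h.pow_le_bound h.le_size (by norm_num)
  have hpow : q ^ (2 * d) ≤ (d ^ d + n) ^ 18 := by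
    rw [mul_comm, pow_mul]
    exact (Nat.pow_le_pow_left h.pow_le_size 2).trans_eq (by ring)
  have hpown : q ^ (2 * d) + n ≤ (d ^ d + n) ^ 19 := by
    have : d ^ d + n ≤ (d ^ d + n) ^ 18 := Nat.le_self_pow (by norm_num) _
    rw [pow_succ]; nlinarith
  have hcap : 8 * n ^ 3 ≤ (d ^ d + n) ^ 5 := by
    rw [pow_one] at hn
    calc _ ≤ 3 ^ 2 * n ^ 3 := by gcongr; norm_num
      _ ≤ (d ^ d + n) ^ 2 * (d ^ d + n) ^ 3 := by gcongr
      _ = _ := by ring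
  have h2 : 2 * 2 ^ d ≤ (d ^ d + n) ^ 2 := by
    rw [sq]; exact Nat.mul_le_mul (by omega) h.two_pow_le
  have hL := h.log_le
  have hd := h.d_le
  have hk := h.digits_le_log
  have hQ := h.queries_le
  have e1 := h.pow_le_bound hcap (by norm_num)
  have e2 := h.lt
  have e3 := h.lam_le
  have e4 := h.hashes_le
  have e5 := h.pow_le_bound h2 (by norm_num)
  have e6 := h.pow_le_bound h.pow_le_size (by norm_num)
  have e7 := h.pow_le_bound hpown (by norm_num)
  have e8 := h.pow_le_bound h.rounds_le (by norm_num)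
  intro y hy
  simp only [List.mem_cons, List.not_mem_nil, or_false] at hy
  rcases hy with rfl | rfl | rfl | rfl | rfl | rfl | rfl | rfl | rfl | rfl | rfl | rfl | rfl |
    rfl | rfl | rfl | rfl | rfl <;> omega

end Params

/-! The programs. -/

/-- A step of a program: the assignment of a term to a register, or a statement. -/
inductive Block where
  | set (x : ℕ) (e : Term)
  | act (p : Stmt)

/-- The program of a list of blocks. -/
def blocks : List Block → Prog
  | [] => .skip
  | .set x e :: l => .seq (assignTerm x e) (blocks l)
  | .act p :: l => .seq (p.compile 32) (blocks l)

/-- The exponent in the time bound of a list of blocks. -/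
def blocksWeight : List Block → ℕ
  | [] => 0
  | .set _ e :: l => e.weight + 1 + blocksWeight l + 1
  | .act p :: l => p.weight + blocksWeight l + 1

/-- From registers `l` and memory `M`, the blocks lead to registers `l'` and memory `M'`. -/
def BlocksLead (B : ℕ) (bs : List Block) (l : List ℕ) (M : ℕ → ℕ → ℕ) (l' : List ℕ)
    (M' : ℕ → ℕ → ℕ) : Prop :=
  Leads B (blocks bs) (blocksWeight bs) (regs l) M (regs l') M'

namespace BlocksLead

variable {B : ℕ} {bs : List Block} {l l' : List ℕ} {M M' : ℕ → ℕ → ℕ}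

theorem nil : BlocksLead B [] l M l M :=
  fun s hs hm => ⟨1, s, Exec.skip s, by simp [blocksWeight], hs, hm⟩

theorem push (v : ℕ) {e : Term} (he : e.Below 32) (hB : ∀ y ∈ l, y ≤ B)
    (hv : e.eval M (regs l) = v) (h : BlocksLead B bs (l ++ [v]) M l' M') :
    BlocksLead B (.set l.length e :: bs) l M l' M' :=
  (Leads.push l v he hB hv).seq h

theorem replace {v₀ : ℕ} (v : ℕ) {e : Term} (he : e.Below 32) (hB : ∀ y ∈ v₀ :: l, y ≤ B)
    (hv : e.eval M (regs (v₀ :: l)) = v) (h : BlocksLead B bs (v :: l) M l' M') :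
    BlocksLead B (.set 0 e :: bs) (v₀ :: l) M l' M' :=
  (Leads.replace v₀ l v he hB hv).seq h

theorem act {p : Stmt} (hp : p.Below 32) (hB : ∀ y ∈ l, y ≤ B)
    (h : BlocksLead B bs l (p.run (regs l) M) l' M') :
    BlocksLead B (.act p :: bs) l M l' M' :=
  (Leads.stmt hp fun y _ => regs_le hB y).seq h

end BlocksLead

open Term Stmt

/-- The program that asks the queries. -/
def askBlocks : List Block :=
  -- The input `n` is moved away because register `0` finally receives the number of queries. No
  -- product is clipped: `d`, `L` and `k` are at most `n`, `lam` is at most `q`, and `32 ≤ 8 * n ^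
  -- 3`.
  [.set 2 (var 0), .set 3 (times 2 (times 2 (mul 2 (const 8) (var 2)))), .act powersOfTwo,
    .set 4 (sum 20 2 (Term.ite (load 4 (var 20)) (var 2) (const 1) (const 0))),
    .set 5 (mul 2 (mul 2 (add (add (var 1) (var 1)) (add (var 1) (var 1))) (var 1)) (var 4)),
    .set 6 nextPrime, .act powersOfQ,
    .set 7 (sum 20 2 (Term.ite (load 5 (var 20)) (var 2) (const 1) (const 0))),
    .set 8 (sum 20 6 (Term.ite (load 4 (var 20)) (var 6) (const 1) (const 0))),
    .set 9 (mul 2 (mul 2 (add (var 1) (var 1)) (var 1)) (var 7)), .set 10 (load 4 (var 1)),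
    .set 11 (load 5 (var 1)), .set 12 (load 5 (add (var 1) (var 1))),
    .set 13 (add (var 12) (var 2)),
    .set 14 (mul 2 (mul 6 (mul 3 (var 10) (const 32)) (var 8)) (var 1)),
    .set 15 (add (var 10) (var 10)), .set 16 (times 14 (var 9)), .act polyTable,
    .act initLabels, .act greedy, .act writeQueries, .set 0 (var 16)]

/-- The program that computes the hypothesis. -/
def reconstructBlocks : List Block :=
  [.act findClasses, .act findRelevant, .set 17 (sum 20 2 (load 11 (var 20))),
    .act listRelevant, .act writeTable, .set 0 (var 17)]

/-- The registers `1`, …, `16` after the parameters have been computed. -/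
def paramList (n d L q k lam : ℕ) : List ℕ :=
  [d, n, 8 * n ^ 3, L, 4 * d ^ 2 * L, q, k, lam, 2 * d ^ 2 * k, 2 ^ d, q ^ d, q ^ (2 * d),
    q ^ (2 * d) + n, rounds d lam, 2 * 2 ^ d, 2 * d ^ 2 * k * rounds d lam]

theorem isEnv_paramList (r₀ n d L q k lam : ℕ) :
    IsEnv (regs (r₀ :: paramList n d L q k lam)) n d q (2 * d ^ 2 * k) (rounds d lam) := by
  constructor <;> rfl

/-- The memory when the queries are asked, from the memory `M` that holds the powers. -/
def askMemory (ρ : ℕ → ℕ) (M : ℕ → ℕ → ℕ) : ℕ → ℕ → ℕ :=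
  writeQueries.run ρ (greedy.run ρ (initLabels.run ρ (polyTable.run ρ M)))

theorem exists_params {n d : ℕ} (hn : 2 ≤ n) (hd : 1 ≤ d) (hdn : d ≤ n) :
    ∃ L q k lam, Params n d L q k lam ∧
      ∀ M ρ, ρ 5 = 4 * d ^ 2 * L → ρ 3 = 8 * n ^ 3 → nextPrime.eval M ρ = q := by
  have hL : 1 ≤ Nat.clog 2 n := Nat.clog_pos (by norm_num) hn
  obtain ⟨q, hq, h1, h2, h3⟩ := exists_eval_nextPrime (X := 4 * d ^ 2 * Nat.clog 2 n)
    (Nat.mul_pos (by positivity) hL)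
  have h : Params n d (Nat.clog 2 n) q (Nat.clog q n) (Nat.clog 2 q) :=
    ⟨hn, hd, hdn, rfl, hq, h1, h2.trans_eq (by ring), rfl, rfl⟩
  refine ⟨_, q, _, _, h, fun M ρ h5 hr => h3 M ρ h5 ?_⟩
  have := h.le_cube
  rw [hr]
  refine le_trans (le_of_eq ?_) this
  ring

theorem eval_clog {M : ℕ → ℕ → ℕ} {ρ : ℕ → ℕ} {a b p n : ℕ} (hb : 2 ≤ b) (hn : ρ p = n)
    (hp : p ≠ 20) (hM : ∀ j < n, M a j = b ^ j) :
    (sum 20 p (Term.ite (load a (var 20)) (var p) (const 1) (const 0))).eval M ρ =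
      Nat.clog b n := by
  rw [← sum_eq_clog hb, eval, hn]
  refine sum_congr rfl fun i hi => ?_
  simp [eval, hM i (mem_range.1 hi), hp, hn]

/-- The query program computes the parameters and runs the phases. -/
theorem exists_ask {n d : ℕ} (hn : 2 ≤ n) (hd : 1 ≤ d) (hdn : d ≤ n) : ∃ L q k lam,
    Params n d L q k lam ∧ ∃ M : ℕ → ℕ → ℕ,
      (∀ j ≤ d, M 4 j = 2 ^ j) ∧ (∀ v, M 6 v = 0) ∧
      BlocksLead (bound n d) askBlocks [n, d] (fun _ _ => 0)
        (2 * d ^ 2 * k * rounds d lam :: paramList n d L q k lam)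
        (askMemory (regs (n :: paramList n d L q k lam)) M) := by
  obtain ⟨L, q, k, lam, h, hqe⟩ := exists_params hn hd hdn
  refine ⟨L, q, k, lam, h, ?_⟩
  set M₁ := powersOfTwo.run (regs [n, d, n, 8 * n ^ 3]) (fun _ _ => 0) with hM₁
  set M₂ := powersOfQ.run (regs [n, d, n, 8 * n ^ 3, L, 4 * d ^ 2 * L, q]) M₁ with hM₂
  have hn3 := Nat.le_self_pow (n := 3) (by norm_num) n
  have h32 : 32 ≤ 8 * n ^ 3 := by
    have := Nat.pow_le_pow_left hn 3
    omega
  have hqcap := h.le.trans h.le_cube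
  have hdq := h.four_mul_lt
  have h4 : ∀ j ≤ 8 * n ^ 3, M₁ 4 j = 2 ^ j :=
    run_powersOfTwo (ρ := regs [n, d, n, 8 * n ^ 3])
  have h5 : ∀ j ≤ 8 * n ^ 3, M₂ 5 j = q ^ j :=
    run_powersOfQ (ρ := regs [n, d, n, 8 * n ^ 3, L, 4 * d ^ 2 * L, q])
  have h4' : M₂ 4 = M₁ 4 := run_frame _ _ _ (by simp [powersOfQ, Writes])
  have h6 : M₂ 6 = fun _ => 0 := by
    rw [hM₂, run_frame _ _ _ (by simp [powersOfQ, Writes]), hM₁,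
      run_frame _ _ _ (by simp [powersOfTwo, Writes])]
  refine ⟨M₂, fun j hj => by rw [h4']; exact h4 j (by omega), fun v => by rw [h6], ?_⟩
  have hB : ∀ j, ∀ y ∈ (n :: paramList n d L q k lam).take j, y ≤ bound n d := by
    intro j y hy
    exact h.registers_le (Or.inl rfl) y (by
      have := List.mem_of_mem_take hy
      simp only [paramList, List.mem_cons, List.not_mem_nil, or_false] at this ⊢
      tauto)
  have hkn : k ≤ n := h.digits_le_log.trans h.log_le
  have hLn := h.log_le
  unfold askBlocks
  refine .push n (by decide) (hB 2) rfl ?_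
  refine .push (8 * n ^ 3) (by decide) (hB 3) ?_ ?_
  · simp [eval, eval_times, regs]; ring
  refine .act (by decide) (hB 4) ?_
  change BlocksLead _ _ [n, d, n, 8 * n ^ 3] M₁ _ _
  refine .push L (by decide) (hB 4) ?_ ?_
  · rw [h.log_eq]
    exact eval_clog le_rfl rfl (by norm_num) fun j hj => h4 j (by omega)
  refine .push (4 * d ^ 2 * L) (by decide) (hB 5) ?_ ?_
  · have h1 : min d n = d := min_eq_left hdn
    have h2 : min L n = L := min_eq_left hLn
    simp only [eval, regs, List.cons_append, List.nil_append, List.getD_cons_succ,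
      List.getD_cons_zero, h1, h2]
    ring
  refine .push q (by decide) (hB 6) (hqe _ _ rfl rfl) ?_
  refine .act (by decide) (hB 7) ?_
  change BlocksLead _ _ ((n :: paramList n d L q k lam).take 7) M₂ _ _
  refine .push k (by decide) (hB 7) ?_ ?_
  · rw [h.digits_eq]
    exact eval_clog h.prime.two_le rfl (by norm_num) fun j hj => h5 j (by omega)
  refine .push lam (by decide) (hB 8) ?_ ?_
  · rw [h.lam_eq]
    exact eval_clog le_rfl rfl (by norm_num) fun j hj => by rw [h4']; exact h4 j (by omega)
  refine .push (2 * d ^ 2 * k) (by decide) (hB 9) ?_ ?_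
  · have h1 : min d n = d := min_eq_left hdn
    have h2 : min k n = k := min_eq_left hkn
    simp only [eval, regs, paramList, List.take_succ_cons, List.take_zero, List.cons_append,
      List.nil_append, List.getD_cons_succ, List.getD_cons_zero, h1, h2]
    ring
  change BlocksLead _ _ ((n :: paramList n d L q k lam).take 10) M₂ _ _
  refine .push (2 ^ d) (by decide) (hB 10) ?_ ?_
  · exact (congrFun h4' d).trans (h4 d (by omega))
  refine .push (q ^ d) (by decide) (hB 11) (h5 d (by omega)) ?_
  refine .push (q ^ (2 * d)) (by decide) (hB 12) ?_ ?_
  · rw [two_mul]; exact h5 (d + d) (by omega)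
  refine .push (q ^ (2 * d) + n) (by decide) (hB 13) rfl ?_
  change BlocksLead _ _ ((n :: paramList n d L q k lam).take 14) M₂ _ _
  refine .push (rounds d lam) (by decide) (hB 14) ?_ ?_
  · have h1 : min d n = d := min_eq_left hdn
    have h2 : min lam q = lam := min_eq_left h.lam_le
    have h3 : min 32 (8 * n ^ 3) = 32 := min_eq_left h32
    simp only [eval, regs, paramList, List.take_succ_cons, List.getD_cons_succ,
      List.getD_cons_zero, h1, h2, h3, rounds]
    ring
  refine .push (2 * 2 ^ d) (by decide) (hB 15) (two_mul _).symm ?_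
  refine .push (2 * d ^ 2 * k * rounds d lam) (by decide) (hB 16) (eval_times _ _ _ _) ?_
  change BlocksLead _ _ (n :: paramList n d L q k lam) M₂ _ _
  refine .act (by decide) (hB 17) ?_
  refine .act (by decide) (hB 17) ?_
  refine .act (by decide) (hB 17) ?_
  refine .act (by decide) (hB 17) ?_
  exact .replace _ (by decide) (hB 17) rfl .nil

end JuntaLearning

/-! ### Assembly: correctness, queries and time -/

namespace JuntaLearning

open Finset Term Stmt

/-- The memory when the queries are asked. -/
theorem askMemory_spec {n d L q k lam : ℕ} (h : Params n d L q k lam) {ρ : ℕ → ℕ}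
    (hρ : IsEnv ρ n d q (2 * d ^ 2 * k) (rounds d lam)) {M : ℕ → ℕ → ℕ}
    (h4 : ∀ j ≤ d, M 4 j = 2 ^ j) (h6 : ∀ v, M 6 v = 0) :
    HasTables (askMemory ρ M) n d q ∧ (∀ r < rounds d lam, askMemory ρ M 7 r < q ^ (2 * d)) ∧
      Determining q d (rounds d lam) (askMemory ρ M 7) ∧
      ∀ α < 2 * d ^ 2 * k, ∀ r < rounds d lam, ∀ i < n,
        askMemory ρ M 0 ((α * rounds d lam + r) * n + i) =
          if bitAt q (askMemory ρ M 7 r) (polyVal q i α) then 1 else 0 := by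
  have hdq := h.four_mul_lt
  set M₁ := polyTable.run ρ M with hM₁
  set M₂ := initLabels.run ρ M₁ with hM₂
  set M₃ := greedy.run ρ M₂ with hM₃
  have ht₁ : HasTables M₁ n d q := by
    refine ⟨fun j hj => ?_, ?_⟩
    · rw [hM₁, run_frame _ _ _ (by simp [polyTable, Writes])]; exact h4 j hj
    · have := run_polyTable (ρ := ρ) (by rw [hρ.r6]; exact h.prime.two_le) h6
      rwa [hρ.r6, hρ.r13] at this
  have ht₂ : HasTables M₂ n d q := ht₁.congr (run_frame _ _ _ (by simp [initLabels, Writes]))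
    (run_frame _ _ _ (by simp [initLabels, Writes]))
  have ht₃ : HasTables M₃ n d q :=
    ht₂.congr (run_frame _ _ _ (by simp [greedy, Stmt.choose, mergeLabels, Writes]))
      (run_frame _ _ _ (by simp [greedy, Stmt.choose, mergeLabels, Writes]))
  obtain ⟨hlt, hmax⟩ := run_greedy hρ ht₂ h.prime.pos (by omega) (run_initLabels hρ M₁)
  have hq := run_writeQueries hρ ht₃ h.hashes_le hlt
  have hf : ∀ a, a ≠ 0 → askMemory ρ M a = M₃ a := fun a ha =>
    run_frame _ _ _ (by simp [writeQueries, Writes, ha])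
  rw [hf 7 (by norm_num)]
  exact ⟨ht₃.congr (hf 4 (by norm_num)) (hf 6 (by norm_num)), hlt,
    determining_of_greedy h.prime hdq h.odd hmax h.pairs_lt h.rounds_ge, hq⟩

/-- The answers are the values of the hashed functions. -/
theorem hasAnswers_answer {n d q m N : ℕ} {s : State}
    (hs : s.reg 0 = m * N)
    (ht : HasTables s.mem n d q) (hlt : ∀ r < N, s.mem 7 r < q ^ (2 * d))
    (hdet : Determining q d N (s.mem 7))
    (hq : ∀ α < m, ∀ r < N, ∀ i < n,
      s.mem 0 ((α * N + r) * n + i) =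
        if bitAt q (s.mem 7 r) (polyVal q i α) then 1 else 0) (f : (Fin n → Bool) → Bool) :
    HasAnswers (answer f s).mem d q m N f := by
  have hf : ∀ a, a ≠ 1 → (answer f s).mem a = s.mem a := fun a ha => by
    funext j; simp [answer, ha]
  refine ⟨ht.congr (hf 4 (by norm_num)) (hf 6 (by norm_num)), ?_, ?_, fun α hα r hr => ?_⟩
  · rw [hf 7 (by norm_num)]; exact hlt
  · rw [hf 7 (by norm_num)]; exact hdet
  · have hj : α * N + r < numQueries s := by
      rw [numQueries, hs]; nlinarith
    rw [hf 7 (by norm_num)]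
    simp only [answer, hj, and_self, if_true, hashed]
    congr 2
    funext i
    rw [query, hq α hα r hr i i.2]
    cases bitAt q (s.mem 7 r) (polyVal q i α) <;> simp

/-- The reconstruction program computes a hypothesis for the target. -/
theorem exists_exec_reconstruct {n d L q k lam : ℕ} (h : Params n d L q k lam)
    {f : (Fin n → Bool) → Bool} (hf : f ∈ Junta n d) {s : State}
    (hs : ∀ x < 32, s.reg x = regs (2 * d ^ 2 * k * rounds d lam :: paramList n d L q k lam) x)
    (hM : HasAnswers s.mem d q (2 * d ^ 2 * k) (rounds d lam) f)
    (hq : ∀ α < 2 * d ^ 2 * k, ∀ r < rounds d lam, ∀ i < n,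
      s.mem 0 ((α * rounds d lam + r) * n + i) =
        if bitAt q (s.mem 7 r) (polyVal q i α) then 1 else 0) :
    ∃ t s', Exec (blocks reconstructBlocks) s t s' ∧
      t ≤ (bound n d + 10) ^ blocksWeight reconstructBlocks ∧ Outputs d s' f := by
  have hdq := h.four_mul_lt
  set r₀ := 2 * d ^ 2 * k * rounds d lam
  set l := paramList n d L q k lam with hl
  set ρ := regs (r₀ :: l) with hρ
  have henv : IsEnv ρ n d q (2 * d ^ 2 * k) (rounds d lam) := isEnv_paramList ..
  set M₂ := findRelevant.run ρ (findClasses.run ρ s.mem) with hM₂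
  set w := ∑ i ∈ range n, M₂ 11 i with hw
  have key : ∀ s' : State,
      s'.mem = writeTable.run (Function.update ρ 17 w)
        (listRelevant.run (Function.update ρ 17 w) M₂) →
      s'.reg 0 = w → Outputs d s' f := fun s' hs' h0 =>
    outputs_of_reconstruct henv hM h.prime hf h.le_pow h.digits_pos le_rfl h.hashes_le h.d_pos
      (by omega) hq hM₂ hw rfl hs' h0
  -- The bound on the arity is needed before the program is known to halt, since register `17`
  -- limits a loop. It follows from correctness applied to an artificial final state.
  have hwd : w ≤ d := (key ⟨fun _ => w, _⟩ rfl rfl).1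
  have hB := h.registers_le (Or.inr rfl)
  have hB₁ : ∀ y ∈ r₀ :: l, y ≤ bound n d := fun y hy => hB y (by
    simp only [hl, paramList, List.mem_cons, List.not_mem_nil, or_false] at hy ⊢
    tauto)
  have hB₂ : ∀ y ∈ r₀ :: (l ++ [w]), y ≤ bound n d := by
    intro y hy
    rw [← List.cons_append, List.mem_append, List.mem_singleton] at hy
    rcases hy with hy | rfl
    · exact hB₁ y hy
    · exact hwd.trans (hB d (by simp))
  have hregs : regs (r₀ :: (l ++ [w])) = Function.update ρ 17 w := regs_append (r₀ :: l) w
  have hlead : BlocksLead (bound n d) reconstructBlocks (r₀ :: l) s.mem (w :: (l ++ [w]))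
      (writeTable.run (Function.update ρ 17 w) (listRelevant.run (Function.update ρ 17 w) M₂)) := by
    unfold reconstructBlocks
    rw [← hregs]
    refine .act (by decide) hB₁ ?_
    refine .act (by decide) hB₁ ?_
    refine .push w (by decide) hB₁ rfl ?_
    refine .act (by decide) hB₂ ?_
    refine .act (by decide) hB₂ ?_
    exact .replace w (by decide) hB₂ ((congrFun hregs 17).trans (Function.update_self ..)) .nil
  obtain ⟨t, s', h1, h2, h3, h4⟩ := hlead s hs rfl
  exact ⟨t, s', h1, h2, key s' h4 (h3 0 (by norm_num))⟩

/-- The number of queries. -/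
theorem Params.queries_le_log {n d L q k lam : ℕ} (h : Params n d L q k lam) {c : ℕ}
    (hc : 1344 ≤ c) : ((2 * d ^ 2 * k * rounds d lam : ℕ) : ℝ) ≤
      (c : ℝ) * ((d : ℝ) ^ 3 * 2 ^ d * Real.log n) := by
  have h1 := h.digits_mul_lam_le
  have hc' : (1344 : ℝ) ≤ c := by exact_mod_cast hc
  have hlog : 0 ≤ Real.log n := Real.log_natCast_nonneg n
  calc ((2 * d ^ 2 * k * rounds d lam : ℕ) : ℝ) = 64 * (d ^ 3 * 2 ^ d) * (k * lam) := by
        rw [rounds]; push_cast; ring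
    _ ≤ 64 * (d ^ 3 * 2 ^ d) * (21 * Real.log n) := by gcongr
    _ = 1344 * (d ^ 3 * 2 ^ d * Real.log n) := by ring
    _ ≤ _ := by gcongr

/-- The total time. -/
theorem Params.time_le {n d L q k lam : ℕ} (h : Params n d L q k lam) {w w' c t t' Q : ℕ}
    (ht : t ≤ (bound n d + 10) ^ w) (ht' : t' ≤ (bound n d + 10) ^ w') (hQ : Q ≤ bound n d)
    (hc : 27 * (w + w') + 25 ≤ c) : t + Q * n + t' ≤ c * (d ^ d + n) ^ c := by
  have hZ := h.size_ge
  have hn : n ≤ d ^ d + n := Nat.le_add_left _ _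
  -- The exponent is `24` from `bound`, plus `3` to absorb the summand `10`.
  have hB : bound n d + 10 ≤ (d ^ d + n) ^ 27 := by
    have h1 : 3 ^ 3 ≤ (d ^ d + n) ^ 3 := Nat.pow_le_pow_left hZ 3
    have h2 : 1 ≤ bound n d := Nat.one_le_pow _ _ (by omega)
    have h3 : (d ^ d + n) ^ 27 = bound n d * (d ^ d + n) ^ 3 := by rw [bound]; ring
    rw [h3]; nlinarith
  have hpow : ∀ v, 27 * v ≤ c → (bound n d + 10) ^ v ≤ (d ^ d + n) ^ c := fun v hv =>
    (Nat.pow_le_pow_left hB v).trans (by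
      rw [← pow_mul]; exact Nat.pow_le_pow_right (by omega) hv)
  have h1 := hpow w (by omega)
  have h2 := hpow w' (by omega)
  have h3 : Q * n ≤ (d ^ d + n) ^ c := by
    calc Q * n ≤ (d ^ d + n) ^ 24 * (d ^ d + n) := Nat.mul_le_mul hQ hn
      _ = (d ^ d + n) ^ 25 := by ring
      _ ≤ _ := Nat.pow_le_pow_right (by omega) (by omega)
  have h4 : 3 * (d ^ d + n) ^ c ≤ c * (d ^ d + n) ^ c := Nat.mul_le_mul_right _ (by omega)
  omega

/-- The algorithm learns juntas. -/
theorem learnsJunta_blocks {n d c : ℕ} (hn : 2 ≤ n) (hd : 1 ≤ d) (hdn : d ≤ n)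
    (hc : 27 * (blocksWeight askBlocks + blocksWeight reconstructBlocks) + 1344 ≤ c) :
    LearnsJunta (blocks askBlocks) (blocks reconstructBlocks) n d
      ((c : ℝ) * ((d : ℝ) ^ 3 * 2 ^ d * Real.log n)) (c * (d ^ d + n) ^ c) := by
  obtain ⟨L, q, k, lam, h, M, h4, h6, hlead⟩ := exists_ask hn hd hdn
  obtain ⟨t, s, he, ht, hr, hm⟩ := hlead (start n d)
    (fun x _ => by rcases x with _ | _ | x <;> simp [start, regs]) rfl
  obtain ⟨htab, hlt, hdet, hq⟩ := askMemory_spec h (isEnv_paramList n n d L q k lam) h4 h6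
  rw [← hm] at htab hlt hdet hq
  have h0 : numQueries s = 2 * d ^ 2 * k * rounds d lam := hr 0 (by norm_num)
  refine ⟨t, s, he, ?_, fun f hf => ?_⟩
  · rw [h0]; exact h.queries_le_log ((Nat.le_add_left _ _).trans hc)
  have hf0 : ∀ a, a ≠ 1 → (answer f s).mem a = s.mem a := fun a ha => by
    funext j; simp [answer, ha]
  obtain ⟨t', s', he', ht', hout⟩ := exists_exec_reconstruct h hf (s := answer f s) hr
    (hasAnswers_answer h0 htab hlt hdet hq f)
    (by rw [hf0 0 (by norm_num), hf0 7 (by norm_num)]; exact hq)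
  exact ⟨t', s', he', hout, h.time_le ht ht' (h0 ▸ h.queries_le)
    ((Nat.add_le_add_left (by norm_num) _).trans hc)⟩

end JuntaLearning

theorem theorem3 :
    ∃ (ask reconstruct : JuntaLearning.Prog) (c : ℕ),
      ∀ n d : ℕ, 2 ≤ n → 1 ≤ d → d ≤ n →
        JuntaLearning.LearnsJunta ask reconstruct n d
          ((c : ℝ) * ((d : ℝ) ^ 3 * 2 ^ d * Real.log n)) (c * (d ^ d + n) ^ c) := by
  -- One constant serves both bounds: `27` per unit of weight for the time, and `1344 = 64 * 21` for
  -- the queries.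
  obtain ⟨c, hc⟩ : ∃ c, 27 * (JuntaLearning.blocksWeight JuntaLearning.askBlocks +
      JuntaLearning.blocksWeight JuntaLearning.reconstructBlocks) + 1344 ≤ c := ⟨_, le_rfl⟩
  exact ⟨_, _, c, fun n d hn hd hdn => JuntaLearning.learnsJunta_blocks hn hd hdn hc⟩
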